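/- **Theorem.** Let $G=(V,E)$ be a finite directed graph without multiple edges and without loops (so $E\subset\{(x,y)\in V^2: x\neq y\}$), and let $\check G$ be its reversed graph, with edge set $\check E=\{(x,y):(y,x)\in E\}$. Assume that $G$ and $\check G$ are both 2-connected, where a directed graph is called 2-connected if it is strongly connected and remains strongly connected after the removal of any single vertex together with all edges coming from or going to it. Let $\omega=(\omega(x,y))_{(x,y)\in E}$ be a random environment on $G$: random variables on a probability space, with values in $[0,1]$, such that almost surely $\sum_{y:(x,y)\in E}\omega(x,y)=1$ for every $x\in V$. Assume that - $\mathbb E(\omega(x,y))>0$ for every edge $(x,y)\in E$; - the transition probabilities are independent across sites, i.e. the random vectors $(\omega(x,y))_{y:(x,y)\in E}$, $x\in V$, are independent; - almost surely $\omega$ has a stationary distribution $\pi$ (i.e. $\pi_x=\sum_{y:(y,x)\in E}\omega(y,x)\pi_y$ for all $x$, and $\sum_x\pi_x=1$) with $\pi_x>0$ for all $x\in V$, chosen measurably, so that the reversed environment $\check\omega(x,y)=\omega(y,x)\,\pi_y/\pi_x$, $(x,y)\in\check E$, is well defined on $\check G$. If the transition probabilities of the reversed environment are also independent across sites, i.e.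 the random vectors $(\check\omega(x,y))_{y:(x,y)\in\check E}$, $x\in V$, are independent, then - either $\omega$ is deterministic, i.e. almost surely equal to a fixed environment; - or there are positive weights $(\alpha_e)_{e\in E}$ of null divergence, i.e. $\sum_{y:(x,y)\in E}\alpha_{(x,y)}=\sum_{y:(y,x)\in E}\alpha_{(y,x)}$ for every $x\in V$, such that the vectors $(\omega(x,y))_{y:(x,y)\in E}$, $x\in V$, are independent and, for each $x$, the vector $(\omega(x,y))_{y:(x,y)\in E}$ has the Dirichlet distribution with parameters $(\alpha_{(x,y)})_{y:(x,y)\in E}$. Here the Dirichlet distribution with positive parameters $(\alpha_1,\dots,\alpha_n)$ is the law on the simplex $\{x\in(0,1]^n:\sum_i x_i=1\}$ with density $\frac{\Gamma(\sum_i\alpha_i)}{\prod_i\Gamma(\alpha_i)}\prod_i x_i^{\alpha_i-1}\,dx_1\cdots dx_{n-1}$ (the unit mass at the point $1$ if $n=1$). -/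

import Mathlib

open MeasureTheory ProbabilityTheory

namespace RandomEnvironment

noncomputable section

/-- The reversed graph: same vertices, all edges flipped. -/
def reverse {V : Type*} (G : Digraph V) : Digraph V where
  Adj x y := G.Adj y x

/-- The graph obtained by removing the vertex `x` and all the edges coming from or going to it. -/
def removeVertex {V : Type*} (G : Digraph V) (x : V) : Digraph {y : V // y ≠ x} where
  Adj a b := G.Adj a.1 b.1

/-- Every ordered pair of vertices is joined by a (possibly trivial) directed path. -/
def StronglyConnected {V : Type*} (G : Digraph V) : Prop :=
  ∀ x y : V, Relation.ReflTransGen G.Adj x y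

/-- Strongly connected, and still strongly connected after the removal of any single vertex. -/
def TwoConnected {V : Type*} (G : Digraph V) : Prop :=
  StronglyConnected G ∧ ∀ x : V, StronglyConnected (removeVertex G x)

/-- `w` is an environment on `G`: nonnegative weights on the edges (extended by `0` to the pairs
that are not edges), which sum to `1` over the edges leaving any given vertex. -/
structure IsEnvironment {V : Type*} [Fintype V] (G : Digraph V) (w : V → V → ℝ) : Prop where
  nonneg : ∀ x y, 0 ≤ w x y
  eq_zero_of_not_adj : ∀ x y, ¬ G.Adj x y → w x y = 0
  sum_eq_one : ∀ x, ∑ y, w x y = 1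

/-- `p` is a stationary distribution of `w` that charges every vertex. -/
structure IsPositiveStationary {V : Type*} [Fintype V] (w : V → V → ℝ) (p : V → ℝ) : Prop where
  pos : ∀ x, 0 < p x
  sum_eq_one : ∑ x, p x = 1
  stationary : ∀ x, p x = ∑ y, w y x * p y

/-- The time reversal of the environment `w` with respect to the stationary distribution `p`. -/
def reversedEnvironment {V : Type*} (w : V → V → ℝ) (p : V → ℝ) : V → V → ℝ :=
  fun x y => w y x * (p y / p x)

/-- The transition probabilities of the random environment `w` at the different sites are
independent, i.e. the random vectors `w(x, ·)`, `x ∈ V`, are mutually independent. -/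
def IndependentSites {Ω V : Type*} [MeasurableSpace Ω] (P : Measure Ω) (w : Ω → V → V → ℝ) : Prop :=
  iIndepFun (fun (x : V) (s : Ω) => w s x) P

/-- The point of the hyperplane `∑ i, x i = 1` whose coordinates other than `i₀` are given by `z`. -/
def simplexPoint {ι : Type*} [Fintype ι] [DecidableEq ι] (i₀ : ι) (z : {i : ι // i ≠ i₀} → ℝ) :
    ι → ℝ :=
  fun i => if h : i = i₀ then 1 - ∑ j, z j else z ⟨i, h⟩

/-- The Dirichlet density, on the open simplex `{x | ∀ i, 0 < x i, ∑ i, x i = 1}`. -/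
def dirichletDensity {ι : Type*} [Fintype ι] (a : ι → ℝ) (x : ι → ℝ) : ENNReal :=
  open Classical in
  if ∀ i, 0 < x i then
    ENNReal.ofReal
      (Real.Gamma (∑ i, a i) / (∏ i, Real.Gamma (a i)) * ∏ i, x i ^ (a i - 1))
  else 0

/-- The Dirichlet distribution of parameters `a`, on the simplex parametrised by all the coordinates
except the one with index `i₀`: density `dirichletDensity a` with respect to
`∏_{i ≠ i₀} d x_i`. -/
def dirichletMeasure {ι : Type*} [Fintype ι] [DecidableEq ι] (a : ι → ℝ) (i₀ : ι) :
    Measure (ι → ℝ) :=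
  Measure.map (simplexPoint i₀)
    ((volume : Measure ({i : ι // i ≠ i₀} → ℝ)).withDensity
      (fun z => dirichletDensity a (simplexPoint i₀ z)))

/-- The random vector `X` has the Dirichlet distribution of positive parameters `a`
(whichever coordinate is chosen to be eliminated). -/
structure HasDirichletLaw {Ω ι : Type*} [MeasurableSpace Ω] [Fintype ι] [DecidableEq ι]
    (P : Measure Ω) (X : Ω → ι → ℝ) (a : ι → ℝ) : Prop where
  nonempty : Nonempty ι
  pos : ∀ i, 0 < a i
  map_eq : ∀ i₀, Measure.map X P = dirichletMeasure a i₀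

/-- The edge weights `a` have null divergence: at every vertex, the total weight of the outgoing
edges is that of the incoming edges. -/
def NullDivergence {V : Type*} [Fintype V] (G : Digraph V) (a : V → V → ℝ) : Prop :=
  open Classical in
  ∀ x, ∑ y with G.Adj x y, a x y = ∑ y with G.Adj y x, a y x

/-- `w` is a Dirichlet environment on `G` with parameters `a`: the sites are independent, and for
each `x` the family `w(x, y)`, over the edges `(x, y)`, is Dirichlet of parameters `a(x, y)`. -/
def IsDirichletEnvironment {Ω V : Type*} [MeasurableSpace Ω] [Fintype V] (P : Measure Ω)
    (G : Digraph V) (w : Ω → V → V → ℝ) (a : V → V → ℝ) : Prop :=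
  open Classical in
  IndependentSites P w ∧
    ∀ x, HasDirichletLaw P (fun (s : Ω) (y : {y : V // G.Adj x y}) => w s x y) (fun y => a x y)

/-- The random environment `w` is deterministic: almost surely equal to a fixed environment. -/
def IsDeterministic {Ω V : Type*} [MeasurableSpace Ω] (P : Measure Ω) (w : Ω → V → V → ℝ) : Prop :=
  ∃ c : V → V → ℝ, ∀ᵐ s ∂P, w s = c

end

end RandomEnvironment

set_option linter.unusedSectionVars false

open RandomEnvironment

/-! Raise each ω(x,y) to an integer power n(x,y), where n is a flow (at every vertex as much comes
in as goes out). In the same product for the reversed environment the factors of the stationary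
distribution cancel, so the two products agree. Taking expectations, using independence of the sites
in both environments, and then logarithms, yields `IsReversiblePair.flowEquation`: a sum over
vertices of functions of the outgoing flow equals a sum over vertices of functions of the incoming
flow. The logarithms make sense because the moments are positive, which again uses independence of
the reversed environment. The rest of the proof solves this equation.

A flow is encoded as an integer matrix with zero row and column sums, the diagonal carrying minus
the flow through each vertex. Rows and columns are the vertices of a bipartite split graph, the
equation is a sum of local functions over them, and flows are perturbed along cycles of that graph.
If two cycles share one vertex only, the second difference of the equation along them reduces to
that vertex and vanishes there. 2-connectivity provides such cycles through `biconnectedIn` and a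
Menger theorem for two paths (`BiconnectedIn.fan`, `BiconnectedIn.linked`).

Let f(m) be the moments at x and e_y the unit flow to y. `mixed_difference_eq_zero` and
`third_difference_eq` show that f(m + e_y) / f(m + e_z) has the form a_y(m_y) / a_z(m_z). Together
with ∑ f(m + e_y) = f(m), this forces the a_y to be affine with a common slope c ≥ 0
(`UrnMoments.exists_isUrn`): the moments are those of a Pólya urn.

Two more differences compare the urns (b, c) of ω with the urns (b', c') of the reversed
environment: `edge_relation` gives c_x b'_{yx} = c'_y b_{xy} on each edge, and `vertex_relation`
gives the analogue for total weights at a vertex. By strong connectivity the slopes vanish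
everywhere or nowhere. In the first case each ω(x,y) has zero variance. In the second, α = b/c has
null divergence and the moments are those of Dirichlet laws, which they determine since the laws
live on a cube. -/

/-- `q` is joined to `p` by a path of the relation `r` whose vertices all lie in `S`. -/
def ReachIn {W : Type*} (r : W → W → Prop) (S : Set W) (p q : W) : Prop :=
  p ∈ S ∧ Relation.ReflTransGen (fun u v => r u v ∧ v ∈ S) p q

/-! ### Paths confined to a set of vertices -/

namespace ReachIn

variable {W : Type*} {r : W → W → Prop} {S T : Set W} {p q s : W}

theorem refl (h : p ∈ S) : ReachIn r S p p := ⟨h, .refl⟩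

theorem left_mem (h : ReachIn r S p q) : p ∈ S := h.1

theorem right_mem (h : ReachIn r S p q) : q ∈ S := by
  obtain ⟨h1, h2⟩ := h
  induction h2 with
  | refl => exact h1
  | tail _ h _ => exact h.2

theorem trans (h : ReachIn r S p q) (h' : ReachIn r S q s) : ReachIn r S p s :=
  ⟨h.1, h.2.trans h'.2⟩

theorem tail (h : ReachIn r S p q) (hr : r q s) (hs : s ∈ S) : ReachIn r S p s :=
  ⟨h.1, h.2.tail ⟨hr, hs⟩⟩

theorem mono (hST : S ⊆ T) (h : ReachIn r S p q) : ReachIn r T p q :=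
  ⟨hST h.1, Relation.ReflTransGen.mono (fun _ _ h => ⟨h.1, hST h.2⟩) _ _ h.2⟩

theorem single (hr : r p q) (hp : p ∈ S) (hq : q ∈ S) : ReachIn r S p q :=
  (refl hp).tail hr hq

theorem symm (hr : ∀ ⦃x y⦄, r x y → r y x) (h : ReachIn r S p q) : ReachIn r S q p := by
  obtain ⟨h1, h2⟩ := h
  induction h2 with
  | refl => exact refl h1
  | @tail b c hab hbc ih =>
    have hb : b ∈ S := right_mem ⟨h1, hab⟩
    exact (single (hr hbc.1) hbc.2 hb).trans ih

/-- A path stays inside the set of the vertices that it reaches. -/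
theorem reachable_set (h : ReachIn r S p q) : ReachIn r {u | ReachIn r S p u} p q := by
  obtain ⟨h1, h2⟩ := h
  induction h2 with
  | refl => exact refl (refl h1)
  | @tail b c hab hbc ih => exact ih.tail hbc.1 ⟨h1, hab.tail hbc⟩

/-- A path leading to `q ≠ p` can be cut at its first visit to `q`. -/
theorem exists_last_step (h : ReachIn r S p q) (hpq : p ≠ q) :
    ∃ s, ReachIn r (S \ {q}) p s ∧ r s q := by
  obtain ⟨h1, h2⟩ := h
  have key : ∀ w, Relation.ReflTransGen (fun u v => r u v ∧ v ∈ S) p w →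
      ReachIn r (S \ {q}) p w ∨ ∃ s, ReachIn r (S \ {q}) p s ∧ r s q := by
    intro w hw
    induction hw with
    | refl => exact Or.inl (refl ⟨h1, hpq⟩)
    | @tail b c hab hbc ih =>
      rcases ih with ih | ih
      · by_cases hc : c = q
        · exact Or.inr ⟨b, ih, hc ▸ hbc.1⟩
        · exact Or.inl (ih.tail hbc.1 ⟨hbc.2, hc⟩)
      · exact Or.inr ih
  rcases key q h2 with h | h
  · exact absurd rfl h.right_mem.2
  · exact h

/-- The part of a path after its last visit to a set `T` that contains its origin. -/
theorem exists_last_visit (h : ReachIn r S p q) (hp : p ∈ T) :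
    ∃ z ∈ T ∩ S, ReachIn r ({z} ∪ (S \ T)) z q := by
  obtain ⟨h1, h2⟩ := h
  induction h2 with
  | refl => exact ⟨p, ⟨hp, h1⟩, refl (Or.inl rfl)⟩
  | @tail b c hab hbc ih =>
    by_cases hc : c ∈ T
    · exact ⟨c, ⟨hc, hbc.2⟩, refl (Or.inl rfl)⟩
    · obtain ⟨z, hz, hzb⟩ := ih
      exact ⟨z, hz, hzb.tail hbc.1 (Or.inr ⟨hbc.2, hc⟩)⟩

end ReachIn

/-! ### Menger's theorem for two paths -/

/-- The set `U` is connected, and remains so when a vertex is removed. -/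
structure BiconnectedIn {W : Type*} (r : W → W → Prop) (U : Set W) : Prop where
  connected : ∀ p ∈ U, ∀ q ∈ U, ReachIn r U p q
  connected_diff : ∀ w, ∀ p ∈ U, ∀ q ∈ U, p ≠ w → q ≠ w → ReachIn r (U \ {w}) p q

namespace BiconnectedIn

variable {W : Type*} {r : W → W → Prop} {U : Set W} {a b c d w v : W}

/-- Two paths, from `a` and from `b`, that meet only at their common endpoint `d`, which they visit
only once. -/
def Fan (r : W → W → Prop) (U : Set W) (a b d : W) : Prop :=
  ∃ P Q : Set W, P ⊆ U ∧ Q ⊆ U ∧ P ∩ Q = {d} ∧ ReachIn r P a d ∧ ReachIn r Q b d ∧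
    (∀ z ∈ P, z ≠ d → ReachIn r (P \ {d}) a z) ∧ (∀ z ∈ Q, z ≠ d → ReachIn r (Q \ {d}) b z)

/-- Two disjoint paths, from `a` to `c` and from `b` to `d`. -/
def Linked (r : W → W → Prop) (U : Set W) (a b c d : W) : Prop :=
  ∃ S T : Set W, S ⊆ U ∧ T ⊆ U ∧ Disjoint S T ∧ ReachIn r S a c ∧ ReachIn r T b d

theorem Linked.swap (h : Linked r U a b c d) : Linked r U b a d c := by
  obtain ⟨S, T, h1, h2, h3, h4, h5⟩ := h
  exact ⟨T, S, h2, h1, h3.symm, h5, h4⟩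

theorem Fan.swap (h : Fan r U a b d) : Fan r U b a d := by
  obtain ⟨P, Q, h1, h2, h3, h4, h5, h6, h7⟩ := h
  exact ⟨Q, P, h2, h1, by rw [Set.inter_comm, h3], h5, h4, h7, h6⟩

theorem linked_of_fan_of_visit {P Q X : Set W} (hPU : P ⊆ U) (hQU : Q ⊆ U) (hPQ : P ∩ Q = {w})
    (hQ : ReachIn r Q b w) (hP' : ∀ z ∈ P, z ≠ w → ReachIn r (P \ {w}) a z)
    (hXU : X ⊆ U) (hX : Disjoint X Q) {z : W} (hz : z ∈ P) (hzw : z ≠ w)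
    (h : ReachIn r ({z} ∪ X) z v) : Linked r U a b v w := by
  refine ⟨P \ {w} ∪ X, Q, ?_, hQU, ?_, ?_, hQ⟩
  · exact Set.union_subset (Set.sdiff_subset.trans hPU) hXU
  · rw [Set.disjoint_union_left]
    refine ⟨?_, hX⟩
    rw [Set.disjoint_left]
    rintro t ⟨ht, htw⟩ htQ
    exact htw (hPQ ▸ (⟨ht, htQ⟩ : t ∈ P ∩ Q))
  · refine ((hP' z hz hzw).mono Set.subset_union_left).trans (h.mono ?_)
    rintro t (rfl | ht)
    · exact Or.inl ⟨hz, hzw⟩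
    · exact Or.inr ht

/-- A path to `v` that avoids `w` starts on the fan; after its last visit to `P ∪ Q` it is disjoint
from the fan. The branch containing that last visit is rerouted to `v`, and the other branch keeps
its endpoint `w`. Which branch is hit is not controlled, hence the disjunction. -/
theorem linked_of_fan (hU : BiconnectedIn r U) (ha : a ∈ U) (hb : b ∈ U) (hab : a ≠ b)
    (hv : v ∈ U) (hvw : v ≠ w) (h : Fan r U a b w) :
    Linked r U a b v w ∨ Linked r U a b w v := by
  obtain ⟨P, Q, hPU, hQU, hPQ, hP, hQ, hP', hQ'⟩ := h
  have hstart : ∃ s ∈ P ∪ Q, s ∈ U ∧ s ≠ w := by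
    by_cases haw : a = w
    · exact ⟨b, Or.inr hQ.left_mem, hb, fun h => hab (haw.trans h.symm)⟩
    · exact ⟨a, Or.inl hP.left_mem, ha, haw⟩
  obtain ⟨s, hs, hsU, hsw⟩ := hstart
  obtain ⟨z, ⟨hz, hzU⟩, hzv⟩ :=
    (hU.connected_diff w s hsU v hv hsw hvw).exists_last_visit hs
  have hsub : (U \ {w}) \ (P ∪ Q) ⊆ U := Set.sdiff_subset.trans Set.sdiff_subset
  rcases hz with hz | hz
  · exact Or.inl (linked_of_fan_of_visit hPU hQU hPQ hQ hP' hsub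
      (Set.disjoint_left.2 fun t ht htQ => ht.2 (Or.inr htQ)) hz hzU.2 hzv)
  · refine Or.inr (Linked.swap (linked_of_fan_of_visit hQU hPU ?_ hP hQ' hsub
      (Set.disjoint_left.2 fun t ht htP => ht.2 (Or.inl htP)) hz hzU.2 hzv))
    rw [Set.inter_comm, hPQ]

/-- Cutting the path at its first arrival at `v` makes `v` a true endpoint: the rest of the set is
reached without crossing it. -/
theorem exists_shrink {S : Set W} (h : ReachIn r S a v) :
    ∃ S' ⊆ S, ReachIn r S' a v ∧ ∀ z ∈ S', z ≠ v → ReachIn r (S' \ {v}) a z := by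
  by_cases hav : a = v
  · subst hav
    exact ⟨{a}, by simpa using h.left_mem, .refl rfl, fun z hz hza => absurd hz hza⟩
  · obtain ⟨s, hs, hsv⟩ := h.exists_last_step hav
    refine ⟨insert v {u | ReachIn r (S \ {v}) a u}, ?_, ?_, ?_⟩
    · rintro t (rfl | ht)
      · exact h.right_mem
      · exact ht.right_mem.1
    · exact (hs.reachable_set.mono (Set.subset_insert _ _)).tail hsv (Set.mem_insert _ _)
    · rintro z (rfl | hz) hzv
      · exact absurd rfl hzv
      · refine (ReachIn.reachable_set hz).mono fun t ht => ⟨Or.inr ht, ht.right_mem.2⟩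

theorem fan_of_linked (hv : v ∈ U) (hr : r w v)
    (h : Linked r U a b v w) : Fan r U a b v := by
  obtain ⟨S, T, hS, hT, hST, ha, hb⟩ := h
  have hvT : v ∉ T := Set.disjoint_left.1 hST ha.right_mem
  obtain ⟨S', hS', h1, h2⟩ := exists_shrink ha
  obtain ⟨T', hT', h3, h4⟩ := exists_shrink
    ((hb.mono (Set.subset_insert v T)).tail hr (Set.mem_insert v T))
  refine ⟨S', T', hS'.trans hS, hT'.trans (Set.insert_subset hv hT), ?_, h1, h3, h2, h4⟩
  ext t
  constructor
  · rintro ⟨htS, htT⟩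
    rcases hT' htT with h | h
    · exact h
    · exact absurd h (Set.disjoint_left.1 hST (hS' htS))
  · rintro rfl
    exact ⟨h1.right_mem, h3.right_mem⟩

/-- The endpoint of the fan is moved along a path from `a` to `d`, one step w, v at a time:
`linked_of_fan` frees one branch to end at v, and the branch ending at w is prolonged by the step to
v. -/
theorem fan (hU : BiconnectedIn r U) (ha : a ∈ U) (hb : b ∈ U) (hab : a ≠ b) (hd : d ∈ U) :
    Fan r U a b d := by
  obtain ⟨h1, h2⟩ := hU.connected a ha d hd
  clear hd
  induction h2 with
  | refl =>
    obtain ⟨Q, hQ, h3, h4⟩ := exists_shrink (hU.connected b hb a ha)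
    refine ⟨{a}, Q, by simpa using ha, hQ, ?_, .refl rfl, h3, fun z hz hza => absurd hz hza, h4⟩
    ext t
    constructor
    · exact fun h => h.1
    · rintro rfl
      exact ⟨rfl, h3.right_mem⟩
  | @tail w v haw hwv ih =>
    by_cases hvw : v = w
    · exact hvw ▸ ih
    · rcases hU.linked_of_fan ha hb hab hwv.2 hvw ih with h | h
      · exact fan_of_linked hwv.2 hwv.1 h
      · exact (fan_of_linked hwv.2 hwv.1 h.swap).swap

theorem linked (hU : BiconnectedIn r U) (ha : a ∈ U) (hb : b ∈ U) (hab : a ≠ b)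
    (hc : c ∈ U) (hd : d ∈ U) (hcd : c ≠ d) :
    Linked r U a b c d ∨ Linked r U a b d c :=
  hU.linked_of_fan ha hb hab hc hcd (hU.fan ha hb hab hd)

end BiconnectedIn

/-! ### Connectivity of the split graph -/

namespace SplitGraph

variable {V : Type*}

/-- The incidence relation of the bipartite graph with two copies of each vertex `x`, one for the
edges leaving `x` and one for the edges entering `x`, which are themselves joined by an edge. -/
def Inc (G : Digraph V) (x y : V) : Prop := G.Adj x y ∨ x = y

/-- The adjacency relation of the bipartite graph of incidence `Inc G`. -/
def Adj (G : Digraph V) : V ⊕ V → V ⊕ V → Prop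
  | .inl x, .inr y => Inc G x y
  | .inr y, .inl x => Inc G x y
  | _, _ => False

theorem adj_symm (G : Digraph V) : ∀ ⦃p q⦄, Adj G p q → Adj G q p := by
  rintro (x | x) (y | y) h <;> exact h

theorem adj_lr {G : Digraph V} {x y : V} (h : G.Adj x y) : Adj G (.inl x) (.inr y) := Or.inl h

theorem adj_rl {G : Digraph V} {x y : V} (h : G.Adj x y) : Adj G (.inr y) (.inl x) := Or.inl h

theorem adj_lr_self (G : Digraph V) (x : V) : Adj G (.inl x) (.inr x) := Or.inr rfl

theorem adj_rl_self (G : Digraph V) (x : V) : Adj G (.inr x) (.inl x) := Or.inr rfl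

/-- There are at least three vertices. -/
def HasThree (V : Type*) : Prop := ∀ a b : V, ∃ c, c ≠ a ∧ c ≠ b

/-- Take the last step of a path that reaches `x` from a third vertex while avoiding `y`. -/
theorem exists_adj_ne {G : Digraph V} (hV : HasThree V) (hG : TwoConnected G) {x y : V}
    (h : x ≠ y) : ∃ u, u ≠ y ∧ G.Adj u x := by
  obtain ⟨w, hwx, hwy⟩ := hV x y
  have hp := hG.2 y ⟨w, hwy⟩ ⟨x, h⟩
  rcases Relation.ReflTransGen.cases_tail hp with h | ⟨u, -, hu⟩
  · exact absurd (congrArg Subtype.val h).symm hwx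
  · exact ⟨u.1, u.2, hu⟩

section Connectivity

variable {G : Digraph V}

/-- A path of G from z to `y` avoiding `x` lifts to a path inr z, inl z, inr z', …, stopped as soon
as it meets `y` so that the deleted `inl y` is not used. The vertex `inr x` is not covered by these
lifts; it is left through a predecessor of `x` other than `y`. -/
theorem reachIn_inl_hub (hV : HasThree V) (hloop : ∀ x, ¬ G.Adj x x) (hG : TwoConnected G)
    {x y : V} (hxy : y ≠ x) (p : V ⊕ V) (hp : p ≠ .inl x) (hpy : p ≠ .inl y) :
    ReachIn (Adj G) ({p | p ≠ .inl x} \ {.inl y}) p (.inr y) := by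
  have key : ∀ z : {z : V // z ≠ x}, ReachIn (Adj G) ({p | p ≠ .inl x} \ {.inl y})
      (.inr z.1) (.inr y) := by
    intro z
    have hz := hG.2 x z ⟨y, hxy⟩
    induction hz using Relation.ReflTransGen.head_induction_on with
    | refl => exact .refl ⟨by simp, by simp⟩
    | @head a b hab _ ih =>
      by_cases ha : a.1 = y
      · rw [ha]; exact .refl ⟨by simp, by simp⟩
      · have h1 : (Sum.inl a.1 : V ⊕ V) ∈ ({p | p ≠ .inl x} \ {.inl y} : Set (V ⊕ V)) :=
          ⟨by simpa using a.2, by simpa using ha⟩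
        refine .trans (.single (q := .inl a.1) (adj_rl_self G _) ⟨by simp, by simp⟩ h1) ?_
        exact .trans (.single (adj_lr hab) h1 ⟨by simp, by simp⟩) ih
  have key2 : ∀ z, z ≠ x → z ≠ y → ReachIn (Adj G) ({p | p ≠ .inl x} \ {.inl y})
      (.inl z) (.inr y) := by
    intro z hzx hzy
    exact .trans (.single (adj_lr_self G _) ⟨by simpa using hzx, by simpa using hzy⟩
      ⟨by simp, by simp⟩) (key ⟨z, hzx⟩)
  rcases p with z | z
  · exact key2 z (by simpa using hp) (by simpa using hpy)
  · by_cases hz : z = x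
    · subst hz
      obtain ⟨u, huy, hu⟩ := exists_adj_ne hV hG (Ne.symm hxy)
      have hux : u ≠ z := fun h => hloop z (h ▸ hu)
      exact .trans (.single (q := .inl u) (adj_rl hu) ⟨by simp, by simp⟩
        ⟨by simpa using hux, by simpa using huy⟩) (key2 u hux huy)
    · exact key ⟨z, hz⟩

/-- Same lifting with paths of G from `y` to z followed backwards, since now the surviving copy of
`y` is `inl y`. -/
theorem reachIn_inr_hub (hV : HasThree V) (hloop : ∀ x, ¬ G.Adj x x) (hG : TwoConnected G)
    {x y : V} (hxy : y ≠ x) (p : V ⊕ V) (hp : p ≠ .inl x) (hpy : p ≠ .inr y) :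
    ReachIn (Adj G) ({p | p ≠ .inl x} \ {.inr y}) p (.inl y) := by
  have hmem : (Sum.inl y : V ⊕ V) ∈ ({p | p ≠ .inl x} \ {.inr y} : Set (V ⊕ V)) :=
    ⟨by simpa using hxy, by simp⟩
  have key : ∀ z : {z : V // z ≠ x}, ReachIn (Adj G) ({p | p ≠ .inl x} \ {.inr y})
      (.inl z.1) (.inl y) := by
    intro z
    have hz := hG.2 x ⟨y, hxy⟩ z
    induction hz with
    | refl => exact .refl hmem
    | @tail a b _ hab ih =>
      by_cases hb : b.1 = y
      · rw [hb]; exact .refl hmem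
      · have h1 : (Sum.inr b.1 : V ⊕ V) ∈ ({p | p ≠ .inl x} \ {.inr y} : Set (V ⊕ V)) :=
          ⟨by simp, by simpa using hb⟩
        refine .trans (.single (q := .inr b.1) (adj_lr_self G _)
          ⟨by simpa using b.2, by simp⟩ h1) ?_
        exact .trans (.single (adj_rl hab) h1 ih.left_mem) ih
  rcases p with z | z
  · exact key ⟨z, by simpa using hp⟩
  · have hzy : z ≠ y := by simpa using hpy
    have h1 : (Sum.inr z : V ⊕ V) ∈ ({p | p ≠ .inl x} \ {.inr y} : Set (V ⊕ V)) :=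
      ⟨by simp, by simpa using hzy⟩
    by_cases hz : z = x
    · subst hz
      obtain ⟨u, huy, hu⟩ := exists_adj_ne hV hG (Ne.symm hxy)
      have hux : u ≠ z := fun h => hloop z (h ▸ hu)
      exact .trans (.single (adj_rl hu) h1 (key ⟨u, hux⟩).left_mem) (key ⟨u, hux⟩)
    · exact .trans (.single (adj_rl_self G _) h1 (key ⟨z, hz⟩).left_mem) (key ⟨z, hz⟩)

theorem reachIn_inr_root_hub (hG : TwoConnected G)
    {x y : V} (hxy : y ≠ x) (p : V ⊕ V) (hp : p ≠ .inl x) (hpx : p ≠ .inr x) :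
    ReachIn (Adj G) ({p | p ≠ .inl x} \ {.inr x}) p (.inr y) := by
  have hmem : ∀ z, z ≠ x → (Sum.inr z : V ⊕ V) ∈ ({p | p ≠ .inl x} \ {.inr x} : Set (V ⊕ V)) :=
    fun z hz => ⟨by simp, by simpa using hz⟩
  have hmem' : ∀ z, z ≠ x → (Sum.inl z : V ⊕ V) ∈ ({p | p ≠ .inl x} \ {.inr x} : Set (V ⊕ V)) :=
    fun z hz => ⟨by simpa using hz, by simp⟩
  have key : ∀ z : {z : V // z ≠ x}, ReachIn (Adj G) ({p | p ≠ .inl x} \ {.inr x})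
      (.inr z.1) (.inr y) := by
    intro z
    have hz := hG.2 x z ⟨y, hxy⟩
    induction hz using Relation.ReflTransGen.head_induction_on with
    | refl => exact .refl (hmem y hxy)
    | @head a b hab _ ih =>
      refine .trans (.single (q := .inl a.1) (adj_rl_self G _) (hmem _ a.2) (hmem' _ a.2)) ?_
      exact .trans (.single (adj_lr hab) (hmem' _ a.2) (hmem _ b.2)) ih
  rcases p with z | z
  · have hz : z ≠ x := by simpa using hp
    exact .trans (.single (adj_lr_self G _) (hmem' z hz) (hmem z hz)) (key ⟨z, hz⟩)
  · exact key ⟨z, by simpa using hpx⟩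

/-- The split graph of a `2`-connected graph remains connected after the removal of two vertices,
one of which is `Sum.inl x`. -/
theorem biconnectedIn (hV : HasThree V) (hloop : ∀ x, ¬ G.Adj x x) (hG : TwoConnected G) (x : V) :
    BiconnectedIn (Adj G) {p : V ⊕ V | p ≠ .inl x} := by
  have hdiff : ∀ w, w ≠ .inl x → ∀ p ∈ {p : V ⊕ V | p ≠ .inl x},
      ∀ q ∈ {p : V ⊕ V | p ≠ .inl x}, p ≠ w → q ≠ w →
        ReachIn (Adj G) ({p : V ⊕ V | p ≠ .inl x} \ {w}) p q := by
    intro w hw p hp q hq hpw hqw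
    rcases w with y | y
    · have hyx : y ≠ x := by simpa using hw
      exact (reachIn_inl_hub hV hloop hG hyx p hp hpw).trans
        ((reachIn_inl_hub hV hloop hG hyx q hq hqw).symm (adj_symm G))
    · by_cases hyx : y = x
      · subst hyx
        obtain ⟨c, hc, -⟩ := hV y y
        exact (reachIn_inr_root_hub hG hc p hp hpw).trans
          ((reachIn_inr_root_hub hG hc q hq hqw).symm (adj_symm G))
      · exact (reachIn_inr_hub hV hloop hG hyx p hp hpw).trans
          ((reachIn_inr_hub hV hloop hG hyx q hq hqw).symm (adj_symm G))
  have hconn : ∀ p ∈ {p : V ⊕ V | p ≠ .inl x}, ∀ q ∈ {p : V ⊕ V | p ≠ .inl x},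
      ReachIn (Adj G) {p : V ⊕ V | p ≠ .inl x} p q := by
    intro p hp q hq
    -- Connectivity without a second deletion follows by deleting a harmless `inr c`, with c
    -- different from the vertices under p and q.
    obtain ⟨c, hcp, hcq⟩ := hV (p.elim id id) (q.elim id id)
    refine (hdiff (.inr c) (by simp) p hp q hq ?_ ?_).mono Set.sdiff_subset
    · rintro rfl; exact hcp rfl
    · rintro rfl; exact hcq rfl
  refine ⟨hconn, fun w p hp q hq hpw hqw => ?_⟩
  by_cases hw : w = .inl x
  · subst hw
    exact (hconn p hp q hq).mono fun t ht => ⟨ht, ht⟩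
  · exact hdiff w hw p hp q hq hpw hqw

end Connectivity

/-! ### Integer cycles of the split graph -/

section Chains

variable [DecidableEq V]

/-- The matrix whose only nonzero entry is a `1` at `(x, y)`. -/
def edge (x y : V) : V → V → ℤ := Pi.single x (Pi.single y 1)

theorem edge_apply (x y a b : V) : edge x y a b = if a = x ∧ b = y then 1 else 0 := by
  unfold edge
  by_cases ha : a = x
  · subst ha; simp [Pi.single_apply]
  · simp [ha]

variable [Fintype V]

/-- The row sums and the column sums of a matrix. -/
def nodeSum : (V → V → ℤ) →+ (V ⊕ V → ℤ) where
  toFun c := Sum.elim (fun x => ∑ y, c x y) (fun y => ∑ x, c x y)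
  map_zero' := by ext (x | x) <;> simp
  map_add' c d := by ext (x | x) <;> simp [Finset.sum_add_distrib]

theorem nodeSum_edge (x y : V) :
    nodeSum (edge x y) = Pi.single (.inl x) 1 + Pi.single (.inr y) 1 := by
  ext (z | z)
  · simp only [nodeSum, AddMonoidHom.coe_mk, ZeroHom.coe_mk, edge_apply, Sum.elim_inl]
    by_cases h : z = x <;> simp [h]
  · simp only [nodeSum, AddMonoidHom.coe_mk, ZeroHom.coe_mk, edge_apply, Sum.elim_inr]
    by_cases h : z = y <;> simp [h]

/-- The side of a vertex of the split graph. -/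
def sgn : V ⊕ V → ℤ := Sum.elim (fun _ => 1) (fun _ => -1)

/-- Edges crossed from left to right count +1 and those crossed back count -1. The contributions at
each intermediate vertex then cancel, and `sgn` records the sign left at the ends. -/
theorem exists_chain {G : Digraph V} {S : Set (V ⊕ V)} {p q : V ⊕ V} (h : ReachIn (Adj G) S p q) :
    ∃ c : V → V → ℤ, (∀ a b, c a b ≠ 0 → Inc G a b ∧ .inl a ∈ S ∧ .inr b ∈ S) ∧
      nodeSum c = Pi.single p (sgn p) - Pi.single q (sgn q) := by
  obtain ⟨h1, h2⟩ := h
  induction h2 with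
  | refl => exact ⟨0, by simp, by simp⟩
  | @tail s q hps hsq ih =>
    obtain ⟨c, hc, hsum⟩ := ih
    have hs : s ∈ S := ReachIn.right_mem ⟨h1, hps⟩
    obtain ⟨hadj, hq⟩ := hsq
    have hedge : ∀ x y : V, Inc G x y → .inl x ∈ S → .inr y ∈ S →
        ∀ a b, edge x y a b ≠ 0 → Inc G a b ∧ .inl a ∈ S ∧ .inr b ∈ S := by
      intro x y hxy hx hy a b hab
      rw [edge_apply] at hab
      obtain ⟨rfl, rfl⟩ : a = x ∧ b = y := by by_contra hne; simp [hne] at hab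
      exact ⟨hxy, hx, hy⟩
    rcases s with x | x <;> rcases q with y | y
    · exact hadj.elim
    · refine ⟨c + edge x y, fun a b hab => ?_, ?_⟩
      · by_cases h0 : c a b = 0
        · exact hedge x y hadj hs hq a b (by simpa [h0] using hab)
        · exact hc a b h0
      · rw [map_add, hsum, nodeSum_edge]
        simp only [sgn, Sum.elim_inl, Sum.elim_inr, Pi.single_neg]
        abel
    · refine ⟨c - edge y x, fun a b hab => ?_, ?_⟩
      · by_cases h0 : c a b = 0
        · exact hedge y x hadj hq hs a b (by simpa [h0] using hab)
        · exact hc a b h0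
      · rw [map_sub, hsum, nodeSum_edge]
        simp only [sgn, Sum.elim_inl, Sum.elim_inr, Pi.single_neg]
        abel
    · exact hadj.elim

/-- An integer cycle of the split graph that visits `Sum.inl x` between `Sum.inr j` and
`Sum.inr k`, stays in `S` elsewhere, and visits `Sum.inr k` once, next to `Sum.inl i`. -/
structure IsCycle (G : Digraph V) (x j k i : V) (S : Set (V ⊕ V)) (C : V → V → ℤ) : Prop where
  closed : nodeSum C = 0
  row : C x = Pi.single j 1 - Pi.single k 1
  inc : ∀ a b, C a b ≠ 0 → Inc G a b
  mem : ∀ a b, a ≠ x → C a b ≠ 0 → .inl a ∈ S ∧ .inr b ∈ S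
  ne : i ≠ x
  left_mem : .inr j ∈ S
  right_mem : .inr k ∈ S
  last_mem : .inl i ∈ S
  last : ∀ a, a ≠ x → C a k = if a = i then 1 else 0

/-- The path is cut at its first visit to `inr k`, reached from some `inl i`, and closed up through
`inl x`. Column `k` then meets the cycle only in rows i and `x`, so it is nonnegative outside row
`x`. -/
theorem exists_isCycle {G : Digraph V} {S : Set (V ⊕ V)} {x j k : V} (hjk : j ≠ k)
    (hx : .inl x ∉ S) (hj : Inc G x j) (hk : Inc G x k)
    (h : ReachIn (Adj G) S (.inr j) (.inr k)) : ∃ i C, IsCycle G x j k i S C := by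
  obtain ⟨s, hs, hsk⟩ := h.exists_last_step (by simpa using hjk)
  rcases s with i | i
  swap
  · exact hsk.elim
  obtain ⟨c, hc, hsum⟩ := exists_chain hs
  have hiS : .inl i ∈ S := hs.right_mem.1
  have hix : i ≠ x := by rintro rfl; exact hx hiS
  have hcx : ∀ b, c x b = 0 := by
    intro b
    by_contra h0
    exact hx (hc x b h0).2.1.1
  have hck : ∀ a, c a k = 0 := by
    intro a
    by_contra h0
    exact (hc a k h0).2.2.2 rfl
  refine ⟨i, c + edge i k + edge x j - edge x k, ?_, ?_, ?_, ?_, hix, h.left_mem, h.right_mem,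
    hiS, ?_⟩
  · rw [map_sub, map_add, map_add, hsum, nodeSum_edge, nodeSum_edge, nodeSum_edge]
    simp only [sgn, Sum.elim_inl, Sum.elim_inr, Pi.single_neg]
    abel
  · ext b
    simp [hcx b, edge_apply, Ne.symm hix, Pi.single_apply]
  · intro a b hab
    by_contra hinc
    have h1 : c a b = 0 := by by_contra h0; exact hinc (hc a b h0).1
    have h2 : ∀ x' y', Inc G x' y' → edge x' y' a b = 0 := by
      intro x' y' hxy
      rw [edge_apply, if_neg]
      rintro ⟨rfl, rfl⟩
      exact hinc hxy
    exact hab (by simp [h1, h2 _ _ hj, h2 _ _ hk, h2 _ _ (show Inc G i k from hsk)])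
  · intro a b hax hab
    have h1 : ∀ y', edge x y' a b = 0 := by simp [edge_apply, hax]
    by_cases h0 : c a b = 0
    · have h2 : edge i k a b ≠ 0 := by simpa [h0, h1] using hab
      rw [edge_apply] at h2
      obtain ⟨rfl, rfl⟩ : a = i ∧ b = k := by by_contra hne; simp [hne] at h2
      exact ⟨hiS, h.right_mem⟩
    · exact ⟨(hc a b h0).2.1.1, (hc a b h0).2.2.1⟩
  · intro a hax
    simp [hck a, edge_apply, hax]

end Chains

end SplitGraph

/-! ### Flows and their perturbation by cycles -/

namespace SplitGraph

variable {V : Type*} [Fintype V] [DecidableEq V] {G : Digraph V}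

section Cycle

variable {x j k i : V} {S : Set (V ⊕ V)} {C : V → V → ℤ}

theorem IsCycle.row_eq_zero (h : IsCycle G x j k i S C) {a : V} (ha : a ≠ x) (haS : .inl a ∉ S) :
    C a = 0 := by
  ext b
  by_contra h0
  exact haS (h.mem a b ha h0).1

theorem IsCycle.col_eq_zero (h : IsCycle G x j k i S C) {b : V} (hbS : .inr b ∉ S) (a : V) :
    C a b = 0 := by
  by_cases ha : a = x
  · have hj : b ≠ j := by rintro rfl; exact hbS h.left_mem
    have hk : b ≠ k := by rintro rfl; exact hbS h.right_mem
    rw [ha, h.row]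
    simp [hj, hk]
  · by_contra h0
    exact hbS (h.mem a b ha h0).2

theorem IsCycle.last_nonneg (h : IsCycle G x j k i S C) {a : V} (ha : a ≠ x) : 0 ≤ C a k := by
  rw [h.last a ha]
  split_ifs <;> norm_num

end Cycle

/-- A nonnegative integer flow on the edges of `G`, encoded as a matrix of zero row and column sums
by means of its diagonal. -/
structure IsFlow (G : Digraph V) (K : V → V → ℤ) : Prop where
  closed : nodeSum K = 0
  inc : ∀ a b, K a b ≠ 0 → Inc G a b
  nonneg : ∀ a b, a ≠ b → 0 ≤ K a b

section Flow

variable {K C : V → V → ℤ}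

theorem inc_add {C D : V → V → ℤ} (hC : ∀ a b, C a b ≠ 0 → Inc G a b)
    (hD : ∀ a b, D a b ≠ 0 → Inc G a b) : ∀ a b, (C + D) a b ≠ 0 → Inc G a b := by
  intro a b hab
  by_cases h : C a b = 0
  · exact hD a b (by simpa [h] using hab)
  · exact hC a b h

theorem IsFlow.add_of (hK : IsFlow G K) (hC : nodeSum C = 0) (hinc : ∀ a b, C a b ≠ 0 → Inc G a b)
    (h : ∀ a b, G.Adj a b → a ≠ b → 0 ≤ K a b + C a b) : IsFlow G (K + C) := by
  refine ⟨by rw [map_add, hK.closed, hC, add_zero], inc_add hK.inc hinc, fun a b hab => ?_⟩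
  by_cases hadj : G.Adj a b
  · exact h a b hadj hab
  · have h1 : K a b = 0 := by
      by_contra h0
      exact (hK.inc a b h0).elim hadj hab
    have h2 : C a b = 0 := by
      by_contra h0
      exact (hinc a b h0).elim hadj hab
    simp [h1, h2]

theorem IsFlow.zero : IsFlow G 0 := ⟨map_zero _, by simp, by simp⟩

theorem IsFlow.add {K' : V → V → ℤ} (hK : IsFlow G K) (hK' : IsFlow G K') : IsFlow G (K + K') :=
  hK.add_of hK'.closed hK'.inc fun a b _ hab => add_nonneg (hK.nonneg a b hab) (hK'.nonneg a b hab)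

theorem IsFlow.nsmul (hK : IsFlow G K) (n : ℕ) : IsFlow G (n • K) := by
  induction n with
  | zero => simpa using IsFlow.zero
  | succ n ih => rw [succ_nsmul]; exact ih.add hK

theorem IsFlow.sum {ι : Type*} (s : Finset ι) {K : ι → V → V → ℤ} (hK : ∀ i, IsFlow G (K i)) :
    IsFlow G (∑ i ∈ s, K i) := by
  classical
  induction s using Finset.induction_on with
  | empty => simpa using IsFlow.zero
  | insert a s ha ih => rw [Finset.sum_insert ha]; exact (hK a).add ih

/-- A step u → v contributes `edge u v - edge v v`: the diagonal term cancels the column sum, the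
row sums telescope, and off the diagonal only edges of the path appear. -/
theorem exists_path_matrix {r : V → V → Prop} (hr : ∀ a b, r a b → G.Adj a b) {y z : V}
    (h : Relation.ReflTransGen r y z) :
    ∃ q : V → V → ℤ, nodeSum q = Pi.single (.inl y) 1 - Pi.single (.inl z) 1 ∧
      (∀ a b, q a b ≠ 0 → Inc G a b) ∧ (∀ a b, a ≠ b → 0 ≤ q a b) ∧
      ∀ a b, a ≠ b → q a b ≠ 0 → r a b := by
  induction h with
  | refl => exact ⟨0, by simp, by simp, by simp, by simp⟩
  | @tail u v _ huv ih =>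
    obtain ⟨q, h1, h2, h3, h4⟩ := ih
    have hdiag : ∀ a b, a ≠ b → edge v v a b = 0 := by
      intro a b hab
      rw [edge_apply, if_neg]
      rintro ⟨rfl, rfl⟩
      exact hab rfl
    refine ⟨q + edge u v - edge v v, ?_, ?_, ?_, ?_⟩
    · rw [map_sub, map_add, h1, nodeSum_edge, nodeSum_edge]
      abel
    · intro a b hab
      by_cases h0 : q a b = 0
      · by_cases hab' : a = b
        · exact Or.inr hab'
        · have : edge u v a b ≠ 0 := by simpa [h0, hdiag a b hab'] using hab
          rw [edge_apply] at this
          obtain ⟨rfl, rfl⟩ : a = u ∧ b = v := by by_contra hne; simp [hne] at this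
          exact Or.inl (hr _ _ huv)
      · exact h2 a b h0
    · intro a b hab
      have : 0 ≤ edge u v a b := by rw [edge_apply]; split_ifs <;> norm_num
      simpa [hdiag a b hab] using add_nonneg (h3 a b hab) this
    · intro a b hab hq
      by_cases h0 : q a b = 0
      · have : edge u v a b ≠ 0 := by simpa [h0, hdiag a b hab] using hq
        rw [edge_apply] at this
        obtain ⟨rfl, rfl⟩ : a = u ∧ b = v := by by_contra hne; simp [hne] at this
        exact huv
      · exact h4 a b hab h0

/-- An edge whose endpoints are joined by a return path belongs to a flow. -/
theorem exists_isFlow_of_return {r : V → V → Prop} (hr : ∀ a b, r a b → G.Adj a b) {u v : V}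
    (huv : G.Adj u v) (hne : u ≠ v) (h : Relation.ReflTransGen r v u) :
    ∃ Z, IsFlow G Z ∧ ∀ a b, a ≠ b → ((a = u ∧ b = v) → 1 ≤ Z a b) ∧
      (¬ r a b → Z a b = edge u v a b) := by
  obtain ⟨q, h1, h2, h3, h4⟩ := exists_path_matrix hr h
  have hdiag : ∀ a b, a ≠ b → edge v v a b = 0 := by
    intro a b hab
    rw [edge_apply, if_neg]
    rintro ⟨rfl, rfl⟩
    exact hab rfl
  refine ⟨q + edge u v - edge v v, ⟨?_, ?_, ?_⟩, ?_⟩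
  · rw [map_sub, map_add, h1, nodeSum_edge, nodeSum_edge]
    abel
  · intro a b hab
    by_cases h0 : q a b = 0
    · by_cases hab' : a = b
      · exact Or.inr hab'
      · have : edge u v a b ≠ 0 := by simpa [h0, hdiag a b hab'] using hab
        rw [edge_apply] at this
        obtain ⟨rfl, rfl⟩ : a = u ∧ b = v := by by_contra hne; simp [hne] at this
        exact Or.inl huv
    · exact h2 a b h0
  · intro a b hab
    have : 0 ≤ edge u v a b := by rw [edge_apply]; split_ifs <;> norm_num
    simpa [hdiag a b hab] using add_nonneg (h3 a b hab) this
  · intro a b hab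
    refine ⟨?_, fun hrab => ?_⟩
    · rintro ⟨rfl, rfl⟩
      have := h3 a b hab
      simp [hdiag a b hab, edge_apply]
      exact this
    · have : q a b = 0 := by by_contra h0; exact hrab (h4 a b hab h0)
      simp [this, hdiag a b hab]

/-- A flow that is prescribed on the edges leaving `x`, and is large on the edges that do not touch
`x`. -/
structure IsBase (G : Digraph V) (x : V) (m : V → ℕ) (M : ℕ) (K : V → V → ℤ) : Prop where
  isFlow : IsFlow G K
  row : ∀ b, b ≠ x → K x b = m b
  le : ∀ a b, a ≠ x → b ≠ x → G.Adj a b → M ≤ K a b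

/-- Superposition of two kinds of circuits: those leaving `x` once, by a chosen edge, which realise
`m`; and those that never leave `x`, which exist because G without `x` is strongly connected and can
be repeated `M` times at no cost in row `x`. -/
theorem exists_isBase (hloop : ∀ x, ¬ G.Adj x x) (hG : TwoConnected G) (x : V) (m : V → ℕ)
    (hm : ∀ y, m y ≠ 0 → G.Adj x y) (M : ℕ) : ∃ K, IsBase G x m M K := by
  have h1 : ∀ y, ∃ Z, IsFlow G Z ∧ ∀ b, b ≠ x → G.Adj x y → Z x b = if b = y then 1 else 0 := by
    intro y
    by_cases hxy : G.Adj x y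
    swap
    · exact ⟨0, .zero, fun b _ h => absurd h hxy⟩
    have hne : x ≠ y := by rintro rfl; exact hloop _ hxy
    -- The return path stops at its first arrival at x, so (x, y) is the only edge of the circuit
    -- that leaves x.
    have hpath : Relation.ReflTransGen (fun a b => G.Adj a b ∧ a ≠ x) y x := by
      have hyx := hG.1 y x
      clear hxy hne
      induction hyx using Relation.ReflTransGen.head_induction_on with
      | refl => exact .refl
      | @head a b hab _ ih =>
        by_cases ha : a = x
        · rw [ha]
        · exact .head ⟨hab, ha⟩ ih
    obtain ⟨Z, hZ, hZ'⟩ := exists_isFlow_of_return (fun a b h => h.1) hxy hne hpath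
    refine ⟨Z, hZ, fun b hb _ => ?_⟩
    rw [(hZ' x b (Ne.symm hb)).2 (fun h => h.2 rfl), edge_apply]
    simp
  have h2 : ∀ u v, ∃ Z, IsFlow G Z ∧ (∀ b, b ≠ x → Z x b = 0) ∧
      (u ≠ x → v ≠ x → G.Adj u v → 1 ≤ Z u v) := by
    intro u v
    by_cases huv : G.Adj u v ∧ u ≠ x ∧ v ≠ x
    swap
    · exact ⟨0, .zero, by simp, fun a b c => absurd ⟨c, a, b⟩ huv⟩
    obtain ⟨huv, hu, hv⟩ := huv
    have hne : u ≠ v := by rintro rfl; exact hloop _ huv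
    have hpath : Relation.ReflTransGen (fun a b => G.Adj a b ∧ a ≠ x) v u := by
      exact Relation.ReflTransGen.lift (p := fun a b => G.Adj a b ∧ a ≠ x) Subtype.val
        (fun a b h => ⟨h, a.2⟩) _ _ (hG.2 x ⟨v, hv⟩ ⟨u, hu⟩)
    obtain ⟨Z, hZ, hZ'⟩ := exists_isFlow_of_return (fun a b h => h.1) huv hne hpath
    refine ⟨Z, hZ, fun b hb => ?_, fun _ _ _ => (hZ' u v hne).1 ⟨rfl, rfl⟩⟩
    rw [(hZ' x b (Ne.symm hb)).2 (fun h => h.2 rfl), edge_apply]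
    simp [Ne.symm hu]
  choose Z hZ hZ' using h1
  choose Y hY hY' hY'' using h2
  refine ⟨∑ y, m y • Z y + M • ∑ u, ∑ v, Y u v, ?_, ?_, ?_⟩
  · exact (IsFlow.sum _ fun y => (hZ y).nsmul _).add
      ((IsFlow.sum _ fun u => IsFlow.sum _ fun v => hY u v).nsmul M)
  · intro b hb
    have e1 : ∀ y, (m y : ℤ) * Z y x b = if b = y then (m y : ℤ) else 0 := by
      intro y
      by_cases hy : m y = 0
      · simp [hy]
      · rw [hZ' y b hb (hm y hy)]; simp
    simp [Finset.sum_apply, hY' _ _ b hb, e1]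
  · intro a b ha hb hab
    have hne : a ≠ b := by rintro rfl; exact hloop _ hab
    have e1 : 0 ≤ ∑ y, (m y : ℤ) * Z y a b :=
      Finset.sum_nonneg fun y _ => mul_nonneg (by positivity) ((hZ y).nonneg a b hne)
    have e2 : 1 ≤ ∑ u, ∑ v, Y u v a b := by
      calc (1 : ℤ) ≤ Y a b a b := hY'' a b ha hb hab
        _ ≤ ∑ v, Y a v a b := Finset.single_le_sum (f := fun v => Y a v a b)
            (fun v _ => (hY a v).nonneg a b hne) (Finset.mem_univ b)
        _ ≤ _ := Finset.single_le_sum (f := fun u => ∑ v, Y u v a b)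
            (fun u _ => Finset.sum_nonneg fun v _ => (hY u v).nonneg a b hne) (Finset.mem_univ a)
    simp only [Pi.add_apply, Finset.sum_apply, nsmul_eq_mul]
    simp only [Finset.sum_apply, Pi.mul_apply, Pi.natCast_apply]
    nlinarith

/-- Base flow for the comparisons where row values need not be prescribed: all edges, including
those around the vertex studied, absorb the negative entries of the cycles. -/
theorem exists_large_flow (hloop : ∀ x, ¬ G.Adj x x) (hG : TwoConnected G) (M : ℕ) :
    ∃ K, IsFlow G K ∧ ∀ a b, G.Adj a b → M ≤ K a b := by
  have h2 : ∀ u v, ∃ Z, IsFlow G Z ∧ (G.Adj u v → 1 ≤ Z u v) := by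
    intro u v
    by_cases huv : G.Adj u v
    swap
    · exact ⟨0, .zero, fun c => absurd c huv⟩
    have hne : u ≠ v := by rintro rfl; exact hloop _ huv
    obtain ⟨Z, hZ, hZ'⟩ := exists_isFlow_of_return (fun a b h => h) huv hne (hG.1 v u)
    exact ⟨Z, hZ, fun _ => (hZ' u v hne).1 ⟨rfl, rfl⟩⟩
  choose Y hY hY'' using h2
  refine ⟨M • ∑ u, ∑ v, Y u v, (IsFlow.sum _ fun u => IsFlow.sum _ fun v => hY u v).nsmul M, ?_⟩
  intro a b hab
  have hne : a ≠ b := by rintro rfl; exact hloop _ hab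
  have e2 : 1 ≤ ∑ u, ∑ v, Y u v a b := by
    calc (1 : ℤ) ≤ Y a b a b := hY'' a b hab
      _ ≤ ∑ v, Y a v a b := Finset.single_le_sum (f := fun v => Y a v a b)
          (fun v _ => (hY a v).nonneg a b hne) (Finset.mem_univ b)
      _ ≤ _ := Finset.single_le_sum (f := fun u => ∑ v, Y u v a b)
          (fun u _ => Finset.sum_nonneg fun v _ => (hY u v).nonneg a b hne) (Finset.mem_univ a)
  simp only [Finset.sum_apply, Pi.smul_apply, nsmul_eq_mul]
  nlinarith

/-- The sum of the absolute values of the entries. -/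
def size (C : V → V → ℤ) : ℕ := ∑ a, ∑ b, (C a b).natAbs

theorem neg_size_le (C : V → V → ℤ) (a b : V) : -(size C : ℤ) ≤ C a b := by
  have : (C a b).natAbs ≤ size C :=
    (Finset.single_le_sum (f := fun b => (C a b).natAbs) (fun _ _ => Nat.zero_le _)
      (Finset.mem_univ b)).trans (Finset.single_le_sum (f := fun a => ∑ b, (C a b).natAbs)
      (fun _ _ => Nat.zero_le _) (Finset.mem_univ a))
  omega

/-- Edges away from `x` are protected by `M` and those leaving `x` by `m`. On edges entering `x` the
base is only known to be nonnegative (the total inflow is the sum of `m`, possibly small), so the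
perturbation must be nonnegative there: this is `hcol`. -/
theorem IsBase.add {x : V} {m : V → ℕ} {M : ℕ} (hK : IsBase G x m M K) (hC : nodeSum C = 0)
    (hinc : ∀ a b, C a b ≠ 0 → Inc G a b) (hM : ∀ a b, -(M : ℤ) ≤ C a b)
    (hcol : ∀ a, a ≠ x → 0 ≤ C a x) (hrow : ∀ b, b ≠ x → 0 ≤ m b + C x b) :
    IsFlow G (K + C) := by
  refine hK.isFlow.add_of hC hinc fun a b hab hne => ?_
  by_cases ha : a = x
  · subst ha
    rw [hK.row b (Ne.symm hne)]
    exact hrow b (Ne.symm hne)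
  · by_cases hb : b = x
    · subst hb
      exact add_nonneg (hK.isFlow.nonneg a b hne) (hcol a ha)
    · have := hK.le a b ha hb hab
      have := hM a b
      omega

end Flow

/-! ### Differences of a sum of local functions along cycles -/

section Differences

/-- The entries of a matrix around a vertex of the split graph. -/
def slice : V ⊕ V → (V → V → ℤ) → V → ℤ :=
  Sum.elim (fun x K => K x) (fun y K a => K a y)

theorem slice_add (v : V ⊕ V) (K C : V → V → ℤ) : slice v (K + C) = slice v K + slice v C := by
  rcases v with x | x <;> rfl

variable {L : V ⊕ V → (V → ℤ) → ℝ}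

theorem sum_second_difference (hL : ∀ K, IsFlow G K → ∑ v, L v (slice v K) = 0)
    {K C D : V → V → ℤ} (h0 : IsFlow G K) (hC : IsFlow G (K + C)) (hD : IsFlow G (K + D))
    (hCD : IsFlow G (K + C + D)) :
    ∑ v, (L v (slice v (K + C + D)) - L v (slice v (K + C)) - L v (slice v (K + D))
      + L v (slice v K)) = 0 := by
  rw [Finset.sum_add_distrib, Finset.sum_sub_distrib, Finset.sum_sub_distrib, hL _ h0, hL _ hC,
    hL _ hD, hL _ hCD]
  norm_num

/-- The function at `v` sees only the slice at `v`; if one of the two cycles misses `v`, the four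
terms cancel in pairs. -/
theorem second_difference_eq_zero {K C D : V → V → ℤ} {v : V ⊕ V}
    (h : slice v C = 0 ∨ slice v D = 0) :
    L v (slice v (K + C + D)) - L v (slice v (K + C)) - L v (slice v (K + D))
      + L v (slice v K) = 0 := by
  simp only [slice_add]
  rcases h with h | h <;> rw [h] <;> simp

/-- Two cycles that meet at a single vertex. -/
theorem second_difference_root (hL : ∀ K, IsFlow G K → ∑ v, L v (slice v K) = 0)
    {K C D : V → V → ℤ} (h0 : IsFlow G K) (hC : IsFlow G (K + C)) (hD : IsFlow G (K + D))
    (hCD : IsFlow G (K + C + D)) (p : V ⊕ V) (h : ∀ v, v ≠ p → slice v C = 0 ∨ slice v D = 0) :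
    L p (slice p (K + C + D)) - L p (slice p (K + C)) - L p (slice p (K + D))
      + L p (slice p K) = 0 := by
  rw [← sum_second_difference hL h0 hC hD hCD]
  exact (Finset.sum_eq_single p (fun v _ hv => second_difference_eq_zero (h v hv)) (by simp)).symm

/-- Two cycles that meet at two vertices. -/
theorem second_difference_pair (hL : ∀ K, IsFlow G K → ∑ v, L v (slice v K) = 0)
    {K C D : V → V → ℤ} (h0 : IsFlow G K) (hC : IsFlow G (K + C)) (hD : IsFlow G (K + D))
    (hCD : IsFlow G (K + C + D)) {p q : V ⊕ V} (hpq : p ≠ q)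
    (h : ∀ v, v ≠ p → v ≠ q → slice v C = 0 ∨ slice v D = 0) :
    (L p (slice p (K + C + D)) - L p (slice p (K + C)) - L p (slice p (K + D))
      + L p (slice p K)) + (L q (slice q (K + C + D)) - L q (slice q (K + C))
      - L q (slice q (K + D)) + L q (slice q K)) = 0 := by
  rw [← sum_second_difference hL h0 hC hD hCD]
  rw [← Finset.sum_subset (Finset.subset_univ {p, q}), Finset.sum_pair hpq]
  intro v _ hv
  simp only [Finset.mem_insert, Finset.mem_singleton, not_or] at hv
  exact second_difference_eq_zero (h v hv.1 hv.2)

/-- Three cycles that have a single common vertex. -/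
theorem third_difference_root (hL : ∀ K, IsFlow G K → ∑ v, L v (slice v K) = 0)
    {K C D E : V → V → ℤ} (h0 : IsFlow G K) (hC : IsFlow G (K + C)) (hD : IsFlow G (K + D))
    (hCD : IsFlow G (K + C + D)) (h0' : IsFlow G (K + E)) (hC' : IsFlow G (K + E + C))
    (hD' : IsFlow G (K + E + D)) (hCD' : IsFlow G (K + E + C + D)) (p : V ⊕ V)
    (h : ∀ v, v ≠ p → slice v C = 0 ∨ slice v D = 0 ∨ slice v E = 0) :
    L p (slice p (K + E + C + D)) - L p (slice p (K + E + C)) - L p (slice p (K + E + D))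
      + L p (slice p (K + E)) = L p (slice p (K + C + D)) - L p (slice p (K + C))
      - L p (slice p (K + D)) + L p (slice p K) := by
  have h1 := sum_second_difference hL h0 hC hD hCD
  have h2 := sum_second_difference hL h0' hC' hD' hCD'
  rw [← sub_eq_zero, ← sub_eq_zero.2 (h2.trans h1.symm), ← Finset.sum_sub_distrib]
  symm
  refine Finset.sum_eq_single p (fun v _ hv => ?_) (fun hp => absurd (Finset.mem_univ p) hp)
  rcases h v hv with h | h | h
  · rw [second_difference_eq_zero (Or.inl h), second_difference_eq_zero (Or.inl h), sub_zero]
  · rw [second_difference_eq_zero (Or.inr h), second_difference_eq_zero (Or.inr h), sub_zero]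
  · simp only [slice_add, h, add_zero, sub_self]

end Differences

end SplitGraph

/-! ### The flow equation and its differences -/

namespace SplitGraph

variable {V : Type*} [Fintype V] [DecidableEq V] {G : Digraph V}

/-- The off-diagonal entries of a row of index `x`. -/
def offDiag (x : V) (r : V → ℤ) : V → ℕ := fun y => if y = x then 0 else (r y).toNat

theorem offDiag_eq {x : V} {r : V → ℤ} {n : V → ℕ} (h : ∀ b, b ≠ x → r b = n b) (hn : n x = 0) :
    offDiag x r = n := by
  ext b
  by_cases hb : b = x
  · simp [offDiag, hb, hn]
  · simp [offDiag, hb, h b hb]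

/-- Two families of functions, of the outgoing and of the incoming flow at each vertex, have the
same sum along every flow. -/
def FlowEquation (G : Digraph V) (F F' : V → (V → ℕ) → ℝ) : Prop :=
  ∀ K, IsFlow G K →
    ∑ x, F x (offDiag x (K x)) = ∑ x, F' x (offDiag x fun a => K a x)

/-- The two families of functions of a flow equation, gathered with opposite signs on the vertices
of the split graph. -/
def nodeFun (F F' : V → (V → ℕ) → ℝ) : V ⊕ V → (V → ℤ) → ℝ :=
  Sum.elim (fun x r => F x (offDiag x r)) (fun x r => -F' x (offDiag x r))

theorem FlowEquation.sum_nodeFun {F F' : V → (V → ℕ) → ℝ} (h : FlowEquation G F F')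
    (K : V → V → ℤ) (hK : IsFlow G K) : ∑ v, nodeFun F F' v (slice v K) = 0 := by
  rw [Fintype.sum_sum_type]
  simp only [nodeFun, slice, Sum.elim_inl, Sum.elim_inr, Finset.sum_neg_distrib, h K hK]
  ring

theorem IsCycle.slice_eq_zero {x j k i : V} {S : Set (V ⊕ V)} {C : V → V → ℤ}
    (h : IsCycle G x j k i S C) {v : V ⊕ V} (hv : v ≠ .inl x) (hvS : v ∉ S) : slice v C = 0 := by
  rcases v with a | b
  · exact h.row_eq_zero (by simpa using hv) hvS
  · ext a
    exact h.col_eq_zero hvS a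

variable {F F' : V → (V → ℕ) → ℝ}

/-- Closing the two disjoint paths through `inl x` gives two cycles that share only `inl x`. One
adds a unit of flow towards `u`, compensated on the diagonal, which `offDiag` ignores; the other
moves a unit from `z` to `y`. -/
theorem mixed_difference_of_linked (hloop : ∀ x, ¬ G.Adj x x) (hG : TwoConnected G)
    (hF : FlowEquation G F F') {x u y z : V} (hu : G.Adj x u) (hy : G.Adj x y) (hz : G.Adj x z)
    (hyz : y ≠ z) (m : V → ℕ) (hm : ∀ b, m b ≠ 0 → G.Adj x b)
    (h : BiconnectedIn.Linked (Adj G) {p | p ≠ .inl x} (.inr u) (.inr y) (.inr x) (.inr z)) :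
    F x (m + Pi.single u 1 + Pi.single y 1) - F x (m + Pi.single u 1 + Pi.single z 1)
      - F x (m + Pi.single y 1) + F x (m + Pi.single z 1) = 0 := by
  obtain ⟨S, T, hS, hT, hST, hux, hyz'⟩ := h
  have hne : ∀ b, G.Adj x b → x ≠ b := by rintro b hb rfl; exact hloop _ hb
  obtain ⟨i, C, hC⟩ := exists_isCycle (hne u hu).symm (fun h => hS h rfl) (Or.inl hu) (Or.inr rfl)
    hux
  obtain ⟨i', D, hD⟩ := exists_isCycle hyz (fun h => hT h rfl) (Or.inl hy) (Or.inl hz) hyz'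
  have hDx : ∀ a, D a x = 0 := hD.col_eq_zero (Set.disjoint_left.1 hST hux.right_mem)
  have hm' : ∀ b, (m + Pi.single z 1 : V → ℕ) b ≠ 0 → G.Adj x b := by
    intro b hb
    by_cases hbz : b = z
    · exact hbz ▸ hz
    · exact hm b (by simpa [hbz] using hb)
  have hmx : m x = 0 := by by_contra h0; exact hloop x (hm x h0)
  -- The extra unit at z is the one that D removes, so m itself can be arbitrary, even zero.
  obtain ⟨K, hK⟩ := exists_isBase hloop hG x (m + Pi.single z 1) hm' (size C + size D)
  have hCb := neg_size_le C
  have hDb := neg_size_le D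
  have hflowC : IsFlow G (K + C) := by
    refine hK.add hC.closed hC.inc (fun a b => ?_) (fun a ha => hC.last_nonneg ha) fun b hb => ?_
    · have := hCb a b; push_cast; omega
    · rw [hC.row]; simp [Pi.single_apply]; split_ifs <;> omega
  have hflowD : IsFlow G (K + D) := by
    refine hK.add hD.closed hD.inc (fun a b => ?_) (fun a ha => (hDx a).ge) fun b hb => ?_
    · have := hDb a b; push_cast; omega
    · rw [hD.row]; simp [Pi.single_apply]; split_ifs <;> omega
  have hflowCD : IsFlow G (K + C + D) := by
    rw [add_assoc]
    refine hK.add (by rw [map_add, hC.closed, hD.closed, add_zero]) (inc_add hC.inc hD.inc)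
      (fun a b => ?_) (fun a ha => ?_) fun b hb => ?_
    · have := hCb a b; have := hDb a b; simp only [Pi.add_apply]; push_cast; omega
    · simpa [hDx a] using hC.last_nonneg ha
    · simp only [Pi.add_apply]; rw [hC.row, hD.row]
      simp [Pi.single_apply]; split_ifs <;> omega
  have key := second_difference_root hF.sum_nodeFun hK.isFlow hflowC hflowD hflowCD (.inl x) <| by
    intro v hv
    by_cases hvS : v ∈ S
    · exact Or.inr (hD.slice_eq_zero hv (Set.disjoint_left.1 hST hvS))
    · exact Or.inl (hC.slice_eq_zero hv hvS)
  simp only [nodeFun, slice, Sum.elim_inl, Pi.add_apply, hC.row, hD.row] at key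
  have hux := (hne u hu); have hyx := hne y hy; have hzx := hne z hz
  rw [offDiag_eq (n := m + Pi.single u 1 + Pi.single y 1),
    offDiag_eq (n := m + Pi.single u 1 + Pi.single z 1),
    offDiag_eq (n := m + Pi.single y 1), offDiag_eq (n := m + Pi.single z 1)] at key
  · linarith
  all_goals first
    | (intro b hb; simp [hK.row b hb, Pi.single_apply] <;> (try split_ifs) <;> omega)
    | simp [*]

/-- The ratio of the increments in the directions `y` and `z` does not depend on the flow along the
other edges. -/
theorem mixed_difference_eq_zero (hV : HasThree V) (hloop : ∀ x, ¬ G.Adj x x)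
    (hG : TwoConnected G) (hF : FlowEquation G F F') {x u y z : V} (hu : G.Adj x u)
    (hy : G.Adj x y) (hz : G.Adj x z) (huy : u ≠ y) (huz : u ≠ z) (hyz : y ≠ z) (m : V → ℕ)
    (hm : ∀ b, m b ≠ 0 → G.Adj x b) :
    F x (m + Pi.single u 1 + Pi.single y 1) - F x (m + Pi.single u 1 + Pi.single z 1)
      - F x (m + Pi.single y 1) + F x (m + Pi.single z 1) = 0 := by
  have hU := biconnectedIn hV hloop hG x
  have hne : ∀ b, G.Adj x b → x ≠ b := by rintro b hb rfl; exact hloop _ hb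
  have hmem : ∀ b, (.inr b : V ⊕ V) ∈ {p : V ⊕ V | p ≠ .inl x} := fun b => by simp
  have hinj : ∀ {a b : V}, a ≠ b → (.inr a : V ⊕ V) ≠ .inr b := fun h => by simpa using h
  have com : ∀ a b, m + Pi.single a 1 + Pi.single b 1 = m + Pi.single b 1 + Pi.single a 1 :=
    fun a b => add_right_comm _ _ _
  have A := fun h => mixed_difference_of_linked hloop hG hF hu hy hz hyz m hm h
  have A' := fun h => mixed_difference_of_linked hloop hG hF hu hz hy hyz.symm m hm h
  have B := fun h => mixed_difference_of_linked hloop hG hF hy hu hz huz m hm h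
  have D := fun h => mixed_difference_of_linked hloop hG hF hz hu hy huy m hm h
  simp only [com y u, com z u, com z y] at B D
  -- There are three ways to pair the columns u, y, z, x by disjoint paths, and each gives a
  -- relation. The pairing {u,x}, {y,z} gives the goal directly. If it is not obtained, both other
  -- pairings occur, and the difference of their relations is the goal.
  have h1 := hU.linked (hmem u) (hmem y) (hinj huy) (hmem x) (hmem z) (hinj (hne z hz))
  have h2 := hU.linked (hmem u) (hmem z) (hinj huz) (hmem x) (hmem y) (hinj (hne y hy))
  rcases h1 with h1 | h1
  · exact A h1
  · have e1 := B h1.swap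
    rcases h2 with h2 | h2
    · linarith [A' h2]
    · have e2 := D h2.swap
      linarith

end SplitGraph

namespace SplitGraph

variable {V : Type*} [Fintype V] [DecidableEq V] {G : Digraph V} {F F' : V → (V → ℕ) → ℝ}

/-- Three cycles through `inl x` realise the moves +y, +z and z to y. The first two follow a fan to
`inr x`, hence share only `inl x` and `inr x`, and the third avoids `inr x`. Only `inl x` lies on
all three, so the third difference vanishes there. -/
theorem third_difference_eq (hV : HasThree V) (hloop : ∀ x, ¬ G.Adj x x)
    (hG : TwoConnected G) (hF : FlowEquation G F F') {x y z : V}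
    (hy : G.Adj x y) (hz : G.Adj x z) (hyz : y ≠ z) (m : V → ℕ)
    (hm : ∀ b, m b ≠ 0 → G.Adj x b) :
    F x (m + Pi.single y 1 + Pi.single y 1 + Pi.single z 1)
      - F x (m + Pi.single y 1 + Pi.single y 1) - F x (m + Pi.single y 1 + Pi.single z 1)
      + F x (m + Pi.single y 1)
      = F x (m + Pi.single z 1 + Pi.single y 1 + Pi.single z 1)
      - F x (m + Pi.single z 1 + Pi.single y 1) - F x (m + Pi.single z 1 + Pi.single z 1)
      + F x (m + Pi.single z 1) := by
  have hU := biconnectedIn hV hloop hG x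
  have hne : ∀ b, G.Adj x b → x ≠ b := by rintro b hb rfl; exact hloop _ hb
  have hmem : ∀ b, (.inr b : V ⊕ V) ∈ {p : V ⊕ V | p ≠ .inl x} := fun b => by simp
  have hinj : ∀ {a b : V}, a ≠ b → (.inr a : V ⊕ V) ≠ .inr b := fun h => by simpa using h
  have hyx := hne y hy
  have hzx := hne z hz
  obtain ⟨P, Q, hP, hQ, hPQ, hPy, hQz, -, -⟩ := hU.fan (hmem y) (hmem z) (hinj hyz) (hmem x)
  have hR := hU.connected_diff (.inr x) _ (hmem y) _ (hmem z) (hinj hyx.symm) (hinj hzx.symm)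
  obtain ⟨i, C, hC⟩ := exists_isCycle hyx.symm (fun h => hP h rfl) (Or.inl hy) (Or.inr rfl) hPy
  obtain ⟨i', D, hD⟩ := exists_isCycle hzx.symm (fun h => hQ h rfl) (Or.inl hz) (Or.inr rfl) hQz
  obtain ⟨i'', E, hE⟩ := exists_isCycle hyz (fun h => h.1 rfl) (Or.inl hy) (Or.inl hz) hR
  have hEx : ∀ a, E a x = 0 := hE.col_eq_zero (fun h => h.2 rfl)
  have hm' : ∀ b, (m + Pi.single z 1 : V → ℕ) b ≠ 0 → G.Adj x b := by
    intro b hb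
    by_cases hbz : b = z
    · exact hbz ▸ hz
    · exact hm b (by simpa [hbz] using hb)
  have hmx : m x = 0 := by by_contra h0; exact hloop x (hm x h0)
  obtain ⟨K, hK⟩ := exists_isBase hloop hG x (m + Pi.single z 1) hm' (size C + size D + size E)
  have hflow : ∀ X : V → V → ℤ, nodeSum X = 0 → (∀ a b, X a b ≠ 0 → Inc G a b) →
      (∀ a b, -((size C : ℤ) + size D + size E) ≤ X a b) → (∀ a, a ≠ x → 0 ≤ X a x) →
      (∀ b, b ≠ x → 0 ≤ ((m + Pi.single z 1 : V → ℕ) b : ℤ) + X x b) → IsFlow G (K + X) :=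
    fun X h1 h2 h3 h4 h5 => hK.add h1 h2 (by push_cast; exact h3) h4 h5
  have bC := neg_size_le C
  have bD := neg_size_le D
  have bE := neg_size_le E
  have cC : ∀ a, a ≠ x → 0 ≤ C a x := fun a ha => hC.last_nonneg ha
  have cD : ∀ a, a ≠ x → 0 ≤ D a x := fun a ha => hD.last_nonneg ha
  have sum0 : ∀ {X Y : V → V → ℤ}, nodeSum X = 0 → nodeSum Y = 0 → nodeSum (X + Y) = 0 :=
    fun h h' => by rw [map_add, h, h', add_zero]
  have f1 : IsFlow G (K + C) := by
    refine hflow _ hC.closed hC.inc (fun a b => ?_) cC fun b hb => ?_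
    · have := bC a b; omega
    · rw [hC.row]; simp [Pi.single_apply]; split_ifs <;> omega
  have f2 : IsFlow G (K + D) := by
    refine hflow _ hD.closed hD.inc (fun a b => ?_) cD fun b hb => ?_
    · have := bD a b; omega
    · rw [hD.row]; simp [Pi.single_apply]; split_ifs <;> omega
  have f3 : IsFlow G (K + C + D) := by
    rw [add_assoc]
    refine hflow _ (sum0 hC.closed hD.closed) (inc_add hC.inc hD.inc) (fun a b => ?_)
      (fun a ha => add_nonneg (cC a ha) (cD a ha)) fun b hb => ?_
    · have := bC a b; have := bD a b; simp only [Pi.add_apply]; omega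
    · simp only [Pi.add_apply]
      rw [hC.row, hD.row]; simp [Pi.single_apply]; split_ifs <;> omega
  have f4 : IsFlow G (K + E) := by
    refine hflow _ hE.closed hE.inc (fun a b => ?_) (fun a _ => (hEx a).ge) fun b hb => ?_
    · have := bE a b; omega
    · rw [hE.row]; simp [Pi.single_apply]; split_ifs <;> omega
  have f5 : IsFlow G (K + E + C) := by
    rw [add_assoc]
    refine hflow _ (sum0 hE.closed hC.closed) (inc_add hE.inc hC.inc) (fun a b => ?_)
      (fun a ha => add_nonneg (hEx a).ge (cC a ha)) fun b hb => ?_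
    · have := bC a b; have := bE a b; simp only [Pi.add_apply]; omega
    · simp only [Pi.add_apply]
      rw [hC.row, hE.row]; simp [Pi.single_apply]; split_ifs <;> omega
  have f6 : IsFlow G (K + E + D) := by
    rw [add_assoc]
    refine hflow _ (sum0 hE.closed hD.closed) (inc_add hE.inc hD.inc) (fun a b => ?_)
      (fun a ha => add_nonneg (hEx a).ge (cD a ha)) fun b hb => ?_
    · have := bD a b; have := bE a b; simp only [Pi.add_apply]; omega
    · simp only [Pi.add_apply]
      rw [hD.row, hE.row]; simp [Pi.single_apply]; split_ifs <;> omega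
  have f7 : IsFlow G (K + E + C + D) := by
    rw [add_assoc, add_assoc]
    refine hflow _ (sum0 hE.closed (sum0 hC.closed hD.closed))
      (inc_add hE.inc (inc_add hC.inc hD.inc)) (fun a b => ?_)
      (fun a ha => add_nonneg (hEx a).ge (add_nonneg (cC a ha) (cD a ha))) fun b hb => ?_
    · have := bC a b; have := bD a b; have := bE a b; simp only [Pi.add_apply]; omega
    · simp only [Pi.add_apply]
      rw [hC.row, hD.row, hE.row]; simp [Pi.single_apply]; split_ifs <;> omega
  have key := third_difference_root hF.sum_nodeFun hK.isFlow f1 f2 f3 f4 f5 f6 f7 (.inl x) <| by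
    intro v hv
    by_cases hvP : v ∈ P
    · by_cases hvQ : v ∈ Q
      · have hvx : v = .inr x := by
          have : v ∈ P ∩ Q := ⟨hvP, hvQ⟩
          rwa [hPQ] at this
        exact Or.inr (Or.inr (hE.slice_eq_zero hv (fun h => h.2 hvx)))
      · exact Or.inr (Or.inl (hD.slice_eq_zero hv hvQ))
    · exact Or.inl (hC.slice_eq_zero hv hvP)
  simp only [nodeFun, slice, Sum.elim_inl, Pi.add_apply, hC.row, hD.row, hE.row] at key
  rw [offDiag_eq (n := m + Pi.single y 1 + Pi.single y 1 + Pi.single z 1),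
    offDiag_eq (n := m + Pi.single y 1 + Pi.single y 1),
    offDiag_eq (n := m + Pi.single y 1 + Pi.single z 1),
    offDiag_eq (n := m + Pi.single y 1),
    offDiag_eq (n := m + Pi.single z 1 + Pi.single y 1 + Pi.single z 1),
    offDiag_eq (n := m + Pi.single z 1 + Pi.single y 1),
    offDiag_eq (n := m + Pi.single z 1 + Pi.single z 1),
    offDiag_eq (n := m + Pi.single z 1)] at key
  · exact key
  all_goals first
    | (intro b hb; simp [hK.row b hb, Pi.single_apply] <;> (try split_ifs) <;> omega)
    | simp [*]

/-- Two cycles that go through the edge `(x, y)`, and share no other edge. -/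
theorem edge_difference_eq (hV : HasThree V) (hloop : ∀ x, ¬ G.Adj x x)
    (hG : TwoConnected G) (hF : FlowEquation G F F') {x y z : V}
    (hy : G.Adj x y) (hz : G.Adj x z) (hyz : y ≠ z) :
    ∃ m m' h : V → ℕ, ∃ i : V, (∀ b, m b ≠ 0 → G.Adj x b) ∧ (∀ a, m' a ≠ 0 → G.Adj a y) ∧
      (∀ a, h a ≠ 0 → G.Adj a y) ∧ m y = m' x ∧ i ≠ x ∧ G.Adj i y ∧ h x = 0 ∧ h i = 0 ∧
      F x (m + Pi.single z 1) - F x (m + Pi.single y 1 + Pi.single z 1) - F x (m + Pi.single y 1)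
        + F x (m + Pi.single y 1 + Pi.single y 1) =
      F' y (m' + h + Pi.single i 1) - F' y (m' + Pi.single x 1 + Pi.single i 1)
        - F' y (m' + h + Pi.single x 1) + F' y (m' + Pi.single x 1 + Pi.single x 1) := by
  have hU := biconnectedIn hV hloop hG x
  have hne : ∀ b, G.Adj x b → x ≠ b := by rintro b hb rfl; exact hloop _ hb
  have hmem : ∀ b, (.inr b : V ⊕ V) ∈ {p : V ⊕ V | p ≠ .inl x} := fun b => by simp
  have hinj : ∀ {a b : V}, a ≠ b → (.inr a : V ⊕ V) ≠ .inr b := fun h => by simpa using h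
  have hyx := hne y hy
  have hzx := hne z hz
  -- Both cycles close up through the edge from `inl x` to `inr y`, hence meet exactly at its two
  -- ends: the second differences there compensate each other.
  obtain ⟨P, Q, hP, hQ, hPQ, hPz, hQx, -, -⟩ := hU.fan (hmem z) (hmem x) (hinj hzx.symm) (hmem y)
  obtain ⟨i, C, hC⟩ := exists_isCycle hyz.symm (fun h => hP h rfl) (Or.inl hz) (Or.inl hy) hPz
  obtain ⟨i', D, hD⟩ := exists_isCycle hyx (fun h => hQ h rfl) (Or.inr rfl) (Or.inl hy) hQx
  have hii' : i ≠ i' := by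
    rintro rfl
    have : (.inl i : V ⊕ V) ∈ P ∩ Q := ⟨hC.last_mem, hD.last_mem⟩
    rw [hPQ] at this
    simp at this
  obtain ⟨K, hK, hKle⟩ := exists_large_flow hloop hG (size C + size D + 2)
  have bC := neg_size_le C
  have bD := neg_size_le D
  have f1 : IsFlow G (K + C) := by
    refine hK.add_of hC.closed hC.inc fun a b hab _ => ?_
    have := bC a b; have := hKle a b hab; push_cast at this; omega
  have f2 : IsFlow G (K + D) := by
    refine hK.add_of hD.closed hD.inc fun a b hab _ => ?_
    have := bD a b; have := hKle a b hab; push_cast at this; omega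
  have f3 : IsFlow G (K + C + D) := by
    rw [add_assoc]
    refine hK.add_of (by rw [map_add, hC.closed, hD.closed, add_zero]) (inc_add hC.inc hD.inc)
      fun a b hab _ => ?_
    have := bC a b; have := bD a b; have := hKle a b hab; push_cast at this
    simp only [Pi.add_apply]; omega
  have key := second_difference_pair hF.sum_nodeFun hK f1 f2 f3 (p := .inl x) (q := .inr y)
    (by simp) <| by
    intro v hv hvy
    by_cases hvP : v ∈ P
    · refine Or.inr (hD.slice_eq_zero hv fun hvQ => hvy ?_)
      have : v ∈ P ∩ Q := ⟨hvP, hvQ⟩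
      rwa [hPQ] at this
    · exact Or.inl (hC.slice_eq_zero hv hvP)
  have hKxy := hKle x y hy
  have hCcol : ∀ a, C a y = (if a = i then 1 else 0) - if a = x then 1 else 0 := by
    intro a
    by_cases h1 : a = x
    · rw [h1, hC.row]; simp [hyz, hC.ne.symm]
    · rw [hC.last a h1, if_neg h1, sub_zero]
  have hDcol : ∀ a, D a y = (if a = i' then 1 else 0) - if a = x then 1 else 0 := by
    intro a
    by_cases h1 : a = x
    · rw [h1, hD.row]; simp [hyx.symm, hD.ne.symm]
    · rw [hD.last a h1, if_neg h1, sub_zero]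
  have hinc : ∀ {j k i : V} {S : Set (V ⊕ V)} {C : V → V → ℤ}, IsCycle G x j k i S C → i ≠ k →
      G.Adj i k := by
    intro j k i S C hC hik
    have h1 : C i k ≠ 0 := by rw [hC.last i hC.ne, if_pos rfl]; norm_num
    exact (hC.inc i k h1).resolve_right hik
  -- Each of the two cycles takes one unit off the entry (x, y), so two units are set aside. The
  -- common remainder is what makes m y = m' x.
  obtain ⟨m, hm⟩ : ∃ m : V → ℕ, m = fun b => if b = x then 0 else
      if b = y then (K x y - 2).toNat else (K x b).toNat := ⟨_, rfl⟩
  obtain ⟨m', hm'⟩ : ∃ m' : V → ℕ, m' = fun a => if a = y then 0 else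
      if a = x then (K x y - 2).toNat else (K a y).toNat := ⟨_, rfl⟩
  have hms : ∀ b, m b ≠ 0 → G.Adj x b := by
    intro b hb
    by_cases hbx : b = x
    · simp [hm, hbx] at hb
    · by_cases hby : b = y
      · exact hby ▸ hy
      · have : K x b ≠ 0 := by rintro h0; simp [hm, hbx, hby, h0] at hb
        exact (hK.inc x b this).resolve_right (Ne.symm hbx)
  have hms' : ∀ a, m' a ≠ 0 → G.Adj a y := by
    intro a ha
    by_cases hax : a = x
    · exact hax ▸ hy
    · by_cases hay : a = y
      · simp [hm', hay] at ha
      · have : K a y ≠ 0 := by rintro h0; simp [hm', hax, hay, h0] at ha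
        exact (hK.inc a y this).resolve_right hay
  have hmz : ∀ b, b ≠ x → K x b = m b + 2 * if b = y then 1 else 0 := by
    intro b hb
    have h0 := hK.nonneg x b (Ne.symm hb)
    by_cases hby : b = y
    · subst hby; simp [hm, hb]; push_cast at hKxy; omega
    · simp [hm, hb, hby]; omega
  have hmz' : ∀ a, a ≠ y → K a y = m' a + 2 * if a = x then 1 else 0 := by
    intro a ha
    have h0 := hK.nonneg a y ha
    by_cases hax : a = x
    · subst hax; simp [hm', ha]; push_cast at hKxy; omega
    · simp [hm', ha, hax]; omega
  have hmx : m x = 0 := by simp [hm]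
  have hmy' : m' y = 0 := by simp [hm']
  have hmm' : m y = m' x := by simp [hm, hm', hyx, hyx.symm]
  have hix := hC.ne
  have hix' := hD.ne
  clear hm hm'
  have e1 : offDiag x (K x + (Pi.single z 1 - Pi.single y 1) + (Pi.single x 1 - Pi.single y 1))
      = m + Pi.single z 1 := offDiag_eq (fun b hb => by
    simp only [Pi.add_apply, Pi.sub_apply, hmz b hb, Pi.single_apply, if_neg hb, Nat.cast_add,
      Nat.cast_ite, Nat.cast_one, Nat.cast_zero]
    ring) (by simp [hmx, hzx])
  have e2 : offDiag x (K x + (Pi.single z 1 - Pi.single y 1))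
      = m + Pi.single y 1 + Pi.single z 1 := offDiag_eq (fun b hb => by
    simp only [Pi.add_apply, Pi.sub_apply, hmz b hb, Pi.single_apply, Nat.cast_add,
      Nat.cast_ite, Nat.cast_one, Nat.cast_zero]
    ring) (by simp [hmx, hzx, hyx])
  have e3 : offDiag x (K x + (Pi.single x 1 - Pi.single y 1))
      = m + Pi.single y 1 := offDiag_eq (fun b hb => by
    simp only [Pi.add_apply, Pi.sub_apply, hmz b hb, Pi.single_apply, if_neg hb, Nat.cast_add,
      Nat.cast_ite, Nat.cast_one, Nat.cast_zero]
    ring) (by simp [hmx, hyx])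
  have e4 : offDiag x (K x) = m + Pi.single y 1 + Pi.single y 1 := offDiag_eq (fun b hb => by
    simp only [Pi.add_apply, hmz b hb, Pi.single_apply, Nat.cast_add,
      Nat.cast_ite, Nat.cast_one, Nat.cast_zero]
    ring) (by simp [hmx, hyx])
  simp only [nodeFun, slice, Sum.elim_inl, Sum.elim_inr, Pi.add_apply, hC.row, hD.row, e1, e2, e3,
    e4] at key
  have g4 : offDiag y (fun a => K a y) = m' + Pi.single x 1 + Pi.single x 1 :=
    offDiag_eq (fun a ha => by
      simp only [Pi.add_apply, hmz' a ha, Pi.single_apply, Nat.cast_add, Nat.cast_ite,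
        Nat.cast_one, Nat.cast_zero]
      ring) (by simp [hmy', hyx.symm])
  -- A cycle that reaches `y` from its other side does not contribute to the incoming flow.
  have hcol : ∀ h h' : V → ℕ, (∀ a, a ≠ y → h a = if a = i then 1 else 0) → h y = 0 →
      (∀ a, a ≠ y → h' a = if a = i' then 1 else 0) → h' y = 0 →
      F x (m + Pi.single z 1) - F x (m + Pi.single y 1 + Pi.single z 1) - F x (m + Pi.single y 1)
        + F x (m + Pi.single y 1 + Pi.single y 1) =
      F' y (m' + h' + h) - F' y (m' + Pi.single x 1 + h)
        - F' y (m' + h' + Pi.single x 1) + F' y (m' + Pi.single x 1 + Pi.single x 1) := by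
    intro h h' hh hhy hh' hhy'
    have g1 : offDiag y (fun a => K a y + C a y + D a y) = m' + h' + h :=
      offDiag_eq (fun a ha => by
        simp only [Pi.add_apply, hmz' a ha, hCcol, hDcol, hh a ha, hh' a ha, Nat.cast_add,
          Nat.cast_ite, Nat.cast_one, Nat.cast_zero]
        ring) (by simp [hmy', hhy, hhy'])
    have g2 : offDiag y (fun a => K a y + C a y) = m' + Pi.single x 1 + h :=
      offDiag_eq (fun a ha => by
        simp only [Pi.add_apply, hmz' a ha, hCcol, hh a ha, Pi.single_apply, Nat.cast_add,
          Nat.cast_ite, Nat.cast_one, Nat.cast_zero]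
        ring) (by simp [hmy', hhy, hyx.symm])
    have g3 : offDiag y (fun a => K a y + D a y) = m' + h' + Pi.single x 1 :=
      offDiag_eq (fun a ha => by
        simp only [Pi.add_apply, hmz' a ha, hDcol, hh' a ha, Pi.single_apply, Nat.cast_add,
          Nat.cast_ite, Nat.cast_one, Nat.cast_zero]
        ring) (by simp [hmy', hhy', hyx.symm])
    rw [g1, g2, g3, g4] at key
    linarith
  -- A cycle arriving at `inr y` from `inl y` uses the diagonal and leaves the incoming flow at y
  -- unchanged off the diagonal. As i ≠ i', this happens for at most one cycle; the other supplies
  -- the required predecessor.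
  by_cases hiy : i = y
  · have hiy' : i' ≠ y := fun h => hii' (hiy.trans h.symm)
    refine ⟨m, m', 0, i', hms, hms', by simp, hmm', hix', hinc hD hiy', rfl, rfl, ?_⟩
    have := hcol 0 (Pi.single i' 1) (fun a ha => by simp [hiy, ha]) rfl
      (fun a _ => by simp [Pi.single_apply]) (by simp [hiy'.symm])
    rw [this, add_zero, add_zero, add_zero, add_right_comm m' (Pi.single x 1)]
    ring_nf
  · refine ⟨m, m', fun a => if a = i' ∧ i' ≠ y then 1 else 0, i, hms, hms', ?_, hmm', hix,
      hinc hC hiy, by simp [hix'.symm], by simp [hii'], ?_⟩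
    · intro a ha
      obtain ⟨rfl, h2⟩ : a = i' ∧ i' ≠ y := by by_contra hne; simp [hne] at ha
      exact hinc hD h2
    refine hcol _ _ (fun a _ => by simp [Pi.single_apply]) (by simp [Ne.symm hiy]) ?_ ?_
    · intro a ha
      exact if_congr ⟨fun h => h.1, fun h => ⟨h, fun h' => ha (h.trans h')⟩⟩ rfl rfl
    · exact if_neg fun h => h.2 h.1.symm

end SplitGraph

namespace SplitGraph

variable {V : Type*} [Fintype V] [DecidableEq V] {G : Digraph V} {F F' : V → (V → ℕ) → ℝ}

/-- Two cycles that go through the vertex `x`, and share no other vertex. -/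
theorem vertex_difference_eq (hV : HasThree V) (hloop : ∀ x, ¬ G.Adj x x)
    (hG : TwoConnected G) (hF : FlowEquation G F F') {x y z : V}
    (hy : G.Adj x y) (hz : G.Adj x z) (hyz : y ≠ z) :
    ∃ m m' : V → ℕ, ∃ i i' : V, (∀ b, m b ≠ 0 → G.Adj x b) ∧ (∀ a, m' a ≠ 0 → G.Adj a x) ∧
      ∑ b, m b = ∑ a, m' a ∧ i ≠ i' ∧ G.Adj i x ∧ G.Adj i' x ∧
      F x (m + Pi.single y 1 + Pi.single z 1) - F x (m + Pi.single y 1) - F x (m + Pi.single z 1)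
        + F x m =
      F' x (m' + Pi.single i 1 + Pi.single i' 1) - F' x (m' + Pi.single i 1)
        - F' x (m' + Pi.single i' 1) + F' x m' := by
  have hU := biconnectedIn hV hloop hG x
  have hne : ∀ b, G.Adj x b → x ≠ b := by rintro b hb rfl; exact hloop _ hb
  have hmem : ∀ b, (.inr b : V ⊕ V) ∈ {p : V ⊕ V | p ≠ .inl x} := fun b => by simp
  have hinj : ∀ {a b : V}, a ≠ b → (.inr a : V ⊕ V) ≠ .inr b := fun h => by simpa using h
  have hyx := hne y hy
  have hzx := hne z hz
  -- The cycles meet exactly at `inl x` and `inr x`, the two ends of the diagonal edge of x.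
  obtain ⟨P, Q, hP, hQ, hPQ, hPy, hQz, -, -⟩ := hU.fan (hmem y) (hmem z) (hinj hyz) (hmem x)
  obtain ⟨i, C, hC⟩ := exists_isCycle hyx.symm (fun h => hP h rfl) (Or.inl hy) (Or.inr rfl) hPy
  obtain ⟨i', D, hD⟩ := exists_isCycle hzx.symm (fun h => hQ h rfl) (Or.inl hz) (Or.inr rfl) hQz
  have hii' : i ≠ i' := by
    rintro rfl
    have : (.inl i : V ⊕ V) ∈ P ∩ Q := ⟨hC.last_mem, hD.last_mem⟩
    rw [hPQ] at this
    simp at this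
  obtain ⟨K, hK, hKle⟩ := exists_large_flow hloop hG (size C + size D)
  have bC := neg_size_le C
  have bD := neg_size_le D
  have f1 : IsFlow G (K + C) := by
    refine hK.add_of hC.closed hC.inc fun a b hab _ => ?_
    have := bC a b; have := hKle a b hab; push_cast at this; omega
  have f2 : IsFlow G (K + D) := by
    refine hK.add_of hD.closed hD.inc fun a b hab _ => ?_
    have := bD a b; have := hKle a b hab; push_cast at this; omega
  have f3 : IsFlow G (K + C + D) := by
    rw [add_assoc]
    refine hK.add_of (by rw [map_add, hC.closed, hD.closed, add_zero]) (inc_add hC.inc hD.inc)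
      fun a b hab _ => ?_
    have := bC a b; have := bD a b; have := hKle a b hab; push_cast at this
    simp only [Pi.add_apply]; omega
  have key := second_difference_pair hF.sum_nodeFun hK f1 f2 f3 (p := .inl x) (q := .inr x)
    (by simp) <| by
    intro v hv hvx
    by_cases hvP : v ∈ P
    · refine Or.inr (hD.slice_eq_zero hv fun hvQ => hvx ?_)
      have : v ∈ P ∩ Q := ⟨hvP, hvQ⟩
      rwa [hPQ] at this
    · exact Or.inl (hC.slice_eq_zero hv hvP)
  have hinc : ∀ {j i : V} {S : Set (V ⊕ V)} {C : V → V → ℤ}, IsCycle G x j x i S C →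
      G.Adj i x := by
    intro j i S C hC
    have h1 : C i x ≠ 0 := by rw [hC.last i hC.ne, if_pos rfl]; norm_num
    exact (hC.inc i x h1).resolve_right hC.ne
  have hm : ∀ b, b ≠ x → K x b = offDiag x (K x) b := by
    intro b hb
    have := hK.nonneg x b (Ne.symm hb)
    simp [offDiag, hb, this]
  have hm' : ∀ a, a ≠ x → K a x = offDiag x (fun a => K a x) a := by
    intro a ha
    have := hK.nonneg a x ha
    simp [offDiag, ha, this]
  have hmx : ∀ r : V → ℤ, offDiag x r x = 0 := fun r => by simp [offDiag]
  have e1 : offDiag x (K x + (Pi.single y 1 - Pi.single x 1) + (Pi.single z 1 - Pi.single x 1))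
      = offDiag x (K x) + Pi.single y 1 + Pi.single z 1 := offDiag_eq (fun b hb => by
    simp only [Pi.add_apply, Pi.sub_apply, hm b hb, Pi.single_apply, if_neg hb, Nat.cast_add,
      Nat.cast_ite, Nat.cast_one, Nat.cast_zero]
    ring) (by simp [hmx, hzx, hyx])
  have e2 : ∀ j, x ≠ j → offDiag x (K x + (Pi.single j 1 - Pi.single x 1))
      = offDiag x (K x) + Pi.single j 1 := fun j hj => offDiag_eq (fun b hb => by
    simp only [Pi.add_apply, Pi.sub_apply, hm b hb, Pi.single_apply, if_neg hb, Nat.cast_add,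
      Nat.cast_ite, Nat.cast_one, Nat.cast_zero]
    ring) (by simp [hmx, hj])
  have g1 : offDiag x (fun a => K a x + C a x + D a x)
      = offDiag x (fun a => K a x) + Pi.single i 1 + Pi.single i' 1 :=
    offDiag_eq (fun a ha => by
      simp only [Pi.add_apply, hm' a ha, hC.last a ha, hD.last a ha, Pi.single_apply,
        Nat.cast_add, Nat.cast_ite, Nat.cast_one, Nat.cast_zero]) (by
      simp [hmx, hC.ne.symm, hD.ne.symm])
  have g2 : offDiag x (fun a => K a x + C a x)
      = offDiag x (fun a => K a x) + Pi.single i 1 :=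
    offDiag_eq (fun a ha => by
      simp only [Pi.add_apply, hm' a ha, hC.last a ha, Pi.single_apply,
        Nat.cast_add, Nat.cast_ite, Nat.cast_one, Nat.cast_zero]) (by simp [hmx, hC.ne.symm])
  have g3 : offDiag x (fun a => K a x + D a x)
      = offDiag x (fun a => K a x) + Pi.single i' 1 :=
    offDiag_eq (fun a ha => by
      simp only [Pi.add_apply, hm' a ha, hD.last a ha, Pi.single_apply,
        Nat.cast_add, Nat.cast_ite, Nat.cast_one, Nat.cast_zero]) (by simp [hmx, hD.ne.symm])
  simp only [nodeFun, slice, Sum.elim_inl, Sum.elim_inr, Pi.add_apply, hC.row, hD.row, e1,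
    e2 y hyx, e2 z hzx, g1, g2, g3] at key
  -- Row x and column x share the diagonal entry, which is minus the total outgoing and minus the
  -- total incoming flow; this makes the totals of the two families equal.
  have hsum : ∀ r : V → ℤ, (∀ b, b ≠ x → 0 ≤ r b) → ∑ b, r b = 0 →
      (∑ b, (offDiag x r b : ℤ)) = -r x := by
    intro r hr hr0
    have h1 : ∀ b, (offDiag x r b : ℤ) = r b - if b = x then r x else 0 := by
      intro b
      by_cases hb : b = x
      · simp [offDiag, hb]
      · simp [offDiag, hb, hr b hb]
    simp [h1, hr0]
  refine ⟨offDiag x (K x), offDiag x (fun a => K a x), i, i', ?_, ?_, ?_, hii', hinc hC, hinc hD,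
    by linarith⟩
  · intro b hb
    have hbx : b ≠ x := by rintro rfl; exact hb (hmx _)
    refine (hK.inc x b fun h0 => hb ?_).resolve_right (Ne.symm hbx)
    simp [offDiag, h0]
  · intro a ha
    have hax : a ≠ x := by rintro rfl; exact ha (hmx _)
    refine (hK.inc a x fun h0 => ha ?_).resolve_right hax
    simp [offDiag, h0]
  · have h1 := hsum (K x) (fun b hb => hK.nonneg x b (Ne.symm hb)) (congrFun hK.closed (.inl x))
    have h2 := hsum (fun a => K a x) (fun a ha => hK.nonneg a x ha)
      (congrFun hK.closed (.inr x))
    exact_mod_cast h1.trans h2.symm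

end SplitGraph

/-! ### From separated ratios to Pólya urns -/

namespace UrnMoments

variable {ι : Type*} [Fintype ι] [DecidableEq ι] {f : (ι → ℕ) → ℝ}

/-- `f` satisfies the recursion of the mixed moments of a Pólya urn, of initial composition `b` and
reinforcement `c`. -/
structure IsUrn (f : (ι → ℕ) → ℝ) (b : ι → ℝ) (c : ℝ) : Prop where
  zero : f 0 = 1
  pos : ∀ i, 0 < b i
  nonneg : 0 ≤ c
  step : ∀ m i, f (m + Pi.single i 1) * (∑ j, b j + c * ∑ j, (m j : ℝ)) = f m * (b i + c * m i)

/-- The ratio of two increments of `f`. -/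
noncomputable def ratio (f : (ι → ℕ) → ℝ) (y z : ι) (m : ι → ℕ) : ℝ :=
  f (m + Pi.single y 1) / f (m + Pi.single z 1)

theorem ratio_pos (hpos : ∀ m, 0 < f m) (y z : ι) (m : ι → ℕ) : 0 < ratio f y z m :=
  div_pos (hpos _) (hpos _)

theorem ratio_mul_ratio (hpos : ∀ m, 0 < f m) (x y z : ι) (m : ι → ℕ) :
    ratio f x y m * ratio f y z m = ratio f x z m := by
  have h1 := (hpos (m + Pi.single y 1)).ne'
  have h2 := (hpos (m + Pi.single z 1)).ne'
  unfold ratio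
  field_simp

theorem ratio_add_single (hpos : ∀ m, 0 < f m)
    (h : ∀ (m : ι → ℕ) (u y z : ι), u ≠ y → u ≠ z → y ≠ z →
      f (m + Pi.single u 1 + Pi.single y 1) * f (m + Pi.single z 1) =
        f (m + Pi.single u 1 + Pi.single z 1) * f (m + Pi.single y 1))
    {y z u : ι} (hyz : y ≠ z) (huy : u ≠ y) (huz : u ≠ z) (m : ι → ℕ) (k : ℕ) :
    ratio f y z (m + Pi.single u k) = ratio f y z m := by
  induction k with
  | zero => simp
  | succ k ih =>
    rw [← ih, Pi.single_add, ← add_assoc]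
    unfold ratio
    rw [div_eq_div_iff (hpos _).ne' (hpos _).ne', h _ u y z huy huz hyz, mul_comm]

theorem ratio_add_sum (hpos : ∀ m, 0 < f m)
    (h : ∀ (m : ι → ℕ) (u y z : ι), u ≠ y → u ≠ z → y ≠ z →
      f (m + Pi.single u 1 + Pi.single y 1) * f (m + Pi.single z 1) =
        f (m + Pi.single u 1 + Pi.single z 1) * f (m + Pi.single y 1))
    {y z : ι} (hyz : y ≠ z) (m n : ι → ℕ) (s : Finset ι) (hy : y ∉ s) (hz : z ∉ s) :
    ratio f y z (m + ∑ u ∈ s, Pi.single u (n u)) = ratio f y z m := by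
  induction s using Finset.induction_on with
  | empty => simp
  | insert u s hu ih =>
    simp only [Finset.mem_insert, not_or] at hy hz
    rw [Finset.sum_insert hu, ← add_assoc, add_right_comm,
      ratio_add_single hpos h hyz (Ne.symm hy.1) (Ne.symm hz.1), ih hy.2 hz.2]

/-- By `h`, a passage in a third direction does not affect the ratio, so all directions other than
`y` and `z` can be erased from `m`. -/
theorem ratio_eq_pair (hpos : ∀ m, 0 < f m)
    (h : ∀ (m : ι → ℕ) (u y z : ι), u ≠ y → u ≠ z → y ≠ z →
      f (m + Pi.single u 1 + Pi.single y 1) * f (m + Pi.single z 1) =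
        f (m + Pi.single u 1 + Pi.single z 1) * f (m + Pi.single y 1))
    {y z : ι} (hyz : y ≠ z) (m : ι → ℕ) :
    ratio f y z m = ratio f y z (Pi.single y (m y) + Pi.single z (m z)) := by
  have hm : m = Pi.single y (m y) + Pi.single z (m z)
      + ∑ u ∈ (Finset.univ.erase y).erase z, Pi.single u (m u) := by
    rw [add_assoc, Finset.add_sum_erase _ (fun u => Pi.single u (m u)) (by simp [hyz.symm]),
      Finset.add_sum_erase _ (fun u => Pi.single u (m u)) (by simp), Finset.univ_sum_single]
  conv_lhs => rw [hm]
  exact ratio_add_sum hpos h hyz _ _ _ (by simp) (by simp)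

/-- The unit-step relation says that the mixed second difference of the logarithm of the ratio
vanishes; it is summed over a rectangle by induction on each side. -/
theorem ratio_mul_ratio_pair
    (h : ∀ (m : ι → ℕ) (y z : ι), y ≠ z →
      ratio f y z (m + Pi.single y 1 + Pi.single z 1) * ratio f y z m =
        ratio f y z (m + Pi.single y 1) * ratio f y z (m + Pi.single z 1))
    (hpos : ∀ m, 0 < f m) {y z : ι} (hyz : y ≠ z) (m : ι → ℕ) (i j : ℕ) :
    ratio f y z (m + Pi.single y i + Pi.single z j) * ratio f y z m =
      ratio f y z (m + Pi.single y i) * ratio f y z (m + Pi.single z j) := by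
  have hp := ratio_pos hpos y z
  have h1 : ∀ (m : ι → ℕ) (i : ℕ), ratio f y z (m + Pi.single y i + Pi.single z 1) * ratio f y z m =
      ratio f y z (m + Pi.single y i) * ratio f y z (m + Pi.single z 1) := by
    intro m i
    induction i with
    | zero => simp [mul_comm]
    | succ i ih =>
      have := h (m + Pi.single y i) y z hyz
      rw [Pi.single_add, ← add_assoc]
      have e1 := (hp (m + Pi.single y i)).ne'
      apply mul_right_cancel₀ e1
      calc _ = (ratio f y z (m + Pi.single y i + Pi.single y 1 + Pi.single z 1)
            * ratio f y z (m + Pi.single y i)) * ratio f y z m := by ring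
        _ = ratio f y z (m + Pi.single y i + Pi.single y 1) *
            (ratio f y z (m + Pi.single y i + Pi.single z 1) * ratio f y z m) := by rw [this]; ring
        _ = _ := by rw [ih]; ring
  induction j with
  | zero => simp
  | succ j ih =>
    have := h1 (m + Pi.single z j) i
    rw [Pi.single_add, ← add_assoc, ← add_assoc]
    have e1 := (hp (m + Pi.single z j)).ne'
    apply mul_right_cancel₀ e1
    rw [add_right_comm m (Pi.single z j)] at this
    calc _ = (ratio f y z (m + Pi.single y i + Pi.single z j + Pi.single z 1)
          * ratio f y z (m + Pi.single z j)) * ratio f y z m := by ring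
      _ = (ratio f y z (m + Pi.single y i + Pi.single z j) * ratio f y z m) *
          ratio f y z (m + Pi.single z j + Pi.single z 1) := by rw [this]; ring
      _ = _ := by rw [ih]; ring

theorem exists_weights [Nontrivial ι] (hpos : ∀ m, 0 < f m)
    (h : ∀ (m : ι → ℕ) (u y z : ι), u ≠ y → u ≠ z → y ≠ z →
      f (m + Pi.single u 1 + Pi.single y 1) * f (m + Pi.single z 1) =
        f (m + Pi.single u 1 + Pi.single z 1) * f (m + Pi.single y 1))
    (h' : ∀ (m : ι → ℕ) (y z : ι), y ≠ z →
      ratio f y z (m + Pi.single y 1 + Pi.single z 1) * ratio f y z m =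
        ratio f y z (m + Pi.single y 1) * ratio f y z (m + Pi.single z 1)) :
    ∃ a : ι → ℕ → ℝ, (∀ y k, 0 < a y k) ∧ ∀ (m : ι → ℕ) (y z : ι),
      f (m + Pi.single y 1) * a z (m z) = f (m + Pi.single z 1) * a y (m y) := by
  obtain ⟨q, o, hqo⟩ := exists_pair_ne ι
  have hp := fun y z m => ratio_pos hpos y z m
  -- Weights relative to a reference direction o, normalised to 1 for o at 0. The dependence on the
  -- flow along o is read off a single ratio q/o; `key` shows that any other ratio y/o would give
  -- the same.
  refine ⟨fun y k => if y = o then ratio f q o 0 / ratio f q o (Pi.single o k)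
    else ratio f y o (Pi.single y k), fun y k => ?_, ?_⟩
  · dsimp only
    split_ifs
    · exact div_pos (hp _ _ _) (hp _ _ _)
    · exact hp _ _ _
  have key : ∀ y, y ≠ o → ∀ m : ι → ℕ, ratio f y o m * ratio f q o 0 =
      ratio f y o (Pi.single y (m y)) * ratio f q o (Pi.single o (m o)) := by
    intro y hy m
    have e1 := ratio_mul_ratio_pair h' hpos hy 0 (m y) (m o)
    rw [zero_add, zero_add, ← ratio_eq_pair hpos h hy] at e1
    have e2 : ratio f y o (Pi.single o (m o)) * ratio f q o 0 =
        ratio f q o (Pi.single o (m o)) * ratio f y o 0 := by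
      by_cases hyq : y = q
      · rw [hyq]
      · have e3 := ratio_add_single hpos h hyq (Ne.symm hy) (Ne.symm hqo) 0 (m o)
        rw [zero_add] at e3
        rw [← ratio_mul_ratio hpos y q o, ← ratio_mul_ratio hpos y q o, e3]
        ring
    apply mul_right_cancel₀ (hp y o 0).ne'
    calc _ = (ratio f y o m * ratio f y o 0) * ratio f q o 0 := by ring
      _ = ratio f y o (Pi.single y (m y)) * (ratio f y o (Pi.single o (m o)) * ratio f q o 0) := by
        rw [e1]; ring
      _ = _ := by rw [e2]; ring
  have key' : ∀ y (m : ι → ℕ), f (m + Pi.single y 1) = f (m + Pi.single o 1) *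
      ((if y = o then ratio f q o 0 / ratio f q o (Pi.single o (m y))
        else ratio f y o (Pi.single y (m y))) *
          (ratio f q o (Pi.single o (m o)) / ratio f q o 0)) := by
    intro y m
    have e0 := (hp q o 0).ne'
    have e1 := (hp q o (Pi.single o (m o))).ne'
    split_ifs with hy
    · subst hy; field_simp
    · have e2 := (hpos (m + Pi.single o 1)).ne'
      have : f (m + Pi.single y 1) = f (m + Pi.single o 1) * ratio f y o m := by
        unfold ratio; field_simp
      rw [this, ← mul_div_assoc, ← key y hy m]
      field_simp
  intro m y z
  rw [key' y m, key' z m]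
  ring

/-- Positive mixed moments of a point of the simplex whose increments have separated ratios are
those of a Pólya urn. -/
theorem exists_isUrn [Nontrivial ι] (hpos : ∀ m, 0 < f m) (h0 : f 0 = 1)
    (hsum : ∀ m, ∑ i, f (m + Pi.single i 1) = f m)
    (h : ∀ (m : ι → ℕ) (u y z : ι), u ≠ y → u ≠ z → y ≠ z →
      f (m + Pi.single u 1 + Pi.single y 1) * f (m + Pi.single z 1) =
        f (m + Pi.single u 1 + Pi.single z 1) * f (m + Pi.single y 1))
    (h' : ∀ (m : ι → ℕ) (y z : ι), y ≠ z →
      ratio f y z (m + Pi.single y 1 + Pi.single z 1) * ratio f y z m =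
        ratio f y z (m + Pi.single y 1) * ratio f y z (m + Pi.single z 1)) :
    ∃ b c, IsUrn f b c := by
  obtain ⟨a, ha, hfa⟩ := exists_weights hpos h h'
  have hS : ∀ m y, f (m + Pi.single y 1) * ∑ u, a u (m u) = f m * a y (m y) := by
    intro m y
    rw [Finset.mul_sum, ← hsum m, Finset.sum_mul]
    exact Finset.sum_congr rfl fun u _ => hfa m y u
  have hSpos : ∀ m : ι → ℕ, 0 < ∑ u, a u (m u) := fun m =>
    Finset.sum_pos (fun u _ => ha u _) Finset.univ_nonempty
  have hSadd : ∀ (m : ι → ℕ) y, ∑ u, a u ((m + Pi.single y 1 : ι → ℕ) u) =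
      ∑ u, a u (m u) + (a y (m y + 1) - a y (m y)) := by
    intro m y
    rw [← Finset.add_sum_erase _ _ (Finset.mem_univ y),
      ← Finset.add_sum_erase (f := fun u => a u (m u)) _ (Finset.mem_univ y)]
    have : ∑ u ∈ Finset.univ.erase y, a u ((m + Pi.single y 1 : ι → ℕ) u) =
        ∑ u ∈ Finset.univ.erase y, a u (m u) :=
      Finset.sum_congr rfl fun u hu => by simp [Finset.ne_of_mem_erase hu]
    rw [this]
    simp
    ring
  -- Adding y then z, or z then y, leads to the same moment, which forces equal increments of the
  -- weights. One side depends only on m y and the other only on m z, so the increment is a constant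
  -- and the weights are affine.
  have hinc : ∀ (m : ι → ℕ) y z, y ≠ z →
      a y (m y + 1) - a y (m y) = a z (m z + 1) - a z (m z) := by
    intro m y z hyz
    have e1 := hS (m + Pi.single y 1) z
    have e2 := hS (m + Pi.single z 1) y
    have e3 := hS m y
    have e4 := hS m z
    rw [hSadd] at e1 e2
    simp only [Pi.add_apply, Pi.single_apply, hyz, hyz.symm, if_false, add_zero] at e1 e2
    rw [add_right_comm m (Pi.single z 1)] at e2
    have hf := hpos (m + Pi.single y 1 + Pi.single z 1)
    have hs := hSpos m
    have : f (m + Pi.single y 1 + Pi.single z 1) * (∑ u, a u (m u)) *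
        ((a y (m y + 1) - a y (m y)) - (a z (m z + 1) - a z (m z))) = 0 := by
      linear_combination (∑ u, a u (m u)) * e1 - (∑ u, a u (m u)) * e2
        + a z (m z) * e3 - a y (m y) * e4
    rcases mul_eq_zero.1 this with h | h
    · exact absurd h (mul_pos hf hs).ne'
    · linarith
  obtain ⟨q, o, hqo⟩ := exists_pair_ne ι
  have hstep : ∀ y k, a y (k + 1) - a y k = a o 1 - a o 0 := by
    intro y k
    by_cases hy : y = o
    · subst hy
      have e1 := hinc (Pi.single y k) y q hqo.symm
      have e2 := hinc 0 y q hqo.symm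
      simp [hqo] at e1 e2
      linarith
    · have e1 := hinc (Pi.single y k) y o hy
      simpa [Ne.symm hy] using e1
  have hlin : ∀ y (k : ℕ), a y k = a y 0 + (a o 1 - a o 0) * k := by
    intro y k
    induction k with
    | zero => simp
    | succ k ih => push_cast; linarith [hstep y k]
  refine ⟨fun y => a y 0, a o 1 - a o 0, h0, fun i => ha i 0, ?_, fun m i => ?_⟩
  -- A negative slope would make the positive weights eventually negative.
  · by_contra hc
    push Not at hc
    obtain ⟨k, hk⟩ := exists_nat_gt (a o 0 / -(a o 1 - a o 0))
    rw [div_lt_iff₀ (by linarith)] at hk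
    have := ha o k
    rw [hlin] at this
    linarith
  · rw [← hlin, ← hS m i, Finset.mul_sum Finset.univ (fun j => (m j : ℝ)),
      ← Finset.sum_add_distrib]
    simp only [← hlin]

end UrnMoments

namespace UrnMoments

namespace IsUrn

variable {ι : Type*} [Fintype ι] [DecidableEq ι] {f : (ι → ℕ) → ℝ} {b : ι → ℝ} {c : ℝ}

theorem weight_pos (h : IsUrn f b c) (m : ι → ℕ) (i : ι) : 0 < b i + c * m i :=
  add_pos_of_pos_of_nonneg (h.pos i) (mul_nonneg h.nonneg (Nat.cast_nonneg _))

theorem total_pos [Nonempty ι] (h : IsUrn f b c) (m : ι → ℕ) :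
    0 < ∑ j, b j + c * ∑ j, (m j : ℝ) :=
  add_pos_of_pos_of_nonneg (Finset.sum_pos (fun i _ => h.pos i) Finset.univ_nonempty)
    (mul_nonneg h.nonneg (Finset.sum_nonneg fun _ _ => Nat.cast_nonneg _))

theorem exchange (h : IsUrn f b c) (m : ι → ℕ) (i j : ι) :
    f (m + Pi.single i 1) * (b j + c * m j) = f (m + Pi.single j 1) * (b i + c * m i) := by
  have : Nonempty ι := ⟨i⟩
  apply mul_right_cancel₀ (h.total_pos m).ne'
  linear_combination (b j + c * m j) * h.step m i - (b i + c * m i) * h.step m j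

/-- Two exchanges of i and y, at `m + k` and at `m + Pi.single y 1`, involve the same weight of i,
which cancels. What remains is the weight of y before and after one passage, independently of `k`.
-/
theorem edge_ratio (h : IsUrn f b c) (m k : ι → ℕ) {i y : ι} (hiy : i ≠ y) (hki : k i = 0)
    (hky : k y = 0) :
    f (m + k + Pi.single i 1) * f (m + Pi.single y 1 + Pi.single y 1) * (b y + c * m y) =
      f (m + Pi.single y 1 + Pi.single i 1) * f (m + k + Pi.single y 1) *
        (b y + c * (m y + 1)) := by
  have e1 := h.exchange (m + k) i y
  have e2 := h.exchange (m + Pi.single y 1) y i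
  simp only [Pi.add_apply, hki, hky, Pi.single_eq_same, Pi.single_eq_of_ne hiy, add_zero] at e1 e2
  push_cast at e2
  apply mul_right_cancel₀ (h.weight_pos m i).ne'
  linear_combination f (m + Pi.single y 1 + Pi.single y 1) * (b i + c * m i) * e1
    + f (m + k + Pi.single y 1) * (b i + c * m i) * e2

/-- A passage along y does not alter the weight of z, so only the total weights, before and after,
survive in the quotient. -/
theorem vertex_ratio (h : IsUrn f b c) (m : ι → ℕ) {y z : ι} (hyz : y ≠ z) :
    f (m + Pi.single y 1 + Pi.single z 1) * f m * (∑ j, b j + c * (∑ j, (m j : ℝ) + 1)) =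
      f (m + Pi.single y 1) * f (m + Pi.single z 1) * (∑ j, b j + c * ∑ j, (m j : ℝ)) := by
  have e1 := h.step (m + Pi.single y 1) z
  have e2 := h.step m z
  have e3 : ∑ j, (((m + Pi.single y 1 : ι → ℕ) j : ℕ) : ℝ) = ∑ j, (m j : ℝ) + 1 := by
    simp [Finset.sum_add_distrib, Pi.single_apply]
  rw [e3] at e1
  simp only [Pi.add_apply, Pi.single_eq_of_ne hyz.symm, add_zero] at e1
  linear_combination f m * e1 - f (m + Pi.single y 1) * e2

theorem div (h : IsUrn f b c) (hc : c ≠ 0) : IsUrn f (fun i => b i / c) 1 := by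
  have hc' : 0 < c := lt_of_le_of_ne h.nonneg (Ne.symm hc)
  refine ⟨h.zero, fun i => div_pos (h.pos i) hc', zero_le_one, fun m i => ?_⟩
  have := h.step m i
  rw [← Finset.sum_div]
  field_simp
  linarith

end IsUrn

end UrnMoments

/-! ### Moment families that solve the flow equation -/

open SplitGraph UrnMoments

section

variable {V : Type*} [Fintype V] [DecidableEq V] {G : Digraph V}

theorem log_second_difference {a b c d : ℝ} (ha : 0 < a) (hb : 0 < b) (hc : 0 < c) (hd : 0 < d) :
    Real.log a - Real.log b - Real.log c + Real.log d = Real.log (a * d / (b * c)) := by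
  rw [Real.log_div (mul_pos ha hd).ne' (mul_pos hb hc).ne', Real.log_mul ha.ne' hd.ne',
    Real.log_mul hb.ne' hc.ne']
  ring

open Classical in
/-- The extension by zero of a flow along the edges leaving `x`. -/
noncomputable def extendOut (G : Digraph V) (x : V) (m : {y // G.Adj x y} → ℕ) : V → ℕ :=
  fun y => if h : G.Adj x y then m ⟨y, h⟩ else 0

theorem extendOut_supp (x : V) (m : {y // G.Adj x y} → ℕ) (y : V)
    (h : extendOut G x m y ≠ 0) : G.Adj x y := by
  by_contra h'
  exact h (by simp [extendOut, h'])

theorem extendOut_add (x : V) (m n : {y // G.Adj x y} → ℕ) :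
    extendOut G x (m + n) = extendOut G x m + extendOut G x n := by
  ext y
  by_cases h : G.Adj x y <;> simp [extendOut, h]

theorem extendOut_zero (x : V) : extendOut G x 0 = 0 := by
  ext y
  simp [extendOut]

theorem extendOut_single (x : V) (i : {y // G.Adj x y}) (k : ℕ) :
    extendOut G x (Pi.single i k) = Pi.single i.1 k := by
  ext y
  by_cases h : G.Adj x y
  · simp [extendOut, h, Pi.single_apply, Subtype.ext_iff]
  · have : y ≠ i.1 := by rintro rfl; exact h i.2
    simp [extendOut, h, this]

theorem extendOut_restrict (x : V) (m : V → ℕ) (hm : ∀ y, m y ≠ 0 → G.Adj x y) :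
    extendOut G x (fun i => m i.1) = m := by
  ext y
  by_cases h : G.Adj x y
  · simp [extendOut, h]
  · have : m y = 0 := by by_contra h0; exact h (hm y h0)
    simp [extendOut, h, this]

open Classical in
/-- `f x` behaves as the mixed moments of a random transition probability at `x`. -/
structure IsMomentFamily (G : Digraph V) (f : V → (V → ℕ) → ℝ) : Prop where
  zero : ∀ x, f x 0 = 1
  pos : ∀ x m, (∀ y, m y ≠ 0 → G.Adj x y) → 0 < f x m
  sum : ∀ x m, (∀ y, m y ≠ 0 → G.Adj x y) →
    ∑ y : {y // G.Adj x y}, f x (m + Pi.single y.1 1) = f x m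

/-- Successors in G are predecessors in the reversed graph, where `exists_adj_ne` finds one away
from any given other vertex. -/
theorem nontrivial_out (hV : HasThree V) (hloop : ∀ x, ¬ G.Adj x x)
    (hG' : TwoConnected (reverse G)) (x : V) : Nontrivial {y // G.Adj x y} := by
  obtain ⟨c, hc, -⟩ := hV x x
  obtain ⟨u, -, hu⟩ := exists_adj_ne hV hG' hc.symm
  have hux : x ≠ u := by rintro rfl; exact hloop _ hu
  obtain ⟨w, hw, hw'⟩ := exists_adj_ne hV hG' hux
  exact ⟨⟨u, hu⟩, ⟨w, hw'⟩, fun h => hw (congrArg Subtype.val h).symm⟩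

theorem SplitGraph.nodeSum_transpose (K : V → V → ℤ) (v : V ⊕ V) :
    nodeSum (fun a b => K b a) v = nodeSum K v.swap := by
  rcases v with x | x <;> rfl

theorem SplitGraph.IsFlow.transpose {K : V → V → ℤ} (h : IsFlow (reverse G) K) :
    IsFlow G (fun a b => K b a) := by
  refine ⟨?_, fun a b hab => ?_, fun a b hab => h.nonneg b a hab.symm⟩
  · ext v
    rw [nodeSum_transpose, h.closed]
    rfl
  · exact (h.inc b a hab).imp id Eq.symm

/-- Transposing a flow exchanges outgoing and incoming; results about f thus transfer to g on the
reversed graph. -/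
theorem SplitGraph.FlowEquation.symm {F F' : V → (V → ℕ) → ℝ} (h : FlowEquation G F F') :
    FlowEquation (reverse G) F' F :=
  fun _ hK => (h _ hK.transpose).symm

open Classical in
theorem IsMomentFamily.exists_isUrn {f : V → (V → ℕ) → ℝ} {F' : V → (V → ℕ) → ℝ}
    (hV : HasThree V) (hloop : ∀ x, ¬ G.Adj x x) (hG : TwoConnected G)
    (hG' : TwoConnected (reverse G)) (hf : IsMomentFamily G f)
    (hF : FlowEquation G (fun x m => Real.log (f x m)) F') (x : V) :
    ∃ b c, IsUrn (fun m => f x (extendOut G x m)) b c := by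
  have := nontrivial_out hV hloop hG' x
  have hp : ∀ m, 0 < f x (extendOut G x m) := fun m => hf.pos x _ (extendOut_supp x m)
  refine UrnMoments.exists_isUrn hp (by rw [extendOut_zero, hf.zero]) ?_ ?_ ?_
  · intro m
    simp only [extendOut_add, extendOut_single]
    exact hf.sum x _ (extendOut_supp x m)
  · intro m u y z huy huz hyz
    have key := mixed_difference_eq_zero hV hloop hG hF u.2 y.2 z.2
      (fun h => huy (Subtype.ext h)) (fun h => huz (Subtype.ext h))
      (fun h => hyz (Subtype.ext h)) _ (extendOut_supp x m)
    simp only [← extendOut_single, ← extendOut_add] at key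
    rw [log_second_difference (hp _) (hp _) (hp _) (hp _)] at key
    have h1 := Real.eq_one_of_pos_of_log_eq_zero
      (div_pos (mul_pos (hp _) (hp _)) (mul_pos (hp _) (hp _))) key
    rwa [div_eq_one_iff_eq (mul_pos (hp _) (hp _)).ne'] at h1
  · intro m y z hyz
    have key := third_difference_eq hV hloop hG hF y.2 z.2
      (fun h => hyz (Subtype.ext h)) _ (extendOut_supp x m)
    simp only [← extendOut_single, ← extendOut_add] at key
    rw [log_second_difference (hp _) (hp _) (hp _) (hp _),
      log_second_difference (hp _) (hp _) (hp _) (hp _)] at key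
    have h1 := Real.log_injOn_pos (Set.mem_Ioi.2 (div_pos (mul_pos (hp _) (hp _))
      (mul_pos (hp _) (hp _)))) (Set.mem_Ioi.2 (div_pos (mul_pos (hp _) (hp _))
      (mul_pos (hp _) (hp _)))) key
    rw [div_eq_div_iff (mul_pos (hp _) (hp _)).ne' (mul_pos (hp _) (hp _)).ne'] at h1
    simp only [ratio]
    have c1 := add_right_comm m (Pi.single z 1) (Pi.single y 1)
    have c2 := add_right_comm m (Pi.single y 1) (Pi.single z 1)
    have c3 : m + Pi.single y 1 + Pi.single z 1 + Pi.single y 1 =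
      m + Pi.single y 1 + Pi.single y 1 + Pi.single z 1 := add_right_comm _ _ _
    rw [c1] at h1
    rw [c3]
    rw [div_mul_div_comm, div_mul_div_comm, div_eq_div_iff (mul_pos (hp _) (hp _)).ne'
      (mul_pos (hp _) (hp _)).ne']
    rw [c1]
    linear_combination h1

theorem edge_ratio_extendOut {x : V} [Fintype {y // G.Adj x y}] {f : (V → ℕ) → ℝ} {b : V → ℝ}
    {c : ℝ} (h : IsUrn (fun m => f (extendOut G x m)) (fun i => b i.1) c) {m k : V → ℕ}
    (hm : ∀ y, m y ≠ 0 → G.Adj x y) (hk : ∀ y, k y ≠ 0 → G.Adj x y) {i y : V}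
    (hi : G.Adj x i) (hy : G.Adj x y) (hiy : i ≠ y) (hki : k i = 0) (hky : k y = 0) :
    f (m + k + Pi.single i 1) * f (m + Pi.single y 1 + Pi.single y 1) * (b y + c * m y) =
      f (m + Pi.single y 1 + Pi.single i 1) * f (m + k + Pi.single y 1) *
        (b y + c * (m y + 1)) := by
  have := h.edge_ratio (fun i => m i.1) (fun i => k i.1) (i := ⟨i, hi⟩) (y := ⟨y, hy⟩)
    (by simpa using hiy) hki hky
  simpa only [extendOut_add, extendOut_single, extendOut_restrict x m hm,
    extendOut_restrict x k hk] using this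

theorem sum_restrict {x : V} [Fintype {y // G.Adj x y}] {m : V → ℕ}
    (hm : ∀ y, m y ≠ 0 → G.Adj x y) :
    ∑ i : {y // G.Adj x y}, (m i.1 : ℝ) = ∑ y, (m y : ℝ) := by
  classical
  rw [← Finset.sum_subtype (Finset.univ.filter (G.Adj x)) (by simp) (fun y => (m y : ℝ))]
  refine Finset.sum_subset (Finset.subset_univ _) fun y _ hy => ?_
  have : m y = 0 := by by_contra h0; exact hy (by simpa using hm y h0)
  simp [this]

theorem vertex_ratio_extendOut {x : V} [Fintype {y // G.Adj x y}] {f : (V → ℕ) → ℝ} {b : V → ℝ}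
    {c : ℝ} (h : IsUrn (fun m => f (extendOut G x m)) (fun i => b i.1) c) {m : V → ℕ}
    (hm : ∀ y, m y ≠ 0 → G.Adj x y) {y z : V}
    (hy : G.Adj x y) (hz : G.Adj x z) (hyz : y ≠ z) :
    f (m + Pi.single y 1 + Pi.single z 1) * f m *
        (∑ j : {y // G.Adj x y}, b j.1 + c * (∑ j, (m j : ℝ) + 1)) =
      f (m + Pi.single y 1) * f (m + Pi.single z 1) *
        (∑ j : {y // G.Adj x y}, b j.1 + c * ∑ j, (m j : ℝ)) := by
  have := h.vertex_ratio (fun i => m i.1) (y := ⟨y, hy⟩) (z := ⟨z, hz⟩) (by simpa using hyz)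
  simpa only [extendOut_add, extendOut_single, extendOut_restrict x m hm, sum_restrict hm]
    using this

theorem supp_add_single {x y : V} {m : V → ℕ} (hm : ∀ y, m y ≠ 0 → G.Adj x y) (hy : G.Adj x y) :
    ∀ z, (m + Pi.single y 1 : V → ℕ) z ≠ 0 → G.Adj x z := by
  intro z hz
  by_cases h : z = y
  · exact h ▸ hy
  · exact hm z (by simpa [h] using hz)

/-- The reinforcements at the two ends of an edge are proportional to the initial weights of that
edge. -/
theorem edge_relation {f g : V → (V → ℕ) → ℝ} [∀ x, Fintype {y // G.Adj x y}]
    [∀ x, Fintype {y // (reverse G).Adj x y}]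
    (hV : HasThree V) (hloop : ∀ x, ¬ G.Adj x x) (hG : TwoConnected G)
    (hG' : TwoConnected (reverse G)) (hf : IsMomentFamily G f)
    (hg : IsMomentFamily (reverse G) g)
    (hF : FlowEquation G (fun x m => Real.log (f x m)) (fun x m => Real.log (g x m)))
    {b b' : V → V → ℝ} {c c' : V → ℝ}
    (hb : ∀ x, IsUrn (fun m => f x (extendOut G x m)) (fun i => b x i.1) (c x))
    (hb' : ∀ x, IsUrn (fun m => g x (extendOut (reverse G) x m))
      (fun i => b' x i.1) (c' x)) {x y : V} (hxy : G.Adj x y) :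
    c x * b' y x = c' y * b x y := by
  obtain ⟨z, hzy, hz⟩ := exists_adj_ne hV hG' (show x ≠ y by rintro rfl; exact hloop _ hxy)
  obtain ⟨m, m', h, i, hm, hm', hh, hmm', hix, hiy, hhx, hhi, key⟩ :=
    edge_difference_eq hV hloop hG hF hxy hz hzy.symm
  have e1 := edge_ratio_extendOut (hb x) (k := 0) hm (by simp) hz hxy hzy rfl rfl
  have e2 := edge_ratio_extendOut (G := reverse G) (hb' y) hm' hh hiy hxy hix hhi hhx
  rw [add_zero] at e1
  have hxy' : (reverse G).Adj y x := hxy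
  have hiy' : (reverse G).Adj y i := hiy
  have hz' : G.Adj x z := hz
  have hmh : ∀ a, (m' + h) a ≠ 0 → (reverse G).Adj y a := by
    intro a ha
    by_cases h0 : m' a = 0
    · exact hh a (by simpa [h0] using ha)
    · exact hm' a h0
  have p1 := hf.pos x _ (supp_add_single hm hz')
  have p2 := hf.pos x _ (supp_add_single (supp_add_single hm hxy) hz')
  have p3 := hf.pos x _ (supp_add_single hm hxy)
  have p4 := hf.pos x _ (supp_add_single (supp_add_single hm hxy) hxy)
  have q1 := hg.pos y _ (supp_add_single hmh hiy')
  have q2 := hg.pos y _ (supp_add_single (supp_add_single (G := reverse G) hm' hxy') hiy')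
  have q3 := hg.pos y _ (supp_add_single hmh hxy')
  have q4 := hg.pos y _ (supp_add_single (supp_add_single (G := reverse G) hm' hxy') hxy')
  rw [log_second_difference p1 p2 p3 p4, log_second_difference q1 q2 q3 q4] at key
  have h1 := Real.log_injOn_pos (Set.mem_Ioi.2 (div_pos (mul_pos p1 p4) (mul_pos p2 p3)))
    (Set.mem_Ioi.2 (div_pos (mul_pos q1 q4) (mul_pos q2 q3))) key
  have w1 : 0 < b x y + c x * m y :=
    add_pos_of_pos_of_nonneg ((hb x).pos ⟨y, hxy⟩) (mul_nonneg (hb x).nonneg (Nat.cast_nonneg _))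
  have w2 : 0 < b' y x + c' y * m' x :=
    add_pos_of_pos_of_nonneg ((hb' y).pos ⟨x, hxy'⟩)
      (mul_nonneg (hb' y).nonneg (Nat.cast_nonneg _))
  have e1' := (div_eq_div_iff (mul_pos p2 p3).ne' w1.ne').2 (e1.trans (mul_comm _ _))
  have e2' := (div_eq_div_iff (mul_pos q2 q3).ne' w2.ne').2 (e2.trans (mul_comm _ _))
  have h2 := e1'.symm.trans (h1.trans e2')
  -- Since m y = m' x, the terms in the product of the two reinforcements cancel and the base flow
  -- drops out.
  rw [div_eq_div_iff w1.ne' w2.ne', hmm'] at h2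
  linarith

/-- The reinforcements on the two sides of a vertex are proportional to the total initial
weights. -/
theorem vertex_relation {f g : V → (V → ℕ) → ℝ} [∀ x, Fintype {y // G.Adj x y}]
    [∀ x, Fintype {y // (reverse G).Adj x y}]
    (hV : HasThree V) (hloop : ∀ x, ¬ G.Adj x x) (hG : TwoConnected G)
    (hG' : TwoConnected (reverse G)) (hf : IsMomentFamily G f)
    (hg : IsMomentFamily (reverse G) g)
    (hF : FlowEquation G (fun x m => Real.log (f x m)) (fun x m => Real.log (g x m)))
    {b b' : V → V → ℝ} {c c' : V → ℝ}
    (hb : ∀ x, IsUrn (fun m => f x (extendOut G x m)) (fun i => b x i.1) (c x))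
    (hb' : ∀ x, IsUrn (fun m => g x (extendOut (reverse G) x m))
      (fun i => b' x i.1) (c' x)) (x : V) :
    c x * ∑ j : {y // (reverse G).Adj x y}, b' x j.1
      = c' x * ∑ j : {y // G.Adj x y}, b x j.1 := by
  obtain ⟨⟨y, hy⟩, ⟨z, hz⟩, hyz⟩ := (nontrivial_out hV hloop hG' x).exists_pair_ne
  have hyz : y ≠ z := by simpa using hyz
  obtain ⟨m, m', i, i', hm, hm', hmm', hii', hi, hi', key⟩ :=
    vertex_difference_eq hV hloop hG hF hy hz hyz
  have hi : (reverse G).Adj x i := hi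
  have hi' : (reverse G).Adj x i' := hi'
  have e1 := vertex_ratio_extendOut (hb x) hm hy hz hyz
  have e2 := vertex_ratio_extendOut (G := reverse G) (hb' x) hm' hi hi' hii'
  have p1 := hf.pos x _ (supp_add_single (supp_add_single hm hy) hz)
  have p2 := hf.pos x _ (supp_add_single hm hy)
  have p3 := hf.pos x _ (supp_add_single hm hz)
  have p4 := hf.pos x _ hm
  have q1 := hg.pos x _ (supp_add_single (supp_add_single (G := reverse G) hm' hi) hi')
  have q2 := hg.pos x _ (supp_add_single (G := reverse G) hm' hi)
  have q3 := hg.pos x _ (supp_add_single (G := reverse G) hm' hi')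
  have q4 := hg.pos x _ hm'
  rw [log_second_difference p1 p2 p3 p4, log_second_difference q1 q2 q3 q4] at key
  have h1 := Real.log_injOn_pos (Set.mem_Ioi.2 (div_pos (mul_pos p1 p4) (mul_pos p2 p3)))
    (Set.mem_Ioi.2 (div_pos (mul_pos q1 q4) (mul_pos q2 q3))) key
  have hs : ∑ j, (m j : ℝ) = ∑ j, (m' j : ℝ) := by exact_mod_cast hmm'
  rw [← hs] at e2
  have hN : 0 ≤ ∑ j, (m j : ℝ) := Finset.sum_nonneg fun _ _ => Nat.cast_nonneg _
  have w1 : 0 < ∑ j : {y // G.Adj x y}, b x j.1 :=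
    Finset.sum_pos (fun j _ => (hb x).pos j) ⟨⟨y, hy⟩, Finset.mem_univ _⟩
  have w2 : 0 < ∑ j : {y // (reverse G).Adj x y}, b' x j.1 :=
    Finset.sum_pos (fun j _ => (hb' x).pos j) ⟨⟨i, hi⟩, Finset.mem_univ _⟩
  have c1 := (hb x).nonneg
  have c2 := (hb' x).nonneg
  have w1' : 0 < ∑ j : {y // G.Adj x y}, b x j.1 + c x * (∑ j, (m j : ℝ) + 1) := by positivity
  have w2' : 0 < ∑ j : {y // (reverse G).Adj x y}, b' x j.1 + c' x * (∑ j, (m j : ℝ) + 1) := by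
    positivity
  have e1' := (div_eq_div_iff (mul_pos p2 p3).ne' w1'.ne').2 (e1.trans (mul_comm _ _))
  have e2' := (div_eq_div_iff (mul_pos q2 q3).ne' w2'.ne').2 (e2.trans (mul_comm _ _))
  have h2 := e1'.symm.trans (h1.trans e2')
  rw [div_eq_div_iff w1'.ne' w2'.ne'] at h2
  linarith

open Classical in
/-- The solutions of the flow equation among the moment families: either no reinforcement at all, or
reinforced urns whose initial weights are of null divergence. -/
theorem IsMomentFamily.isUrn_or {f g : V → (V → ℕ) → ℝ}
    (hV : HasThree V) (hloop : ∀ x, ¬ G.Adj x x) (hG : TwoConnected G)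
    (hG' : TwoConnected (reverse G)) (hf : IsMomentFamily G f)
    (hg : IsMomentFamily (reverse G) g)
    (hF : FlowEquation G (fun x m => Real.log (f x m)) (fun x m => Real.log (g x m))) :
    (∀ x, ∃ b, IsUrn (fun m => f x (extendOut G x m)) b 0) ∨
    ∃ α : V → V → ℝ, NullDivergence G α ∧
      ∀ x, IsUrn (fun m => f x (extendOut G x m)) (fun i => α x i.1) 1 := by
  have key : ∀ {G : Digraph V} {h : (V → ℕ) → ℝ} {x : V} {b : {y // G.Adj x y} → ℝ} {c : ℝ},
      IsUrn (fun m => h (extendOut G x m)) b c →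
        ∃ b' : V → ℝ, IsUrn (fun m => h (extendOut G x m)) (fun i => b' i.1) c := by
    intro G h x b c hb
    refine ⟨fun y => if hy : G.Adj x y then b ⟨y, hy⟩ else 0, ?_⟩
    convert hb using 2 with i
    simp [i.2]
  have h1 : ∀ x, ∃ (b : V → ℝ) (c : ℝ),
      IsUrn (fun m => f x (extendOut G x m)) (fun i => b i.1) c := by
    intro x
    obtain ⟨b, c, hb⟩ := hf.exists_isUrn hV hloop hG hG' hF x
    obtain ⟨b', hb'⟩ := key hb
    exact ⟨b', c, hb'⟩
  have h2 : ∀ x, ∃ (b : V → ℝ) (c : ℝ),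
      IsUrn (fun m => g x (extendOut (reverse G) x m)) (fun i => b i.1) c := by
    intro x
    obtain ⟨b, c, hb⟩ := hg.exists_isUrn hV hloop (G := reverse G) hG' hG hF.symm x
    obtain ⟨b', hb'⟩ := key (G := reverse G) hb
    exact ⟨b', c, hb'⟩
  choose b c hb using h1
  choose b' c' hb' using h2
  have hE := fun {x y : V} (hxy : G.Adj x y) => edge_relation hV hloop hG hG' hf hg hF hb hb' hxy
  have hX := vertex_relation hV hloop hG hG' hf hg hF hb hb'
  have hBpos : ∀ x, 0 < ∑ j : {y // G.Adj x y}, b x j.1 := fun x =>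
    have := nontrivial_out hV hloop hG' x
    Finset.sum_pos (fun j _ => (hb x).pos j) Finset.univ_nonempty
  have hBpos' : ∀ x, 0 < ∑ j : {y // (reverse G).Adj x y}, b' x j.1 := fun x =>
    have := nontrivial_out (G := reverse G) hV hloop hG x
    Finset.sum_pos (fun j _ => (hb' x).pos j) Finset.univ_nonempty
  have hcc' : ∀ x, c x = 0 ↔ c' x = 0 := by
    intro x
    have := hX x
    constructor
    · intro h
      rw [h, zero_mul] at this
      exact (mul_eq_zero.1 this.symm).resolve_right (hBpos x).ne'
    · intro h
      rw [h, zero_mul] at this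
      exact (mul_eq_zero.1 this).resolve_right (hBpos' x).ne'
  -- Zero reinforcement passes from c x to c' y across the edge, then from c' y to c y across the
  -- vertex.
  have hadj : ∀ x y, G.Adj x y → c x = 0 → c y = 0 := by
    intro x y hxy hx
    have := hE hxy
    rw [hx, zero_mul] at this
    exact (hcc' y).2 ((mul_eq_zero.1 this.symm).resolve_right ((hb x).pos ⟨y, hxy⟩).ne')
  have hpath : ∀ x y, c x = 0 → c y = 0 := by
    intro x y hx
    have := hG.1 x y
    induction this with
    | refl => exact hx
    | tail _ h ih => exact hadj _ _ h ih
  by_cases h0 : ∀ x, c x = 0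
  · exact Or.inl fun x => ⟨_, h0 x ▸ hb x⟩
  · push Not at h0
    obtain ⟨x0, hx0⟩ := h0
    have hc : ∀ x, c x ≠ 0 := fun x hx => hx0 (hpath x x0 hx)
    have hc' : ∀ x, c' x ≠ 0 := fun x hx => hc x ((hcc' x).2 hx)
    refine Or.inr ⟨fun x y => b x y / c x, fun x => ?_, fun x => (hb x).div (hc x)⟩
    have e1 : ∑ y with G.Adj x y, b x y / c x = (∑ j : {y // G.Adj x y}, b x j.1) / c x := by
      rw [Finset.sum_div]
      exact Finset.sum_subtype _ (by simp) (fun y => b x y / c x)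
    -- On an edge (y, x) the edge relation reads b y x / c y = b' x y / c' x, so the incoming sum is
    -- a total weight of the reversed urn at x, and the vertex relation concludes.
    have e2 : ∑ y with G.Adj y x, b y x / c y =
        (∑ j : {y // (reverse G).Adj x y}, b' x j.1) / c' x := by
      rw [Finset.sum_div, ← Finset.sum_subtype (Finset.univ.filter fun y => G.Adj y x)
        (by simp [reverse]) (fun y => b' x y / c' x)]
      refine Finset.sum_congr rfl fun y hy => ?_
      have := hE (Finset.mem_filter.1 hy).2
      rw [div_eq_div_iff (hc y) (hc' x)]
      linarith
    rw [e1, e2, div_eq_div_iff (hc x) (hc' x)]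
    linarith [hX x]

end

theorem measurableSet_cube (ι : Type*) [Fintype ι] :
    MeasurableSet {x : ι → ℝ | ∀ i, x i ∈ Set.Icc (0 : ℝ) 1} := by
  have : {x : ι → ℝ | ∀ i, x i ∈ Set.Icc (0 : ℝ) 1} = Set.univ.pi fun _ => Set.Icc 0 1 := by
    ext x
    simp only [Set.mem_ofPred_eq, Set.mem_univ_pi]
  rw [this]
  exact MeasurableSet.univ_pi fun _ => measurableSet_Icc

/-! ### Moments of the Dirichlet distribution -/

namespace Dirichlet

/-- The power function `t ^ (a - 1)`, restricted to the positive half-line. -/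
noncomputable def kern (a t : ℝ) : ℝ := if 0 < t then t ^ (a - 1) else 0

theorem kern_nonneg (a t : ℝ) : 0 ≤ kern a t := by
  unfold kern
  split_ifs with h
  · exact Real.rpow_nonneg h.le _
  · exact le_rfl

theorem measurable_kern (a : ℝ) : Measurable (kern a) :=
  Measurable.ite measurableSet_Ioi (measurable_id.pow_const _) measurable_const

theorem kern_exp_eq (a : ℝ) : (fun t => kern a t * Real.exp (-t)) =
    (Set.Ioi 0).indicator fun t => Real.exp (-t) * t ^ (a - 1) := by
  ext t
  unfold kern
  by_cases h : 0 < t <;> simp [h, mul_comm]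

theorem integrable_kern_exp {a : ℝ} (ha : 0 < a) :
    Integrable fun t => kern a t * Real.exp (-t) := by
  rw [kern_exp_eq, integrable_indicator_iff measurableSet_Ioi]
  exact Real.GammaIntegral_convergent ha

theorem integral_kern_exp {a : ℝ} (ha : 0 < a) :
    ∫ t, kern a t * Real.exp (-t) = Real.Gamma a := by
  rw [kern_exp_eq, integral_indicator measurableSet_Ioi, Real.Gamma_eq_integral ha]

theorem lintegral_kern_exp {a : ℝ} (ha : 0 < a) :
    ∫⁻ t, ENNReal.ofReal (kern a t * Real.exp (-t)) = ENNReal.ofReal (Real.Gamma a) := by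
  rw [← integral_kern_exp ha, ofReal_integral_eq_lintegral_ofReal (integrable_kern_exp ha)]
  exact Filter.Eventually.of_forall fun t => mul_nonneg (kern_nonneg _ _) (Real.exp_pos _).le

theorem lintegral_prod_kern_exp {J : Type*} [Fintype J] {a : J → ℝ} (ha : ∀ j, 0 < a j) :
    ∫⁻ z : J → ℝ, ∏ j, ENNReal.ofReal (kern (a j) (z j) * Real.exp (-z j)) =
      ∏ j, ENNReal.ofReal (Real.Gamma (a j)) := by
  have hnn : ∀ z : J → ℝ, ∀ j, 0 ≤ kern (a j) (z j) * Real.exp (-z j) :=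
    fun z j => mul_nonneg (kern_nonneg _ _) (Real.exp_pos _).le
  rw [← ENNReal.ofReal_prod_of_nonneg fun j _ => (Real.Gamma_pos_of_pos (ha j)).le,
    ← Finset.prod_congr rfl fun j _ => integral_kern_exp (ha j),
    ← integral_fintype_prod_volume_eq_prod (fun j t => kern (a j) t * Real.exp (-t)),
    ofReal_integral_eq_lintegral_ofReal]
  · exact lintegral_congr fun z => (ENNReal.ofReal_prod_of_nonneg fun j _ => hnn z j).symm
  · exact Integrable.fintype_prod fun j => integrable_kern_exp (ha j)
  · exact Filter.Eventually.of_forall fun z => Finset.prod_nonneg fun j _ => hnn z j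

theorem kern_mul {a s t : ℝ} (hs : 0 < s) : kern a (s * t) = s ^ (a - 1) * kern a t := by
  unfold kern
  by_cases h : 0 < t
  · rw [if_pos h, if_pos (mul_pos hs h), Real.mul_rpow hs.le h.le]
  · rw [if_neg h, if_neg (fun h' => h (pos_of_mul_pos_right h' hs.le)), mul_zero]

section

variable {ι : Type*} [Fintype ι] [DecidableEq ι] (a : ι → ℝ) (i₀ : ι)

/-- The unnormalised Dirichlet density on the simplex of size `s`. -/
noncomputable def weight (s : ℝ) (z : {i // i ≠ i₀} → ℝ) : ENNReal :=
  (∏ j : {i // i ≠ i₀}, ENNReal.ofReal (kern (a j) (z j))) *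
    ENNReal.ofReal (kern (a i₀) (s - ∑ j, z j))

theorem measurable_weight {α : Type*} [MeasurableSpace α] {f : α → ℝ}
    {g : α → {i // i ≠ i₀} → ℝ} (hf : Measurable f) (hg : Measurable g) :
    Measurable fun p => weight a i₀ (f p) (g p) := by
  have hgj : ∀ j, Measurable fun p => g p j := fun j => (measurable_pi_apply j).comp hg
  unfold weight
  refine Measurable.mul (Finset.measurable_fun_prod _ fun j _ => ?_) ?_
  · exact ((measurable_kern _).comp (hgj j)).ennreal_ofReal
  · exact ((measurable_kern _).comp
      (hf.sub (Finset.measurable_fun_sum _ fun j _ => hgj j))).ennreal_ofReal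

theorem measurable_weight_apply (s : ℝ) : Measurable (weight a i₀ s) :=
  measurable_weight a i₀ measurable_const measurable_id

theorem weight_eq_zero {s : ℝ} (hs : s ≤ 0) (z : {i // i ≠ i₀} → ℝ) : weight a i₀ s z = 0 := by
  by_cases h : ∀ j, 0 < z j
  · have : 0 ≤ ∑ j, z j := Finset.sum_nonneg fun j _ => (h j).le
    have h1 : kern (a i₀) (s - ∑ j, z j) = 0 := if_neg (by linarith)
    simp [weight, h1]
  · push Not at h
    obtain ⟨j, hj⟩ := h
    have h1 : kern (a j) (z j) = 0 := if_neg (not_lt.2 hj)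
    unfold weight
    rw [Finset.prod_eq_zero (Finset.mem_univ j) (by rw [h1, ENNReal.ofReal_zero]), zero_mul]

theorem weight_smul {s : ℝ} (hs : 0 < s) (z : {i // i ≠ i₀} → ℝ) :
    weight a i₀ s (s • z) =
      ENNReal.ofReal (s ^ (∑ i, (a i - 1))) * weight a i₀ 1 z := by
  have h1 : s - ∑ j, (s • z) j = s * (1 - ∑ j, z j) := by
    simp [mul_sub, Finset.mul_sum]
  unfold weight
  rw [h1, kern_mul hs]
  simp only [Pi.smul_apply, smul_eq_mul, kern_mul hs]
  rw [ENNReal.ofReal_mul (Real.rpow_nonneg hs.le _)]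
  simp only [ENNReal.ofReal_mul (Real.rpow_nonneg hs.le _)]
  rw [Finset.prod_mul_distrib, Real.rpow_sum_of_pos hs,
    Fintype.prod_eq_mul_prod_subtype_ne (fun i => s ^ (a i - 1)) i₀,
    ENNReal.ofReal_mul (Real.rpow_nonneg hs.le _),
    ENNReal.ofReal_prod_of_nonneg fun j _ => Real.rpow_nonneg hs.le _]
  ring

/-- The substitution z ↦ s z uses the homogeneity of the weight; the Jacobian s^(n-1), with n the
number of coordinates, completes the exponent to ∑ a - 1. -/
theorem lintegral_weight {s : ℝ} :
    ∫⁻ z : {i // i ≠ i₀} → ℝ, weight a i₀ s z =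
      ENNReal.ofReal (kern (∑ i, a i) s) * ∫⁻ z : {i // i ≠ i₀} → ℝ, weight a i₀ 1 z := by
  by_cases hs : 0 < s
  swap
  · simp [weight_eq_zero a i₀ (not_lt.1 hs), kern, hs]
  have hm := measurable_weight_apply a i₀ s
  have hm1 := measurable_weight_apply a i₀ 1
  have h1 : ∫⁻ z : {i // i ≠ i₀} → ℝ, weight a i₀ s (s • z) =
      ENNReal.ofReal |(s ^ Module.finrank ℝ ({i // i ≠ i₀} → ℝ))⁻¹| *
        ∫⁻ z : {i // i ≠ i₀} → ℝ, weight a i₀ s z := by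
    rw [← lintegral_map hm (measurable_const_smul s), Measure.map_addHaar_smul volume hs.ne',
      lintegral_smul_measure, smul_eq_mul]
  simp only [weight_smul a i₀ hs] at h1
  rw [lintegral_const_mul _ hm1] at h1
  have hcard : Module.finrank ℝ ({i // i ≠ i₀} → ℝ) = Fintype.card ι - 1 := by
    rw [Module.finrank_fintype_fun_eq_card]
    simp
  have hpos : 0 < Fintype.card ι := Fintype.card_pos_iff.2 ⟨i₀⟩
  have h2 : s ^ (∑ i, a i - 1) = s ^ (Fintype.card ι - 1) * s ^ (∑ i, (a i - 1)) := by
    rw [← Real.rpow_natCast, ← Real.rpow_add hs, Nat.cast_sub hpos]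
    congr 1
    simp [Finset.sum_sub_distrib]
  rw [kern, if_pos hs, h2, ENNReal.ofReal_mul (by positivity), mul_assoc, h1, hcard, abs_of_pos
    (by positivity), ← mul_assoc, ← ENNReal.ofReal_mul (by positivity),
    mul_inv_cancel₀ (by positivity), ENNReal.ofReal_one, one_mul]

/-- The Dirichlet integral. -/
theorem gamma_mul_lintegral_weight (ha : ∀ i, 0 < a i) :
    ENNReal.ofReal (Real.Gamma (∑ i, a i)) * ∫⁻ z : {i // i ≠ i₀} → ℝ, weight a i₀ 1 z =
      ENNReal.ofReal (∏ i, Real.Gamma (a i)) := by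
  have hsum : 0 < ∑ i, a i := Finset.sum_pos (fun i _ => ha i) ⟨i₀, Finset.mem_univ _⟩
  have hms := measurable_weight_apply a i₀
  have hmp : Measurable fun z : {i // i ≠ i₀} → ℝ =>
      ∏ j : {i // i ≠ i₀}, ENNReal.ofReal (kern (a j) (z j) * Real.exp (-z j)) :=
    Finset.measurable_fun_prod _ fun j _ =>
      (((measurable_kern _).comp (measurable_pi_apply j)).mul (by fun_prop)).ennreal_ofReal
  -- In the product of the Gamma integrals, the last variable is replaced by the total s of all
  -- variables. Integrating over z first then leaves the Gamma integral of ∑ a times the integral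
  -- over the unit simplex.
  have hshift : ∀ z : {i // i ≠ i₀} → ℝ,
      ENNReal.ofReal (Real.Gamma (a i₀)) =
        ∫⁻ s, ENNReal.ofReal (kern (a i₀) (s - ∑ j, z j) * Real.exp (-(s - ∑ j, z j))) := by
    intro z
    rw [← lintegral_kern_exp (ha i₀)]
    exact (lintegral_sub_right_eq_self
      (fun t => ENNReal.ofReal (kern (a i₀) t * Real.exp (-t))) (∑ j, z j)).symm
  have hpt : ∀ (z : {i // i ≠ i₀} → ℝ) (s : ℝ),
      (∏ j : {i // i ≠ i₀}, ENNReal.ofReal (kern (a j) (z j) * Real.exp (-z j))) *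
        ENNReal.ofReal (kern (a i₀) (s - ∑ j, z j) * Real.exp (-(s - ∑ j, z j))) =
      ENNReal.ofReal (Real.exp (-s)) * weight a i₀ s z := by
    intro z s
    simp only [ENNReal.ofReal_mul (kern_nonneg _ _), Finset.prod_mul_distrib, weight]
    have : ENNReal.ofReal (Real.exp (-s)) =
        (∏ j : {i // i ≠ i₀}, ENNReal.ofReal (Real.exp (-z j))) *
          ENNReal.ofReal (Real.exp (-(s - ∑ j, z j))) := by
      rw [← ENNReal.ofReal_prod_of_nonneg fun j _ => (Real.exp_pos _).le, ← Real.exp_sum,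
        ← ENNReal.ofReal_mul (Real.exp_pos _).le, ← Real.exp_add]
      congr 2
      simp only [Finset.sum_neg_distrib]
      ring
    rw [this]
    ring
  symm
  calc ENNReal.ofReal (∏ i, Real.Gamma (a i))
      = (∏ j : {i // i ≠ i₀}, ENNReal.ofReal (Real.Gamma (a j))) *
          ENNReal.ofReal (Real.Gamma (a i₀)) := by
        rw [Fintype.prod_eq_mul_prod_subtype_ne (fun i => Real.Gamma (a i)) i₀, mul_comm,
          ENNReal.ofReal_mul (Finset.prod_nonneg fun (j : {i // i ≠ i₀}) _ =>
            (Real.Gamma_pos_of_pos (ha j)).le),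
          ENNReal.ofReal_prod_of_nonneg fun (j : {i // i ≠ i₀}) _ =>
            (Real.Gamma_pos_of_pos (ha j)).le]
    _ = ∫⁻ z : {i // i ≠ i₀} → ℝ, ∫⁻ s, ENNReal.ofReal (Real.exp (-s)) * weight a i₀ s z := by
        rw [← lintegral_prod_kern_exp (a := fun j : {i // i ≠ i₀} => a j) (fun j => ha j),
          ← lintegral_mul_const _ hmp]
        refine lintegral_congr fun z => ?_
        rw [hshift z, ← lintegral_const_mul]
        · exact lintegral_congr fun s => hpt z s
        · exact (((measurable_kern _).comp (by fun_prop)).mul (by fun_prop)).ennreal_ofReal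
    _ = ∫⁻ s, ∫⁻ z : {i // i ≠ i₀} → ℝ, ENNReal.ofReal (Real.exp (-s)) * weight a i₀ s z := by
        refine lintegral_lintegral_swap (Measurable.aemeasurable ?_)
        exact Measurable.mul (by fun_prop) (measurable_weight a i₀ measurable_snd measurable_fst)
    _ = ∫⁻ s, ENNReal.ofReal (kern (∑ i, a i) s * Real.exp (-s)) *
          ∫⁻ z : {i // i ≠ i₀} → ℝ, weight a i₀ 1 z := by
        refine lintegral_congr fun s => ?_
        rw [lintegral_const_mul _ (hms s), lintegral_weight, ← mul_assoc,
          ← ENNReal.ofReal_mul (Real.exp_pos _).le, mul_comm (Real.exp _)]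
    _ = _ := by
        have hm : Measurable fun s =>
            ENNReal.ofReal (kern (∑ i, a i) s * Real.exp (-s)) :=
          ((measurable_kern _).mul (by fun_prop)).ennreal_ofReal
        rw [lintegral_mul_const _ hm, lintegral_kern_exp hsum]

theorem simplexPoint_self (z : {i // i ≠ i₀} → ℝ) : simplexPoint i₀ z i₀ = 1 - ∑ j, z j := by
  simp [simplexPoint]

theorem simplexPoint_coe (z : {i // i ≠ i₀} → ℝ) (j : {i // i ≠ i₀}) :
    simplexPoint i₀ z j = z j := by
  simp [simplexPoint, j.2]

theorem measurable_simplexPoint : Measurable (simplexPoint i₀) := by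
  refine measurable_pi_lambda _ fun i => ?_
  by_cases h : i = i₀
  · subst h
    simp only [simplexPoint_self]
    fun_prop
  · simp only [simplexPoint, h, dif_neg, not_false_eq_true]
    fun_prop

theorem weight_one_eq (z : {i // i ≠ i₀} → ℝ) :
    weight a i₀ 1 z = ∏ i, ENNReal.ofReal (kern (a i) (simplexPoint i₀ z i)) := by
  rw [Fintype.prod_eq_mul_prod_subtype_ne _ i₀, mul_comm, simplexPoint_self]
  simp only [simplexPoint_coe, weight]

theorem dirichletDensity_eq (ha : ∀ i, 0 < a i) (x : ι → ℝ) :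
    dirichletDensity a x = ENNReal.ofReal (Real.Gamma (∑ i, a i) / ∏ i, Real.Gamma (a i)) *
      ∏ i, ENNReal.ofReal (kern (a i) (x i)) := by
  unfold dirichletDensity
  have hprod : 0 ≤ ∏ i, Real.Gamma (a i) :=
    Finset.prod_nonneg fun i _ => (Real.Gamma_pos_of_pos (ha i)).le
  by_cases h : ∀ i, 0 < x i
  · have hG : 0 ≤ Real.Gamma (∑ i, a i) := by
      rcases isEmpty_or_nonempty ι with h | h
      · simp [Real.Gamma_zero]
      · exact (Real.Gamma_pos_of_pos
          (Finset.sum_pos (fun i _ => ha i) Finset.univ_nonempty)).le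
    rw [if_pos h, ENNReal.ofReal_mul (div_nonneg hG hprod),
      ENNReal.ofReal_prod_of_nonneg fun i _ => Real.rpow_nonneg (h i).le _]
    congr 1
    exact Finset.prod_congr rfl fun i _ => by rw [kern, if_pos (h i)]
  · rw [if_neg h]
    push Not at h
    obtain ⟨i, hi⟩ := h
    rw [Finset.prod_eq_zero (f := fun i => ENNReal.ofReal (kern (a i) (x i))) (Finset.mem_univ i)
      (by rw [kern, if_neg (not_lt.2 hi), ENNReal.ofReal_zero]), mul_zero]

theorem measurable_dirichletDensity (ha : ∀ i, 0 < a i) : Measurable (dirichletDensity a) := by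
  rw [funext (dirichletDensity_eq a ha)]
  refine Measurable.const_mul (Finset.measurable_fun_prod _ fun i _ => ?_) _
  exact ((measurable_kern _).comp (measurable_pi_apply i)).ennreal_ofReal

theorem lintegral_dirichletMeasure (ha : ∀ i, 0 < a i) {g : (ι → ℝ) → ENNReal}
    (hg : Measurable g) :
    ∫⁻ x, g x ∂(dirichletMeasure a i₀) =
      ∫⁻ z, dirichletDensity a (simplexPoint i₀ z) * g (simplexPoint i₀ z) := by
  unfold dirichletMeasure
  rw [lintegral_map hg (measurable_simplexPoint i₀), lintegral_withDensity_eq_lintegral_mul]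
  · rfl
  · exact (measurable_dirichletDensity a ha).comp (measurable_simplexPoint i₀)
  · exact hg.comp (measurable_simplexPoint i₀)

theorem ae_dirichletMeasure (ha : ∀ i, 0 < a i) :
    ∀ᵐ x ∂(dirichletMeasure a i₀), ∀ i, x i ∈ Set.Icc (0 : ℝ) 1 := by
  unfold dirichletMeasure
  rw [ae_map_iff (measurable_simplexPoint i₀).aemeasurable (measurableSet_cube ι),
    ae_withDensity_iff (f := fun z => dirichletDensity a (simplexPoint i₀ z))
      ((measurable_dirichletDensity a ha).comp (measurable_simplexPoint i₀))]
  refine Filter.Eventually.of_forall fun z hz i => ?_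
  have hpos : ∀ i, 0 < simplexPoint i₀ z i := by
    by_contra h
    exact hz (by rw [dirichletDensity, if_neg h])
  refine ⟨(hpos i).le, ?_⟩
  have hsum : ∑ i, simplexPoint i₀ z i = 1 := by
    rw [Fintype.sum_eq_add_sum_subtype_ne _ i₀, simplexPoint_self]
    simp [simplexPoint_coe]
  rw [← hsum]
  exact Finset.single_le_sum (f := fun i => simplexPoint i₀ z i) (fun i _ => (hpos i).le)
    (Finset.mem_univ i)

/-- The mixed moments of the Dirichlet distribution. -/
noncomputable def moment (m : ι → ℕ) : ℝ :=
  Real.Gamma (∑ i, a i) / (∏ i, Real.Gamma (a i)) *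
    ((∏ i, Real.Gamma (a i + m i)) / Real.Gamma (∑ i, (a i + m i)))

/-- A monomial times the Dirichlet weight is the weight with parameters a + m, so this is the
Dirichlet integral again. -/
theorem lintegral_moment (ha : ∀ i, 0 < a i) (m : ι → ℕ) :
    ∫⁻ x, (∏ i, ENNReal.ofReal (x i) ^ m i) ∂(dirichletMeasure a i₀) =
      ENNReal.ofReal (moment a m) := by
  have ham : ∀ i, 0 < a i + m i := fun i => add_pos_of_pos_of_nonneg (ha i) (Nat.cast_nonneg _)
  have hne : (Finset.univ : Finset ι).Nonempty := ⟨i₀, Finset.mem_univ _⟩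
  have hG := Real.Gamma_pos_of_pos (Finset.sum_pos (fun i _ => ha i) hne)
  have hG' := Real.Gamma_pos_of_pos (Finset.sum_pos (fun i _ => ham i) hne)
  have hP : 0 < ∏ i, Real.Gamma (a i) :=
    Finset.prod_pos fun i _ => Real.Gamma_pos_of_pos (ha i)
  rw [lintegral_dirichletMeasure a i₀ ha (by fun_prop)]
  have hpt : ∀ z, dirichletDensity a (simplexPoint i₀ z) *
      ∏ i, ENNReal.ofReal (simplexPoint i₀ z i) ^ m i =
      ENNReal.ofReal (Real.Gamma (∑ i, a i) / ∏ i, Real.Gamma (a i)) *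
        weight (fun i => a i + m i) i₀ 1 z := by
    intro z
    rw [dirichletDensity_eq a ha, weight_one_eq, mul_assoc, ← Finset.prod_mul_distrib]
    congr 1
    refine Finset.prod_congr rfl fun i _ => ?_
    unfold kern
    split_ifs with h
    · rw [← ENNReal.ofReal_pow h.le, ← ENNReal.ofReal_mul (Real.rpow_nonneg h.le _),
        ← Real.rpow_natCast, ← Real.rpow_add h]
      congr 2
      ring
    · simp
  rw [lintegral_congr hpt, lintegral_const_mul _
    (measurable_weight_apply (fun i => a i + m i) i₀ 1), moment,
    ENNReal.ofReal_mul (div_nonneg hG.le hP.le), ENNReal.ofReal_div_of_pos hG',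
    ← gamma_mul_lintegral_weight (fun i => a i + m i) i₀ ham,
    mul_comm (ENNReal.ofReal (Real.Gamma (∑ i, (a i + m i)))), ENNReal.mul_div_cancel_right]
  · exact (ENNReal.ofReal_pos.2 hG').ne'
  · exact ENNReal.ofReal_ne_top

theorem isUrn_moment [Nonempty ι] (ha : ∀ i, 0 < a i) : IsUrn (moment a) a 1 := by
  have hne : (Finset.univ : Finset ι).Nonempty := Finset.univ_nonempty
  have hG := Real.Gamma_pos_of_pos (Finset.sum_pos (fun i _ => ha i) hne)
  have hP : 0 < ∏ i, Real.Gamma (a i) :=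
    Finset.prod_pos fun i _ => Real.Gamma_pos_of_pos (ha i)
  refine ⟨?_, ha, zero_le_one, fun m i => ?_⟩
  · simp only [moment, Pi.zero_apply, Nat.cast_zero, add_zero]
    field_simp
  · have ham : ∀ i, 0 < a i + m i := fun i => add_pos_of_pos_of_nonneg (ha i) (Nat.cast_nonneg _)
    have hs : 0 < ∑ i, (a i + m i) := Finset.sum_pos (fun i _ => ham i) hne
    have e1 : ∑ j, (a j + ((m + Pi.single i 1 : ι → ℕ) j : ℝ)) = ∑ j, (a j + m j) + 1 := by
      simp [Finset.sum_add_distrib, Pi.single_apply, add_assoc]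
    have e2 : ∏ j, Real.Gamma (a j + ((m + Pi.single i 1 : ι → ℕ) j : ℝ)) =
        (a i + m i) * ∏ j, Real.Gamma (a j + m j) := by
      rw [← Finset.mul_prod_erase _ _ (Finset.mem_univ i),
        ← Finset.mul_prod_erase Finset.univ (fun j => Real.Gamma (a j + m j))
          (Finset.mem_univ i), ← mul_assoc, ← Real.Gamma_add_one (ham i).ne']
      congr 1
      · simp [add_assoc]
      · exact Finset.prod_congr rfl fun j hj => by simp [Finset.ne_of_mem_erase hj]
    have hG' := Real.Gamma_pos_of_pos hs
    rw [one_mul, one_mul, ← Finset.sum_add_distrib, moment, moment, e1, e2,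
      Real.Gamma_add_one hs.ne']
    field_simp

end

end Dirichlet

/-- The total weight is positive, so the recursion determines the moments by induction on the
degree. -/
theorem UrnMoments.IsUrn.unique {ι : Type*} [Fintype ι] [DecidableEq ι] [Nonempty ι]
    {f g : (ι → ℕ) → ℝ} {b : ι → ℝ} {c : ℝ} (hf : IsUrn f b c) (hg : IsUrn g b c) : f = g := by
  have key : ∀ (n : ℕ) (m : ι → ℕ), ∑ i, m i = n → f m = g m := by
    intro n
    induction n with
    | zero =>
      intro m hm
      have : m = 0 := by
        ext i
        exact (Finset.sum_eq_zero_iff.1 hm) i (Finset.mem_univ i)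
      rw [this, hf.zero, hg.zero]
    | succ n ih =>
      intro m hm
      obtain ⟨i, hi⟩ : ∃ i, m i ≠ 0 := by
        by_contra h
        push Not at h
        simp [h] at hm
      obtain ⟨k, rfl⟩ : ∃ k : ι → ℕ, m = k + Pi.single i 1 := by
        refine ⟨m - Pi.single i 1, ?_⟩
        ext j
        by_cases hj : j = i
        · subst hj; simp; omega
        · simp [hj]
      have hk : ∑ i, k i = n := by
        simpa [Finset.sum_add_distrib, Pi.single_apply] using hm
      apply mul_right_cancel₀ (hf.total_pos k).ne'
      rw [hf.step, hg.step, ih k hk]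
  exact funext fun m => key _ m rfl

/-! ### Laws on the cube are determined by their moments -/

section

variable {ι : Type*} [Fintype ι]

/-- The coordinate functions of the unit cube. -/
noncomputable def cubeCoord (i : ι) : BoundedContinuousFunction (ι → Set.Icc (0 : ℝ) 1) ℝ :=
  BoundedContinuousFunction.mkOfCompact ⟨fun x => (x i : ℝ), by fun_prop⟩

theorem cubeCoord_apply (i : ι) (x : ι → Set.Icc (0 : ℝ) 1) : cubeCoord i x = x i := rfl

/-- The polynomial functions on the unit cube. -/
noncomputable def cubePolynomials (ι : Type*) [Fintype ι] :
    StarSubalgebra ℝ (BoundedContinuousFunction (ι → Set.Icc (0 : ℝ) 1) ℝ) where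
  toSubalgebra := (MvPolynomial.aeval (R := ℝ) (cubeCoord (ι := ι))).range
  star_mem' := by
    intro f hf
    have : star f = f := by
      ext x
      simp
    rwa [this]

theorem integral_aeval_cubeCoord_eq {μ ν : Measure (ι → Set.Icc (0 : ℝ) 1)} [IsFiniteMeasure μ]
    [IsFiniteMeasure ν]
    (h : ∀ m : ι → ℕ, ∫ x, ∏ i, (x i : ℝ) ^ m i ∂μ = ∫ x, ∏ i, (x i : ℝ) ^ m i ∂ν)
    (p : MvPolynomial ι ℝ) :
    ∫ x, MvPolynomial.aeval (cubeCoord (ι := ι)) p x ∂μ =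
      ∫ x, MvPolynomial.aeval (cubeCoord (ι := ι)) p x ∂ν := by
  induction p using MvPolynomial.induction_on' with
  | monomial u a =>
    have : ∀ x, MvPolynomial.aeval (cubeCoord (ι := ι)) (MvPolynomial.monomial u a) x =
        a * ∏ i, (x i : ℝ) ^ u i := by
      intro x
      rw [MvPolynomial.aeval_monomial, Finsupp.prod_fintype _ _ (fun i => pow_zero _),
        BoundedContinuousFunction.mul_apply, BoundedContinuousFunction.coe_prod, Finset.prod_apply]
      simp [cubeCoord_apply]
    simp only [this, integral_const_mul, h]
  | add p q hp hq =>
    simp only [map_add, BoundedContinuousFunction.add_apply]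
    rw [integral_add (BoundedContinuousFunction.integrable _ _)
      (BoundedContinuousFunction.integrable _ _), integral_add
      (BoundedContinuousFunction.integrable _ _) (BoundedContinuousFunction.integrable _ _), hp, hq]

/-- Polynomials form a subalgebra that separates the points of the compact cube, so integrals
against them determine a finite measure. -/
theorem MeasureTheory.Measure.ext_of_cube_moments {μ ν : Measure (ι → Set.Icc (0 : ℝ) 1)}
    [IsFiniteMeasure μ] [IsFiniteMeasure ν]
    (h : ∀ m : ι → ℕ, ∫ x, ∏ i, (x i : ℝ) ^ m i ∂μ = ∫ x, ∏ i, (x i : ℝ) ^ m i ∂ν) : μ = ν := by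
  refine ext_of_forall_mem_subalgebra_integral_eq_of_polish (𝕜 := ℝ) (A := cubePolynomials ι) ?_ ?_
  · intro x y hxy
    obtain ⟨i, hi⟩ := Function.ne_iff.1 hxy
    refine ⟨cubeCoord i, ⟨_, ⟨cubeCoord i, ⟨MvPolynomial.X i, MvPolynomial.aeval_X _ _⟩, rfl⟩,
      rfl⟩, ?_⟩
    simpa [cubeCoord_apply, Subtype.ext_iff] using hi
  · rintro _ ⟨p, rfl⟩
    exact integral_aeval_cubeCoord_eq h p

/-- The coordinatewise projection onto the unit cube. -/
noncomputable def toCube (x : ι → ℝ) : ι → Set.Icc (0 : ℝ) 1 :=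
  fun i => Set.projIcc 0 1 zero_le_one (x i)

theorem measurable_toCube : Measurable (toCube (ι := ι)) :=
  measurable_pi_lambda _ fun i => continuous_projIcc.measurable.comp (measurable_pi_apply i)

theorem coe_toCube {x : ι → ℝ} (hx : ∀ i, x i ∈ Set.Icc (0 : ℝ) 1) (i : ι) :
    (toCube x i : ℝ) = x i := by
  rw [toCube, Set.projIcc_of_mem _ (hx i)]

theorem map_toCube_coe {μ : Measure (ι → ℝ)} (hμ : ∀ᵐ x ∂μ, ∀ i, x i ∈ Set.Icc (0 : ℝ) 1) :
    (μ.map toCube).map (fun x i => (x i : ℝ)) = μ := by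
  rw [Measure.map_map (by fun_prop) measurable_toCube]
  conv_rhs => rw [← Measure.map_id (μ := μ)]
  refine Measure.map_congr ?_
  filter_upwards [hμ] with x hx
  exact funext fun i => coe_toCube hx i

theorem integral_map_toCube {μ : Measure (ι → ℝ)} (hμ : ∀ᵐ x ∂μ, ∀ i, x i ∈ Set.Icc (0 : ℝ) 1)
    (m : ι → ℕ) :
    ∫ x, ∏ i, (x i : ℝ) ^ m i ∂(μ.map toCube) = ∫ x, ∏ i, x i ^ m i ∂μ := by
  rw [integral_map measurable_toCube.aemeasurable
    (Measurable.aestronglyMeasurable (by fun_prop))]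
  refine integral_congr_ae ?_
  filter_upwards [hμ] with x hx
  exact Finset.prod_congr rfl fun i _ => by rw [coe_toCube hx i]

/-- Finite measures on the unit cube with the same mixed moments are equal. -/
theorem MeasureTheory.Measure.ext_of_moments {μ ν : Measure (ι → ℝ)} [IsFiniteMeasure μ]
    [IsFiniteMeasure ν] (hμ : ∀ᵐ x ∂μ, ∀ i, x i ∈ Set.Icc (0 : ℝ) 1)
    (hν : ∀ᵐ x ∂ν, ∀ i, x i ∈ Set.Icc (0 : ℝ) 1)
    (h : ∀ m : ι → ℕ, ∫ x, ∏ i, x i ^ m i ∂μ = ∫ x, ∏ i, x i ^ m i ∂ν) : μ = ν := by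
  rw [← map_toCube_coe hμ, ← map_toCube_coe hν, Measure.ext_of_cube_moments
    (μ := μ.map toCube) (ν := ν.map toCube)
    fun m => by rw [integral_map_toCube hμ, integral_map_toCube hν, h]]

end

/-! ### Recognising a Dirichlet law by its moments -/

namespace Dirichlet

variable {ι : Type*} [Fintype ι] [DecidableEq ι] {a : ι → ℝ}

theorem isProbabilityMeasure_dirichletMeasure (i₀ : ι) (ha : ∀ i, 0 < a i) :
    IsProbabilityMeasure (dirichletMeasure a i₀) := by
  have : Nonempty ι := ⟨i₀⟩
  have h := lintegral_moment a i₀ ha 0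
  rw [(isUrn_moment a ha).zero] at h
  exact ⟨by simpa using h⟩

theorem integral_moment (i₀ : ι) (ha : ∀ i, 0 < a i) (m : ι → ℕ) :
    ∫ x, ∏ i, x i ^ m i ∂(dirichletMeasure a i₀) = moment a m := by
  have hcube := ae_dirichletMeasure a i₀ ha
  have hne : 0 ≤ moment a m := by
    have : Nonempty ι := ⟨i₀⟩
    unfold moment
    have h1 : ∀ i, 0 < a i + m i := fun i => add_pos_of_pos_of_nonneg (ha i) (Nat.cast_nonneg _)
    refine mul_nonneg (div_nonneg ?_ ?_) (div_nonneg ?_ ?_)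
    · exact (Real.Gamma_pos_of_pos (Finset.sum_pos (fun i _ => ha i) Finset.univ_nonempty)).le
    · exact Finset.prod_nonneg fun i _ => (Real.Gamma_pos_of_pos (ha i)).le
    · exact Finset.prod_nonneg fun i _ => (Real.Gamma_pos_of_pos (h1 i)).le
    · exact (Real.Gamma_pos_of_pos (Finset.sum_pos (fun i _ => h1 i) Finset.univ_nonempty)).le
  rw [integral_eq_lintegral_of_nonneg_ae, ← ENNReal.toReal_ofReal hne, ← lintegral_moment a i₀ ha]
  · congr 1
    refine lintegral_congr_ae ?_
    filter_upwards [hcube] with x hx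
    rw [ENNReal.ofReal_prod_of_nonneg fun i _ => pow_nonneg (hx i).1 _]
    exact Finset.prod_congr rfl fun i _ => ENNReal.ofReal_pow (hx i).1 _
  · filter_upwards [hcube] with x hx
    exact Finset.prod_nonneg fun i _ => pow_nonneg (hx i).1 _
  · exact Measurable.aestronglyMeasurable (by fun_prop)

/-- A random vector whose mixed moments are those of an urn of unit reinforcement has a Dirichlet
law. -/
theorem hasDirichletLaw_of_isUrn [Nonempty ι] {Ω : Type*} [MeasurableSpace Ω] {P : Measure Ω}
    [IsProbabilityMeasure P] {X : Ω → ι → ℝ} (hX : AEMeasurable X P)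
    (hcube : ∀ᵐ s ∂P, ∀ i, X s i ∈ Set.Icc (0 : ℝ) 1)
    (hurn : UrnMoments.IsUrn (fun m => ∫ s, ∏ i, X s i ^ m i ∂P) a 1) : HasDirichletLaw P X a := by
  refine ⟨inferInstance, hurn.pos, fun i₀ => ?_⟩
  have := isProbabilityMeasure_dirichletMeasure i₀ hurn.pos
  have := Measure.isProbabilityMeasure_map hX
  refine Measure.ext_of_moments ((ae_map_iff hX (measurableSet_cube ι)).2 hcube)
    (ae_dirichletMeasure a i₀ hurn.pos) fun m => ?_
  rw [integral_map hX (Measurable.aestronglyMeasurable (by fun_prop)),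
    integral_moment i₀ hurn.pos]
  exact congrFun (hurn.unique (isUrn_moment a hurn.pos)) m

end Dirichlet

/-! ### Random environments and their reversals -/

section

variable {V : Type*} [Fintype V] {G : Digraph V}

theorem RandomEnvironment.IsEnvironment.mem_Icc {w : V → V → ℝ} (h : IsEnvironment G w) (x y : V) :
    w x y ∈ Set.Icc (0 : ℝ) 1 := by
  refine ⟨h.nonneg x y, ?_⟩
  rw [← h.sum_eq_one x]
  exact Finset.single_le_sum (fun z _ => h.nonneg x z) (Finset.mem_univ y)

theorem RandomEnvironment.IsPositiveStationary.isEnvironment_reversed {w : V → V → ℝ} {p : V → ℝ}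
    (hw : IsEnvironment G w) (hp : IsPositiveStationary w p) :
    IsEnvironment (reverse G) (reversedEnvironment w p) := by
  refine ⟨fun x y => ?_, fun x y h => ?_, fun x => ?_⟩
  · exact mul_nonneg (hw.nonneg y x) (div_nonneg (hp.pos y).le (hp.pos x).le)
  · rw [reversedEnvironment, hw.eq_zero_of_not_adj y x h, zero_mul]
  · simp only [reversedEnvironment, ← mul_div_assoc]
    rw [← Finset.sum_div, ← hp.stationary x, div_self (hp.pos x).ne']

/-- `v` is the reversal of the random environment `w`, and the sites of both are independent. -/
structure IsReversiblePair {Ω : Type*} [MeasurableSpace Ω] (P : Measure Ω) (G : Digraph V)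
    (w v : Ω → V → V → ℝ) : Prop where
  measurable : Measurable w
  measurable' : Measurable v
  env : ∀ᵐ s ∂P, IsEnvironment G (w s)
  env' : ∀ᵐ s ∂P, IsEnvironment (reverse G) (v s)
  reversal : ∀ᵐ s ∂P, ∃ p : V → ℝ, (∀ x, 0 < p x) ∧ v s = reversedEnvironment (w s) p
  edge : ∀ x y, G.Adj x y → P {s | 0 < w s x y} ≠ 0
  indep : IndependentSites P w
  indep' : IndependentSites P v

/-- The mixed moments of the transition probabilities at `x`. -/
noncomputable def siteMoment {Ω : Type*} [MeasurableSpace Ω] (P : Measure Ω) (w : Ω → V → V → ℝ)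
    (x : V) (m : V → ℕ) : ℝ :=
  ∫ s, ∏ y, w s x y ^ m y ∂P

namespace IsReversiblePair

variable {Ω : Type*} [MeasurableSpace Ω] {P : Measure Ω} {w v : Ω → V → V → ℝ}

theorem measurable_apply (h : IsReversiblePair P G w v) (x y : V) : Measurable fun s => w s x y :=
  (measurable_pi_apply y).comp ((measurable_pi_apply x).comp h.measurable)

theorem pos_iff (h : IsReversiblePair P G w v) :
    ∀ᵐ s ∂P, ∀ x y, 0 < v s y x ↔ 0 < w s x y := by
  filter_upwards [h.reversal] with s ⟨p, hp, hv⟩ x y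
  rw [hv, reversedEnvironment, mul_pos_iff_of_pos_right (div_pos (hp x) (hp y))]

/-- Reversing twice with the same positive vector gives back the original; stationarity is not
recorded in the structure, which keeps it symmetric. -/
theorem symm (h : IsReversiblePair P G w v) : IsReversiblePair P (reverse G) v w := by
  refine ⟨h.measurable', h.measurable, h.env', h.env, ?_, fun x y hxy => ?_, h.indep', h.indep⟩
  · filter_upwards [h.reversal] with s ⟨p, hp, hv⟩
    refine ⟨p, hp, ?_⟩
    ext x y
    have := hp x
    have := hp y
    rw [hv]
    simp only [reversedEnvironment]
    field_simp
  · have : P {s | 0 < v s x y} = P {s | 0 < w s y x} := by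
      refine measure_congr ?_
      filter_upwards [h.pos_iff] with s hs
      exact propext (hs y x)
    rw [this]
    exact h.edge y x hxy

/-- Edges leaving one site are not independent under w, but w(x,y) > 0 is equivalent to v(y,x) > 0,
and the rows v(y,·) are independent for distinct y. The probability is therefore a product of
nonzero factors. -/
theorem measure_forall_pos_ne_zero [IsProbabilityMeasure P] (h : IsReversiblePair P G w v) (x : V) :
    P {s | ∀ y, G.Adj x y → 0 < w s x y} ≠ 0 := by
  have hms : ∀ y, MeasurableSet {r : V → ℝ | G.Adj x y → 0 < r x} := fun y => by
    by_cases hy : G.Adj x y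
    · simpa [hy] using measurableSet_lt measurable_const (measurable_pi_apply x)
    · simp [hy]
  have key := (iIndepFun_iff_measure_inter_preimage_eq_mul.1 h.indep') Finset.univ
    (sets := fun y => {r : V → ℝ | G.Adj x y → 0 < r x}) fun y _ => hms y
  have hset : P {s | ∀ y, G.Adj x y → 0 < w s x y} =
      P (⋂ y ∈ Finset.univ, (fun s => v s y) ⁻¹' {r : V → ℝ | G.Adj x y → 0 < r x}) := by
    refine measure_congr ?_
    filter_upwards [h.pos_iff] with s hs
    refine propext ?_
    change (∀ y, G.Adj x y → 0 < w s x y) ↔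
      s ∈ ⋂ y ∈ Finset.univ, (fun s => v s y) ⁻¹' {r : V → ℝ | G.Adj x y → 0 < r x}
    simp [hs]
  rw [hset, key, Finset.prod_ne_zero_iff]
  intro y _
  by_cases hy : G.Adj x y
  · have := h.symm.edge y x hy
    simpa [hy] using this
  · simp [hy]

theorem siteMoment_integrand_mem (h : IsReversiblePair P G w v) (x : V) (m : V → ℕ) :
    ∀ᵐ s ∂P, ∏ y, w s x y ^ m y ∈ Set.Icc (0 : ℝ) 1 := by
  filter_upwards [h.env] with s hs
  exact ⟨Finset.prod_nonneg fun y _ => pow_nonneg (hs.mem_Icc x y).1 _,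
    Finset.prod_le_one (fun y _ => pow_nonneg (hs.mem_Icc x y).1 _)
      fun y _ => pow_le_one₀ (hs.mem_Icc x y).1 (hs.mem_Icc x y).2⟩

theorem integrable_siteMoment [IsProbabilityMeasure P] (h : IsReversiblePair P G w v) (x : V)
    (m : V → ℕ) : Integrable (fun s => ∏ y, w s x y ^ m y) P := by
  refine Integrable.of_bound (C := 1) (Measurable.aestronglyMeasurable ?_) ?_
  · exact Finset.measurable_fun_prod _ fun y _ => (h.measurable_apply x y).pow_const _
  · filter_upwards [h.siteMoment_integrand_mem x m] with s hs
    rw [Real.norm_of_nonneg hs.1]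
    exact hs.2

theorem siteMoment_pos [IsProbabilityMeasure P] (h : IsReversiblePair P G w v) (x : V) (m : V → ℕ)
    (hm : ∀ y, m y ≠ 0 → G.Adj x y) : 0 < siteMoment P w x m := by
  rw [siteMoment, integral_pos_iff_support_of_nonneg_ae
    ((h.siteMoment_integrand_mem x m).mono fun s hs => hs.1) (h.integrable_siteMoment x m)]
  refine lt_of_lt_of_le (pos_iff_ne_zero.2 (h.measure_forall_pos_ne_zero x))
    (measure_mono fun s hs => ?_)
  refine Finset.prod_ne_zero_iff.2 fun y _ => ?_
  by_cases hy : m y = 0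
  · simp [hy]
  · exact pow_ne_zero _ (hs y (hm y hy)).ne'

theorem prod_pow_add_single [DecidableEq V] (r : V → ℝ) (m : V → ℕ) (y : V) :
    ∏ z, r z ^ (m + Pi.single y 1 : V → ℕ) z = (∏ z, r z ^ m z) * r y := by
  simp only [Pi.add_apply, pow_add, Finset.prod_mul_distrib]
  congr 1
  rw [Finset.prod_eq_single y (fun z _ hz => by simp [hz]) (by simp)]
  simp

theorem isMomentFamily [DecidableEq V] [IsProbabilityMeasure P] (h : IsReversiblePair P G w v) :
    IsMomentFamily G (siteMoment P w) := by
  refine ⟨fun x => by simp [siteMoment], fun x m hm => h.siteMoment_pos x m hm, fun x m hm => ?_⟩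
  classical
  unfold siteMoment
  rw [← integral_finsetSum _ fun y _ => h.integrable_siteMoment x _]
  refine integral_congr_ae ?_
  filter_upwards [h.env] with s hs
  simp only [prod_pow_add_single]
  rw [← Finset.mul_sum]
  have : ∑ y : {y // G.Adj x y}, w s x y = 1 := by
    rw [← hs.sum_eq_one x, ← Finset.sum_subtype (Finset.univ.filter fun y => G.Adj x y)
      (by simp) fun y => w s x y]
    refine Finset.sum_filter_of_ne fun y _ hy => ?_
    by_contra hxy
    exact hy (hs.eq_zero_of_not_adj x y hxy)
  convert mul_one _

theorem integral_prod_eq [IsProbabilityMeasure P] (h : IsReversiblePair P G w v)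
    (n : V → V → ℕ) :
    ∫ s, ∏ x, ∏ y, w s x y ^ n x y ∂P = ∏ x, siteMoment P w x (n x) :=
  iIndepFun.integral_fun_prod_comp (f := fun x r => ∏ y, r y ^ n x y) h.indep
    (fun x => ((measurable_pi_apply x).comp h.measurable).aemeasurable)
    fun x => Measurable.aestronglyMeasurable (by fun_prop)

/-- Each p(x) occurs in the numerator as often as there is outgoing flow at x, and in the
denominator as often as there is incoming flow. -/
theorem prod_reversedEnvironment {w : V → V → ℝ} {p : V → ℝ} (hp : ∀ x, 0 < p x) {n : V → V → ℕ}
    (hn : ∀ x, ∑ y, n x y = ∑ y, n y x) :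
    ∏ y, ∏ x, reversedEnvironment w p y x ^ n x y = ∏ x, ∏ y, w x y ^ n x y := by
  simp only [reversedEnvironment, mul_pow, div_pow, Finset.prod_mul_distrib,
    Finset.prod_div_distrib]
  rw [Finset.prod_comm (f := fun y x => w x y ^ n x y),
    Finset.prod_comm (f := fun y x => p x ^ n x y)]
  simp only [Finset.prod_pow_eq_pow_sum, hn]
  rw [div_self, mul_one]
  exact Finset.prod_ne_zero_iff.2 fun x _ => pow_ne_zero _ (hp x).ne'

/-- The off-diagonal entries of the flow serve as exponents. The two products agree almost surely,
and each expectation factorises over the sites of its own environment. -/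
theorem flowEquation [DecidableEq V] [IsProbabilityMeasure P] (h : IsReversiblePair P G w v) :
    FlowEquation G (fun x m => Real.log (siteMoment P w x m))
      (fun x m => Real.log (siteMoment P v x m)) := by
  intro K hK
  have hcol : ∀ x y, offDiag y (fun a => K a y) x = offDiag x (K x) y := by
    intro x y
    simp only [offDiag, eq_comm]
  have hadj : ∀ x y, offDiag x (K x) y ≠ 0 → G.Adj x y := by
    intro x y hxy
    have hne : y ≠ x := fun e => hxy (by simp [offDiag, e])
    have hK0 : K x y ≠ 0 := fun e => hxy (by simp [offDiag, e])
    exact (hK.inc x y hK0).resolve_right hne.symm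
  have hcast : ∀ x y, ((offDiag x (K x) y : ℕ) : ℤ) = K x y - if y = x then K x y else 0 := by
    intro x y
    by_cases hxy : y = x
    · simp [offDiag, hxy]
    · simp [offDiag, hxy, hK.nonneg x y (Ne.symm hxy)]
  have hbal : ∀ x, ∑ y, offDiag x (K x) y = ∑ y, offDiag y (K y) x := by
    intro x
    have h1 : ∑ y, K x y = 0 := congrFun hK.closed (.inl x)
    have h2 : ∑ y, K y x = 0 := congrFun hK.closed (.inr x)
    zify
    simp only [hcast, Finset.sum_sub_distrib, h1, h2]
    simp
  have hprod : ∏ x, siteMoment P w x (offDiag x (K x)) =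
      ∏ x, siteMoment P v x (offDiag x fun a => K a x) := by
    rw [← h.integral_prod_eq fun x => offDiag x (K x),
      ← h.symm.integral_prod_eq fun x => offDiag x fun a => K a x]
    refine integral_congr_ae ?_
    filter_upwards [h.reversal] with s ⟨p, hp, hv⟩
    simp only [hcol, hv]
    exact (prod_reversedEnvironment hp hbal).symm
  have := congrArg Real.log hprod
  rwa [Real.log_prod fun x _ => (h.siteMoment_pos x _ (hadj x)).ne',
    Real.log_prod fun y _ => (h.symm.siteMoment_pos y _ fun x hx =>
      hadj x y (by rwa [← hcol])).ne'] at this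

/-- Without reinforcement, two steps of the recursion give a second moment equal to the square of
the mean, so the variance of each entry is zero. -/
theorem isDeterministic_of_isUrn_zero [DecidableEq V] [IsProbabilityMeasure P]
    [∀ x, Fintype {y // G.Adj x y}] (h : IsReversiblePair P G w v)
    (hurn : ∀ x, ∃ b, IsUrn (fun m => siteMoment P w x (extendOut G x m)) b 0) :
    IsDeterministic P w := by
  have key : ∀ x y, ∃ c, ∀ᵐ s ∂P, w s x y = c := by
    intro x y
    by_cases hxy : G.Adj x y
    swap
    · exact ⟨0, h.env.mono fun s hs => hs.eq_zero_of_not_adj x y hxy⟩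
    obtain ⟨b, hb⟩ := hurn x
    have : Nonempty {y // G.Adj x y} := ⟨⟨y, hxy⟩⟩
    have htot : 0 < ∑ i, b i := Finset.sum_pos (fun i _ => hb.pos i) Finset.univ_nonempty
    have e1 := hb.step 0 ⟨y, hxy⟩
    have e2 := hb.step (Pi.single ⟨y, hxy⟩ 1) ⟨y, hxy⟩
    simp only [extendOut_add, extendOut_single, extendOut_zero, zero_mul, add_zero] at e1 e2
    have m1 : siteMoment P w x (0 + Pi.single y 1) = ∫ s, w s x y ∂P := by
      simp only [siteMoment, prod_pow_add_single]
      simp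
    have m2 : siteMoment P w x (Pi.single y 1 + Pi.single y 1) = ∫ s, w s x y ^ 2 ∂P := by
      have hone : ∀ s, ∏ z, w s x z ^ (Pi.single y 1 : V → ℕ) z = w s x y := fun s => by
        simpa using prod_pow_add_single (w s x) 0 y
      simp only [siteMoment, prod_pow_add_single, hone, sq]
    rw [zero_add] at e1 m1
    rw [m1] at e1
    rw [m1, m2] at e2
    have hzero : siteMoment P w x 0 = 1 := by simp [siteMoment]
    rw [hzero, one_mul] at e1
    set q := ∫ s, w s x y ∂P with hq
    have hmeas := h.measurable_apply x y
    have hbdd : ∀ᵐ s ∂P, ‖w s x y‖ ≤ 1 := h.env.mono fun s hs => by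
      rw [Real.norm_of_nonneg (hs.mem_Icc x y).1]
      exact (hs.mem_Icc x y).2
    have hI1 : Integrable (fun s => w s x y) P :=
      Integrable.of_bound hmeas.aestronglyMeasurable 1 hbdd
    have hI2 : Integrable (fun s => w s x y ^ 2) P :=
      Integrable.of_bound (hmeas.pow_const 2).aestronglyMeasurable 1
        (hbdd.mono fun s hs => by rw [norm_pow]; exact pow_le_one₀ (norm_nonneg _) hs)
    have hI3 : Integrable (fun s => 2 * w s x y * q) P := (hI1.const_mul 2).mul_const q
    have hI4 : Integrable (fun s => w s x y ^ 2 - 2 * w s x y * q) P := hI2.sub hI3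
    have hvar : ∫ s, (w s x y - q) ^ 2 ∂P = 0 := by
      simp only [sub_sq]
      rw [integral_add hI4 (integrable_const _), integral_sub hI2 hI3,
        integral_mul_const, integral_const_mul, ← hq]
      simp only [integral_const, probReal_univ, one_smul]
      apply mul_right_cancel₀ htot.ne'
      linear_combination e2 - q * e1
    refine ⟨q, ?_⟩
    rw [integral_eq_zero_iff_of_nonneg (fun s => sq_nonneg _)] at hvar
    · filter_upwards [hvar] with s hs
      exact sub_eq_zero.1 (pow_eq_zero_iff two_ne_zero |>.1 hs)
    · have : Integrable (fun s => w s x y ^ 2 - 2 * w s x y * q + q ^ 2) P :=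
        hI4.add (integrable_const _)
      simpa only [sub_sq] using this
  choose c hc using key
  refine ⟨c, ?_⟩
  filter_upwards [ae_all_iff.2 fun x => ae_all_iff.2 (hc x)] with s hs
  ext x y
  exact hs x y

theorem hasDirichletLaw_of_isUrn_one [DecidableEq V] [IsProbabilityMeasure P] {x : V}
    [Fintype {y // G.Adj x y}] [Nonempty {y // G.Adj x y}] (h : IsReversiblePair P G w v)
    {a : V → ℝ}
    (hurn : IsUrn (fun m => siteMoment P w x (extendOut G x m)) (fun i => a i.1) 1) :
    HasDirichletLaw P (fun s (y : {y // G.Adj x y}) => w s x y) (fun y => a y) := by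
  have hmeas : Measurable fun s (y : {y // G.Adj x y}) => w s x y :=
    measurable_pi_lambda _ fun y => h.measurable_apply x y
  refine Dirichlet.hasDirichletLaw_of_isUrn hmeas.aemeasurable
    (h.env.mono fun s hs y => hs.mem_Icc x y) ?_
  convert hurn using 2 with m
  classical
  refine integral_congr_ae (Filter.Eventually.of_forall fun s => ?_)
  have h1 := Finset.prod_filter_of_ne (s := Finset.univ)
    (f := fun y => w s x y ^ extendOut G x m y) (p := fun y => G.Adj x y) fun y _ hy =>
      extendOut_supp x m y fun h0 => hy (by rw [h0, pow_zero])
  rw [Finset.prod_subtype (p := fun y => G.Adj x y) (Finset.univ.filter fun y => G.Adj x y)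
    (by simp)] at h1
  simp only [← h1]
  refine Finset.prod_congr rfl fun y _ => ?_
  simp [extendOut, y.2]

end IsReversiblePair

/-- With at most two vertices and no loops, each site has only one possible target, which receives
all the mass. -/
theorem RandomEnvironment.isDeterministic_of_not_hasThree {Ω : Type*} [MeasurableSpace Ω]
    {P : Measure Ω} {w : Ω → V → V → ℝ} (hV : ¬ HasThree V) (hloop : ∀ x, ¬ G.Adj x x)
    (hw : ∀ᵐ s ∂P, IsEnvironment G (w s)) : IsDeterministic P w := by
  classical
  refine ⟨fun x y => if x = y then 0 else 1, ?_⟩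
  unfold HasThree at hV
  push Not at hV
  obtain ⟨a, b, hab⟩ := hV
  filter_upwards [hw] with s hs
  ext x y
  by_cases hxy : x = y
  · subst hxy
    simpa using hs.eq_zero_of_not_adj x x (hloop x)
  · rw [if_neg hxy, ← hs.sum_eq_one x, Finset.sum_eq_single y]
    · intro z _ hzy
      have : z = x := by
        have hx := or_iff_not_imp_left.2 (hab x)
        have hy := or_iff_not_imp_left.2 (hab y)
        have hz := or_iff_not_imp_left.2 (hab z)
        grind
      rw [this]
      exact hs.eq_zero_of_not_adj x x (hloop x)
    · simp

end

theorem theorem1 {V : Type*} [Fintype V] (G : Digraph V)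
    (hloop : ∀ x, ¬ G.Adj x x)
    (hG : RandomEnvironment.TwoConnected G)
    (hG' : RandomEnvironment.TwoConnected (RandomEnvironment.reverse G))
    {Ω : Type*} [MeasurableSpace Ω] (P : Measure Ω) [IsProbabilityMeasure P]
    (ω : Ω → V → V → ℝ) (hω_meas : Measurable ω)
    (hω : ∀ᵐ s ∂P, RandomEnvironment.IsEnvironment G (ω s))
    (hω_pos : ∀ x y, G.Adj x y → 0 < ∫ s, ω s x y ∂P)
    (hω_indep : RandomEnvironment.IndependentSites P ω)
    (π : Ω → V → ℝ) (hπ_meas : Measurable π)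
    (hπ : ∀ᵐ s ∂P, RandomEnvironment.IsPositiveStationary (ω s) (π s))
    (hrev_indep : RandomEnvironment.IndependentSites P
      (fun s => RandomEnvironment.reversedEnvironment (ω s) (π s))) :
    RandomEnvironment.IsDeterministic P ω ∨
      ∃ α : V → V → ℝ, RandomEnvironment.NullDivergence G α ∧
        RandomEnvironment.IsDirichletEnvironment P G ω α := by
  classical
  by_cases hV : HasThree V
  swap
  · exact Or.inl (isDeterministic_of_not_hasThree hV hloop hω)
  have hpair : IsReversiblePair P G ω fun s => reversedEnvironment (ω s) (π s) := by
    refine ⟨hω_meas, ?_, hω, ?_, ?_, fun x y hxy h0 => ?_, hω_indep, hrev_indep⟩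
    · have h1 : ∀ x, Measurable fun s => π s x := fun x => (measurable_pi_apply x).comp hπ_meas
      refine measurable_pi_lambda _ fun x => measurable_pi_lambda _ fun y => ?_
      exact ((measurable_pi_apply x).comp ((measurable_pi_apply y).comp hω_meas)).mul
        ((h1 y).div (h1 x))
    · filter_upwards [hω, hπ] with s h1 h2
      exact h2.isEnvironment_reversed h1
    · exact hπ.mono fun s hs => ⟨π s, hs.pos, rfl⟩
    · refine (hω_pos x y hxy).not_ge (integral_nonpos_of_ae ?_)
      filter_upwards [measure_eq_zero_iff_ae_notMem.1 h0] with s hs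
      exact not_lt.1 hs
  rcases hpair.isMomentFamily.isUrn_or hV hloop hG hG' hpair.symm.isMomentFamily
    hpair.flowEquation with h | ⟨α, hα, h⟩
  · exact Or.inl (hpair.isDeterministic_of_isUrn_zero h)
  · refine Or.inr ⟨α, hα, hω_indep, fun x => ?_⟩
    have : Nontrivial {y // G.Adj x y} := nontrivial_out hV hloop hG' x
    exact hpair.hasDirichletLaw_of_isUrn_one (h x)
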